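/- Let $V\in C^{1,1}(\mathbb R^d;\mathbb R)$, i.e. $V\in C^1$ with $V,\nabla V$ bounded and $\nabla V$ Lipschitz, and let $R\in\mathbb R$. For $\hbar>0$ put $M=\hbar^{-d}$, $\hat p=-i\hbar\nabla$, and let $\hat x$ be multiplication by $x$ on $L^2(\mathbb R^d)=L^2(\mathbb R^d;\mathbb C)$. **States.** $\mathscr P_2(\mathbb R^{2d})$ is the set of probability densities $f\in L^1(\mathbb R^{2d})$ with $\int(|x|^2+|p|^2)f\,dx\,dp<\infty$; $\mathcal P_2(L^2)$ is the set of trace-class operators $\omega=\omega^*\ge 0$ on $L^2(\mathbb R^d)$ with $\mathrm{Tr}\,\omega=M$ and $\mathrm{Tr}\,[\omega^{1/2}(\hat x^2+\hat p^2)\omega^{1/2}]<\infty$. **Distance.** For such $f,\omega$ let $\mathcal C(f,\omega)$ be the set of weakly measurable $Q:\mathbb R^{2d}\to\mathscr B(L^2(\mathbb R^d))$ with $Q(x,p)=Q(x,p)^*\ge 0$ and $\mathrm{Tr}\,Q(x,p)=\hbar^{-d}f(x,p)$ for almost every $(x,p)$ and $\int Q(x,p)\,dx\,dp=\omega$ (weakly).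 With $c_\hbar(x,p)=\frac12(x-\hat x)^2+\frac12(p-\hat p)^2$ and $\mathrm{Tr}\,Qc_\hbar:=\mathrm{Tr}\,Q^{1/2}c_\hbar Q^{1/2}\in[0,\infty]$, set $$E_\hbar(f,\omega)=\hbar^{d/2}\inf_{Q\in\mathcal C(f,\omega)}\Big(\int_{\mathbb R^{2d}}\mathrm{Tr}\,[Q(x,p)\,c_\hbar(x,p)]\,dx\,dp\Big)^{1/2}\in[0,\infty].$$ **Equations.** The Hartree–Hartree equation, with initial data $(\omega_0^\hbar,\varphi_0^\hbar)$, is $$i\hbar\,\partial_t\omega_\hbar=\big[-\tfrac{\hbar^2}2\Delta+V*|\varphi_\hbar|^2,\ \omega_\hbar\big],\qquad i\,\partial_t\varphi_\hbar=-\tfrac12\Delta\varphi_\hbar+(V*\rho_\omega)\varphi_\hbar,\qquad \rho_\omega(t,x)=M^{-1}\omega_\hbar(t;x,x);$$ a solution is a pair in $C(\mathbb R;\mathscr L^1(L^2)\times L^2)$ ($\mathscr L^1$ being the trace class with its norm) satisfying the mild (Duhamel) form. The Vlasov–Hartree equation, with initial data $(f_0,\varphi_0)$, is $$\partial_tf+p\cdot\nabla_xf-(\nabla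 V*|\varphi|^2)\cdot\nabla_pf=0,\qquad i\,\partial_t\varphi=-\tfrac12\Delta\varphi+(V*\rho_f)\varphi,\qquad \rho_f(t,x)=\int f(t,x,p)\,dp;$$ a solution is a bounded measurable map $\mathbb R\to L^1(\mathbb R^{2d})\times L^2(\mathbb R^d)$ with $(f,\varphi)(0)=(f_0,\varphi_0)$ such that, for every Schwartz function $h$, the map $t\mapsto\langle f(t),h\rangle$ is differentiable on $\mathbb R$ with derivative $\langle f(t),(p\cdot\nabla_x-(\nabla V*|\varphi(t)|^2)\cdot\nabla_p)h\rangle$, and the equation for $\varphi$ holds in mild form. **Theorem 6.4.** There is a constant $C>0$, depending only on $V$ and $R$, such that the following holds for all $\hbar>0$. Let $f_0\in\mathscr P_2(\mathbb R^{2d})$, $\omega_0^\hbar\in\mathcal P_2(L^2)$ and $\varphi_0,\varphi_0^\hbar\in L^2(\mathbb R^d)$ with $\|\varphi_0\|_{L^2},\|\varphi_0^\hbar\|_{L^2}\le R$ (so $C=C(V)$ for normalized boson fields, $R=1$). Let $(\omega_\hbar,\varphi_\hbar)$ solve the Hartree–Hartree equation with initial data $(\omega_0^\hbar,\varphi_0^\hbar)$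 and let $(f,\varphi)$ solve the Vlasov–Hartree equation with initial data $(f_0,\varphi_0)$. Then for all $t\in\mathbb R$ one has $f(t)\in\mathscr P_2(\mathbb R^{2d})$, $\omega_\hbar(t)\in\mathcal P_2(L^2)$ and $$E_\hbar\big(f(t),\omega_\hbar(t)\big)+\|\varphi(t)-\varphi_\hbar(t)\|_{L^2}\le C e^{Ct^2}\Big(E_\hbar(f_0,\omega_0^\hbar)+\|\varphi_0-\varphi_0^\hbar\|_{L^2}\Big).$$ -/

import Mathlib

open MeasureTheory Filter Topology
open scoped ENNReal NNReal FourierTransform SchwartzMap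

noncomputable section

/-- Position (or momentum) space `ℝ^d` with its Euclidean norm. -/
abbrev Pos (d : ℕ) : Type := EuclideanSpace ℝ (Fin d)

/-- Phase space `ℝ^{2d}`, with points `z = (x, p)`; it carries Lebesgue measure. -/
abbrev Phase (d : ℕ) : Type := Pos d × Pos d

/-- The one-particle Hilbert space `L²(ℝ^d; ℂ)`. -/
abbrev L2 (d : ℕ) : Type := Lp ℂ 2 (volume : Measure (Pos d))

/-- Bounded operators on `L²(ℝ^d; ℂ)`. -/
abbrev Op (d : ℕ) : Type := L2 d →L[ℂ] L2 d

/-- The space `L¹(ℝ^{2d}; ℝ)`. -/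
abbrev PhaseL1 (d : ℕ) : Type := Lp ℝ 1 (volume : Measure (Phase d))

/-- The class `C^{1,1}(ℝ^d; ℝ)`: `V` is continuously differentiable, `V` and `∇V` are bounded, and
`∇V` is Lipschitz continuous. -/
structure IsC11 {d : ℕ} (V : Pos d → ℝ) : Prop where
  contDiff : ContDiff ℝ 1 V
  bounded : ∃ B : ℝ, ∀ x, |V x| ≤ B
  gradient_bounded : ∃ B : ℝ, ∀ x, ‖gradient V x‖ ≤ B
  gradient_lipschitz : ∃ L : ℝ≥0, LipschitzWith L (gradient V)

/-! ### Traces and trace-class operators -/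

section Trace

variable {H : Type*} [NormedAddCommGroup H] [InnerProductSpace ℂ H] [CompleteSpace H]

variable (H) in
/-- Index set of a fixed orthonormal basis of `H`. -/
def basisIndex : Set H := (exists_hilbertBasis ℂ H).choose

variable (H) in
/-- A fixed orthonormal (Hilbert) basis of `H`, used to write down traces. -/
def onb : HilbertBasis (basisIndex H) ℂ H :=
  (exists_hilbertBasis ℂ H).choose_spec.choose

/-- The square root `A^{1/2}` of a nonnegative operator. -/
def opSqrt (A : H →L[ℂ] H) : H →L[ℂ] H := CFC.sqrt A

/-- The absolute value `|A| = (A* A)^{1/2}`. -/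
def opAbs (A : H →L[ℂ] H) : H →L[ℂ] H := CFC.abs A

/-- The trace norm `Tr |A| ∈ [0,∞]`. -/
def traceNorm (A : H →L[ℂ] H) : ℝ≥0∞ :=
  ∑' i, ENNReal.ofReal (inner ℂ (onb H i) (opAbs A (onb H i))).re

/-- `A` is of trace class. -/
def IsTraceClass (A : H →L[ℂ] H) : Prop := traceNorm A < ∞

/-- The trace `Tr A` of a trace-class operator. -/
def opTrace (A : H →L[ℂ] H) : ℂ := ∑' i, inner ℂ (onb H i) (A (onb H i))

/-- `Tr (Q c) = Tr (Q^{1/2} c Q^{1/2}) ∈ [0,∞]` for `Q ≥ 0` and a nonnegative operator `c` that is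
given by its quadratic form `u ↦ ⟨u, c u⟩ ∈ [0,∞]`. -/
def traceForm (c : H → ℝ≥0∞) (Q : H →L[ℂ] H) : ℝ≥0∞ :=
  ∑' i, c (opSqrt Q (onb H i))

end Trace

/-! ### Multiplication operators, the free Schrödinger group, position densities -/

open Classical in
/-- The operator of multiplication by an essentially bounded function `a` on `L²(ℝ^d)`
(it is only used for such `a`). -/
def mulOp {d : ℕ} (a : Pos d → ℂ) : Op d :=
  if h : MemLp a ∞ (volume : Measure (Pos d)) then
    (ContinuousLinearMap.mul ℂ ℂ).holderL volume ∞ 2 2 (h.toLp a)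
  else 0

/-- The free Schrödinger group `e^{iτΔ/2}` on `L²(ℝ^d)`. With Mathlib's normalization of the Fourier
transform, `-Δ` is the Fourier multiplier `(2π|ξ|)²`. -/
def freeProp {d : ℕ} (τ : ℝ) (u : L2 d) : L2 d :=
  𝓕⁻ (mulOp (fun ξ : Pos d =>
    Complex.exp (-(Complex.I * ((τ * (2 * Real.pi * ‖ξ‖) ^ 2 / 2 : ℝ) : ℂ)))) (𝓕 u))

/-- `ρ` is the position density `ρ(x) = A(x; x)` of the trace-class operator `A`: the integrable
function, unique up to null sets, with `Tr (a A) = ∫ a ρ` for all bounded multipliers `a`. -/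
def IsPositionDensity {d : ℕ} (A : Op d) (ρ : Pos d → ℂ) : Prop :=
  Integrable ρ ∧ ∀ a : Pos d → ℂ, MemLp a ∞ (volume : Measure (Pos d)) →
    opTrace (mulOp a * A) = ∫ x, a x * ρ x

open Classical in
/-- The position density `x ↦ A(x; x)` of a trace-class operator `A`. -/
def positionDensity {d : ℕ} (A : Op d) : Pos d → ℂ :=
  if h : ∃ ρ, IsPositionDensity A ρ then h.choose else 0

/-- The convolution `(V * ρ)(x) = ∫ V(x - y) ρ(y) dy`. -/
def potential {d : ℕ} (V : Pos d → ℝ) (ρ : Pos d → ℂ) (x : Pos d) : ℂ :=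
  ∫ y, (V (x - y) : ℂ) * ρ y

/-- The bosonic position density `|φ|²`. -/
def bosonDensity {d : ℕ} (φ : L2 d) (x : Pos d) : ℂ := ((‖φ x‖ ^ 2 : ℝ) : ℂ)

/-- The fermionic position density `M⁻¹ ω(x; x)` of a density matrix, where `M = ħ^{-d}`. -/
def fermionDensity {d : ℕ} (ħ : ℝ) (ω : Op d) (x : Pos d) : ℂ :=
  ((ħ ^ d : ℝ) : ℂ) * positionDensity ω x

/-- The spatial density `∫ f(x,p) dp` of a phase-space density. -/
def spatialDensity {d : ℕ} (f : PhaseL1 d) (x : Pos d) : ℂ := ((∫ p, f (x, p) : ℝ) : ℂ)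

/-- The mean-field force `F_φ(x) = - ∫ ∇V(x - y) |φ(y)|² dy`. -/
def bosonForce {d : ℕ} (V : Pos d → ℝ) (φ : L2 d) (x : Pos d) : Pos d :=
  -∫ y, (‖φ y‖ ^ 2) • gradient V (x - y)

/-! ### The two evolution equations -/

/-- `(ω, φ) ∈ C(ℝ; 𝓛¹ × L²)` is the (global, mild) solution of the Hartree–Hartree equation
`iħ ∂ₜω = [-ħ²Δ/2 + V * |φ|², ω]`, `i ∂ₜφ = -Δφ/2 + (V * ρ_F) φ`, `ρ_F(x) = M⁻¹ ω(x;x)`, with initial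
datum `(ω₀, φ₀)`. The Duhamel formula for `ω` is evaluated on vectors `u ∈ L²`. -/
structure IsHartreeHartreeSolution {d : ℕ} (V : Pos d → ℝ) (ħ : ℝ) (ω₀ : Op d) (φ₀ : L2 d)
    (ω : ℝ → Op d) (φ : ℝ → L2 d) : Prop where
  traceClass : ∀ t, IsTraceClass (ω t)
  continuous_fermion : ∀ t₀, Tendsto (fun t => traceNorm (ω t - ω t₀)) (𝓝 t₀) (𝓝 0)
  continuous_boson : Continuous φ
  fermion_eq : ∀ (t : ℝ) (u : L2 d),
    ω t u = freeProp (ħ * t) (ω₀ (freeProp (-(ħ * t)) u))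
      - (Complex.I / (ħ : ℂ)) • ∫ s in (0 : ℝ)..t,
          freeProp (ħ * (t - s))
            ((mulOp (potential V (bosonDensity (φ s))) * ω s
                - ω s * mulOp (potential V (bosonDensity (φ s))))
              (freeProp (-(ħ * (t - s))) u))
  boson_eq : ∀ t : ℝ,
    φ t = freeProp t φ₀
      - Complex.I • ∫ s in (0 : ℝ)..t,
          freeProp (t - s) (mulOp (potential V (fermionDensity ħ (ω s))) (φ s))

/-- `(f, φ)` is the (global) weak-mild solution of the Vlasov–Hartree equation
`∂ₜf + p · ∇ₓf + F_φ · ∇ₚf = 0`, `i ∂ₜφ = -Δφ/2 + (V * ρ_f) φ`, `ρ_f(x) = ∫ f(x,p) dp`, with initial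
datum `(f₀, φ₀)`: a bounded measurable curve in `L¹ × L²` that satisfies the transport equation
against Schwartz functions and the Schrödinger equation in mild form. -/
structure IsVlasovHartreeSolution {d : ℕ} (V : Pos d → ℝ) (f₀ : PhaseL1 d) (φ₀ : L2 d)
    (f : ℝ → PhaseL1 d) (φ : ℝ → L2 d) : Prop where
  measurable_fermion : StronglyMeasurable f
  measurable_boson : StronglyMeasurable φ
  bounded : ∃ B : ℝ, ∀ t, ‖f t‖ ≤ B ∧ ‖φ t‖ ≤ B
  initial_fermion : f 0 = f₀
  initial_boson : φ 0 = φ₀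
  fermion_eq : ∀ (h : 𝓢(Phase d, ℝ)) (t : ℝ),
    HasDerivAt (fun s => ∫ z, f s z * h z)
      (∫ z, f t z * fderiv ℝ h z (z.2, bosonForce V (φ t) z.1)) t
  boson_eq : ∀ t : ℝ,
    φ t = freeProp t φ₀
      - Complex.I • ∫ s in (0 : ℝ)..t,
          freeProp (t - s) (mulOp (potential V (spatialDensity (f s))) (φ s))

/-! ### Classical and quantum states, and the quantum Wasserstein distance -/

/-- `f ∈ 𝒫₂(ℝ^{2d})`: a probability density on phase space with finite second moments. -/
structure IsClassicalState {d : ℕ} (f : PhaseL1 d) : Prop where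
  nonneg : ∀ᵐ z, 0 ≤ f z
  integral_eq_one : ∫ z, f z = 1
  second_moment : Integrable (fun z : Phase d => (‖z.1‖ ^ 2 + ‖z.2‖ ^ 2) * f z)

/-- The quadratic form
`⟨u, c_ħ(x,p) u⟩ = ½ ‖(x - x̂) u‖² + ½ ‖(p - p̂) u‖² ∈ [0,∞]` of the cost operator
`c_ħ(x,p) = ½ (x - x̂)² + ½ (p - p̂)²`, with the value `∞` off the form domain. The
momentum operator `p̂ = -iħ∇` is the Fourier multiplier `2πħξ`. -/
def costForm {d : ℕ} (ħ : ℝ) (x p : Pos d) (u : L2 d) : ℝ≥0∞ :=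
  2⁻¹ * (∫⁻ y, ‖x - y‖ₑ ^ 2 * ‖u y‖ₑ ^ 2)
    + 2⁻¹ * (∫⁻ ξ, ‖p - (2 * Real.pi * ħ) • ξ‖ₑ ^ 2 * ‖(𝓕 u : L2 d) ξ‖ₑ ^ 2)

/-- A quantum state `ω`, i.e. `ω = ω* ≥ 0` of trace class with `Tr ω = M = ħ^{-d}`, with finite
second moments `Tr (ω^{1/2} (x̂² + p̂²) ω^{1/2}) < ∞`. -/
structure IsQuantumState {d : ℕ} (ħ : ℝ) (ω : Op d) : Prop where
  nonneg : 0 ≤ ω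
  traceClass : IsTraceClass ω
  trace_eq : opTrace ω = (((ħ ^ d)⁻¹ : ℝ) : ℂ)
  second_moment : traceForm (costForm ħ 0 0) ω < ∞

/-- `Q` is a coupling of the phase-space density `f` and the density matrix `ω`: a weakly measurable
operator-valued function on phase space with `Q(x,p) = Q(x,p)* ≥ 0` and `Tr Q(x,p) = ħ^{-d} f(x,p)`
almost everywhere, and `∫ Q(x,p) dx dp = ω`. -/
structure IsCoupling {d : ℕ} (ħ : ℝ) (f : PhaseL1 d) (ω : Op d) (Q : Phase d → Op d) : Prop where
  measurable : ∀ u v : L2 d, AEStronglyMeasurable (fun z => inner ℂ u (Q z v)) volume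
  nonneg : ∀ᵐ z, 0 ≤ Q z
  integral_eq : ∀ u v : L2 d, Integrable (fun z => inner ℂ u (Q z v)) ∧
    ∫ z, inner ℂ u (Q z v) = inner ℂ u (ω v)
  trace_eq : ∀ᵐ z, IsTraceClass (Q z) ∧ opTrace (Q z) = (((ħ ^ d)⁻¹ * f z : ℝ) : ℂ)

/-- The second quantum Wasserstein (pseudo-)distance
`E_ħ(f, ω) = ħ^{d/2} inf_Q (∫ Tr (Q(x,p) c_ħ(x,p)) dx dp)^{1/2} ∈ [0,∞]`, the infimum being over all
couplings `Q` of `f` and `ω`. -/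
def quantumWasserstein {d : ℕ} (ħ : ℝ) (f : PhaseL1 d) (ω : Op d) : ℝ≥0∞ :=
  ENNReal.ofReal (ħ ^ ((d : ℝ) / 2)) *
    ⨅ (Q : Phase d → Op d) (_ : IsCoupling ħ f ω Q),
      (∫⁻ z, traceForm (costForm ħ z.1 z.2) (Q z)) ^ (1 / 2 : ℝ)

end

/-! Both fermion states are transported by their own dynamics: `f t` is `f₀` carried along the
Newton flow `Φ_t` of the force `-∇V * |φ|²`, and `ω t` is `U_t ω₀ U_t*`, where `U_t` is the unitary
propagator with potential `V * |φħ|²`. Hence every coupling `Q` of the initial data yields the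
coupling `z ↦ U_t Q(Φ_t⁻¹ z) U_t*` at time `t`. Only its cost has to be estimated, and it need not
be optimal at time `t`.

The core is `costForm_propagator_le`. Formally, the time derivative of the cost contains `(x -
x̂)·(p - p̂)` and `(p - p̂)·(F(x) - G(x̂))`. Since `F - G` is bounded by `L'|x - x̂|` plus a
multiple of `‖φ - φħ‖`, Grönwall gives exponential growth. To avoid domain questions for unbounded
operators, both evolutions are split into kicks and drifts. For one kick or drift the Weyl relations
between `e^{iax̂}`, `e^{iap̂}` and the unitary step are exact, and the limit `a → 0` recovers `x̂`
and `p̂` (`wNorm_le_of_phase`). Convergence of the splitting and lower semicontinuity of the cost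
(`costForm_le_of_tendsto`) carry the bound to the true evolutions.

Conversely, the boson equations see the fermions only through `V * ρ`. A coupling of cost `c` bounds
the difference of the two potentials by `B'(θ/2 + ħ^d c/θ)` for every `θ > 0`
(`IsCoupling.abs_potential_sub_le`), as in the comparison of the first and second Wasserstein
distances. Duhamel's formula then bounds `φ - φħ` by the cost. The loop is closed in
`norm_boson_sub_le`: the maximum of `e^{-λ|s|}‖φ - φħ‖` is bounded by data plus half of itself once
`λ` is large. The growth rate is `e^{λ|t|}`, which is stronger than the claimed `e^{Ct²}`.

The solution concepts are weak, so the transport formulas need proof. For the Vlasov equation a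
mollifier centred on a trajectory is used as test function: the Newton field is divergence free, and
its Lipschitz bound makes the commutator vanish with the mollification scale
(`IsWeakTransport.ae_eq_flow`). For the von Neumann equation the interaction picture turns the mild
formula into an ordinary differential equation (`eq_conjOp_of_mild`). Conservation of the boson
norms follows only after the fermion potentials are known to be regular in time. -/

/-! ### Ordinary differential equations with globally Lipschitz right-hand side -/

section ODE

variable {E : Type*} [NormedAddCommGroup E] [NormedSpace ℝ E]

/-- A primitive of a function of exponential growth has the same exponential growth. -/
theorem norm_intervalIntegral_le_exp {g : ℝ → E} {A lam t₀ : ℝ} (hlam : 0 < lam) (t : ℝ)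
    (hg : ∀ s ∈ Set.uIcc t₀ t, ‖g s‖ ≤ A * Real.exp (lam * |s - t₀|)) :
    ‖∫ s in t₀..t, g s‖ ≤ A / lam * (Real.exp (lam * |t - t₀|) - 1) := by
  rcases le_total t₀ t with h | h
  · have h1 : ‖∫ s in t₀..t, g s‖ ≤ ∫ s in t₀..t, A * Real.exp (lam * (s - t₀)) := by
      apply intervalIntegral.norm_integral_le_of_norm_le h
      · refine Eventually.of_forall fun s hs => ?_
        have := hg s (by rw [Set.uIcc_of_le h]; exact ⟨hs.1.le, hs.2⟩)
        rwa [abs_of_nonneg (by linarith [hs.1])] at this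
      · exact (by fun_prop : Continuous fun s => A * Real.exp (lam * (s - t₀))).intervalIntegrable _ _
    have h2 : ∫ s in t₀..t, A * Real.exp (lam * (s - t₀))
        = A / lam * Real.exp (lam * (t - t₀)) - A / lam * Real.exp (lam * (t₀ - t₀)) := by
      apply intervalIntegral.integral_eq_sub_of_hasDerivAt (f := fun s => A / lam * Real.exp (lam * (s - t₀)))
      · intro s _
        have : HasDerivAt (fun s => lam * (s - t₀)) lam s := by
          simpa using ((hasDerivAt_id s).sub_const t₀).const_mul lam
        convert! (this.exp).const_mul (A / lam) using 1
        field_simp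
      · exact (by fun_prop : Continuous fun s => A * Real.exp (lam * (s - t₀))).intervalIntegrable _ _
    rw [abs_of_nonneg (by linarith)]
    rw [h2] at h1
    simp only [sub_self, mul_zero, Real.exp_zero] at h1
    linarith
  · have h1 : ‖∫ s in t₀..t, g s‖ ≤ ∫ s in t..t₀, A * Real.exp (lam * (t₀ - s)) := by
      rw [intervalIntegral.integral_symm, norm_neg]
      apply intervalIntegral.norm_integral_le_of_norm_le h
      · refine Eventually.of_forall fun s hs => ?_
        have := hg s (by rw [Set.uIcc_of_ge h]; exact ⟨hs.1.le, hs.2⟩)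
        rwa [abs_of_nonpos (by linarith [hs.2]), neg_sub] at this
      · exact (by fun_prop : Continuous fun s => A * Real.exp (lam * (t₀ - s))).intervalIntegrable _ _
    have h2 : ∫ s in t..t₀, A * Real.exp (lam * (t₀ - s))
        = -(A / lam) * Real.exp (lam * (t₀ - t₀)) - -(A / lam) * Real.exp (lam * (t₀ - t)) := by
      apply intervalIntegral.integral_eq_sub_of_hasDerivAt (f := fun s => -(A / lam) * Real.exp (lam * (t₀ - s)))
      · intro s _
        have : HasDerivAt (fun s => lam * (t₀ - s)) (-lam) s := by
          simpa using ((hasDerivAt_id s).const_sub t₀).const_mul lam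
        convert! (this.exp).const_mul (-(A / lam)) using 1
        field_simp
      · exact (by fun_prop : Continuous fun s => A * Real.exp (lam * (t₀ - s))).intervalIntegrable _ _
    rw [abs_of_nonpos (by linarith), neg_sub]
    rw [h2] at h1
    simp only [sub_self, mul_zero, Real.exp_zero] at h1
    linarith

/-- Time-dependent vector fields that are continuous in time, `K`-Lipschitz in space, and bounded in
time at each point. -/
structure IsLipschitzField (v : ℝ → E → E) (K : ℝ≥0) : Prop where
  continuous : ∀ x, Continuous fun t => v t x
  lipschitz : ∀ t, LipschitzWith K (v t)
  bounded : ∀ x, ∃ M, ∀ t, ‖v t x‖ ≤ M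

namespace IsLipschitzField

variable {v : ℝ → E → E} {K : ℝ≥0}

theorem continuous_comp (hv : IsLipschitzField v K) {y : ℝ → E} (hy : Continuous y) :
    Continuous fun t => v t (y t) := by
  have : Continuous (Function.uncurry fun t x => v t x) :=
    continuous_prod_of_continuous_lipschitzWith' _ K hv.lipschitz hv.continuous
  exact this.comp (continuous_id.prodMk hy)

theorem neg (hv : IsLipschitzField v K) : IsLipschitzField (fun t x => -v (-t) x) K where
  continuous x := ((hv.continuous x).comp continuous_neg).neg
  lipschitz t := (hv.lipschitz (-t)).neg
  bounded x := by
    obtain ⟨M, hM⟩ := hv.bounded x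
    exact ⟨M, fun t => by simpa using hM (-t)⟩

-- Picard iteration for the weighted unknown `w = e^{-λ|s - t₀|}(y - x₀)` in the sup norm. With `λ =
-- 2(K + 1)` the contraction constant `K/λ` is below `1/2` on the whole line, so the solution is
-- global at once, without continuation. Boundedness in time of `v` at `x₀` keeps the iterates in
-- the weighted space.
open BoundedContinuousFunction in
theorem exists_solution [CompleteSpace E] (hv : IsLipschitzField v K) (t₀ : ℝ) (x₀ : E) :
    ∃ y : ℝ → E, y t₀ = x₀ ∧ ∀ t, HasDerivAt y (v t (y t)) t := by
  obtain ⟨M, hM⟩ := hv.bounded x₀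
  have hM0 : 0 ≤ M := (norm_nonneg _).trans (hM 0)
  set lam : ℝ := 2 * (K + 1) with hlam
  have hK : (0 : ℝ) ≤ K := K.2
  have hlam0 : 0 < lam := by positivity
  let Y : (ℝ →ᵇ E) → ℝ → E := fun w s => x₀ + Real.exp (lam * |s - t₀|) • w s
  have hY : ∀ w, Continuous (Y w) := fun w => by
    have := w.continuous
    fun_prop
  have hvY : ∀ w, Continuous fun s => v s (Y w s) := fun w => hv.continuous_comp (hY w)
  have hexp : ∀ s, 1 ≤ Real.exp (lam * |s - t₀|) := fun s => Real.one_le_exp (by positivity)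
  have hbd : ∀ (w : ℝ →ᵇ E) s, ‖v s (Y w s)‖ ≤ (M + K * ‖w‖) * Real.exp (lam * |s - t₀|) := by
    intro w s
    have h1 := (hv.lipschitz s).norm_sub_le (Y w s) x₀
    have h2 : ‖Y w s - x₀‖ ≤ Real.exp (lam * |s - t₀|) * ‖w‖ := by
      simp only [Y, add_sub_cancel_left, norm_smul, Real.norm_eq_abs, Real.abs_exp]
      gcongr
      exact w.norm_coe_le_norm s
    have h3 := norm_le_norm_add_norm_sub' (v s (Y w s)) (v s x₀)
    have h4 := hM s
    have h5 : (K : ℝ) * ‖Y w s - x₀‖ ≤ K * (Real.exp (lam * |s - t₀|) * ‖w‖) := by gcongr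
    nlinarith [hexp s]
  have hdiff : ∀ (w w' : ℝ →ᵇ E) s, ‖v s (Y w s) - v s (Y w' s)‖
      ≤ (K * dist w w') * Real.exp (lam * |s - t₀|) := by
    intro w w' s
    have h1 := (hv.lipschitz s).norm_sub_le (Y w s) (Y w' s)
    have h2 : ‖Y w s - Y w' s‖ ≤ Real.exp (lam * |s - t₀|) * dist w w' := by
      simp only [Y, add_sub_add_left_eq_sub, ← smul_sub, norm_smul, Real.norm_eq_abs, Real.abs_exp]
      gcongr
      rw [← dist_eq_norm]
      exact dist_coe_le_dist s
    calc _ ≤ _ := h1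
      _ ≤ K * (Real.exp (lam * |s - t₀|) * dist w w') := by gcongr
      _ = _ := by ring
  let G : (ℝ →ᵇ E) → ℝ → E := fun w t => Real.exp (-(lam * |t - t₀|)) • ∫ s in t₀..t, v s (Y w s)
  have hGc : ∀ w, Continuous (G w) := fun w => by
    have : Continuous fun t => ∫ s in t₀..t, v s (Y w s) :=
      intervalIntegral.continuous_primitive (fun a b => (hvY w).intervalIntegrable a b) t₀
    fun_prop
  have key : ∀ (g : ℝ → E) (A : ℝ), 0 ≤ A → (∀ s, ‖g s‖ ≤ A * Real.exp (lam * |s - t₀|)) → ∀ t,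
      ‖Real.exp (-(lam * |t - t₀|)) • ∫ s in t₀..t, g s‖ ≤ A / lam := by
    intro g A hA hg t
    have := norm_intervalIntegral_le_exp hlam0 t (t₀ := t₀) (A := A) (g := g) fun s _ => hg s
    rw [norm_smul, Real.norm_eq_abs, Real.abs_exp]
    have h3 : Real.exp (-(lam * |t - t₀|)) * Real.exp (lam * |t - t₀|) = 1 := by
      rw [← Real.exp_add]; simp
    calc _ ≤ Real.exp (-(lam * |t - t₀|)) * (A / lam * Real.exp (lam * |t - t₀|)) := by
          gcongr
          refine this.trans ?_
          gcongr
          linarith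
      _ = _ := by linear_combination (A / lam) * h3
  let Γ : (ℝ →ᵇ E) → (ℝ →ᵇ E) := fun w => ofNormedAddCommGroup (G w) (hGc w) ((M + K * ‖w‖) / lam)
    (key _ _ (by positivity) (hbd w))
  have hcontr : ContractingWith (1/2) Γ := by
    refine ⟨by norm_num, LipschitzWith.of_dist_le_mul fun w w' => ?_⟩
    rw [dist_le (by positivity)]
    intro t
    simp only [Γ, coe_ofNormedAddCommGroup, G, dist_eq_norm]
    rw [← smul_sub, ← intervalIntegral.integral_sub ((hvY w).intervalIntegrable _ _)
      ((hvY w').intervalIntegrable _ _), ← dist_eq_norm]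
    refine (key _ _ (by positivity) (hdiff w w') t).trans ?_
    rw [div_le_iff₀ hlam0, hlam]
    have : (0:ℝ) ≤ dist w w' := dist_nonneg
    simp
    nlinarith
  obtain ⟨w, hw, -⟩ := hcontr.exists_fixedPoint 0 (edist_ne_top _ _)
  have hwt : ∀ t, Y w t = x₀ + ∫ s in t₀..t, v s (Y w s) := by
    intro t
    have h1 : w t = G w t := by
      conv_lhs => rw [← hw.eq]
      rfl
    have h3 : Real.exp (lam * |t - t₀|) * Real.exp (-(lam * |t - t₀|)) = 1 := by
      rw [← Real.exp_add]; simp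
    change x₀ + Real.exp (lam * |t - t₀|) • w t = _
    rw [h1, smul_smul, h3, one_smul]
  refine ⟨Y w, by rw [hwt]; simp, fun t => ?_⟩
  have h1 : HasDerivAt (fun t => x₀ + ∫ s in t₀..t, v s (Y w s)) (v t (Y w t)) t :=
    (intervalIntegral.integral_hasDerivAt_right ((hvY w).intervalIntegrable _ _)
      (hvY w).stronglyMeasurable.stronglyMeasurableAtFilter (hvY w).continuousAt).const_add x₀
  exact h1.congr_of_eventuallyEq (Eventually.of_forall hwt)

/-- Grönwall's inequality, applied forwards; for `t < t₀` time is reversed, and the reversed field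
satisfies the same hypotheses. -/
theorem dist_solution_le (hv : IsLipschitzField v K) {y z : ℝ → E}
    (hy : ∀ t, HasDerivAt y (v t (y t)) t) (hz : ∀ t, HasDerivAt z (v t (z t)) t) (t₀ t : ℝ) :
    dist (y t) (z t) ≤ dist (y t₀) (z t₀) * Real.exp (K * |t - t₀|) := by
  have hfwd : ∀ {v : ℝ → E → E} {y z : ℝ → E}, IsLipschitzField v K →
      (∀ t, HasDerivAt y (v t (y t)) t) → (∀ t, HasDerivAt z (v t (z t)) t) → ∀ {a b}, a ≤ b →
      dist (y b) (z b) ≤ dist (y a) (z a) * Real.exp (K * (b - a)) := by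
    intro v y z hv hy hz a b hab
    exact dist_le_of_trajectories_ODE hv.lipschitz
      (fun t _ => (hy t).continuousAt.continuousWithinAt) (fun t _ => (hy t).hasDerivWithinAt)
      (fun t _ => (hz t).continuousAt.continuousWithinAt) (fun t _ => (hz t).hasDerivWithinAt)
      le_rfl b ⟨hab, le_rfl⟩
  rcases le_total t₀ t with h | h
  · rw [abs_of_nonneg (by linarith)]
    exact hfwd hv hy hz h
  · rw [abs_of_nonpos (by linarith)]
    have hrev : ∀ {y : ℝ → E}, (∀ t, HasDerivAt y (v t (y t)) t) →
        ∀ t, HasDerivAt (fun t => y (-t)) (-v (-t) (y (-t))) t := by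
      intro y hy t
      simpa [Function.comp_def] using (hy (-t)).scomp t (hasDerivAt_neg t)
    have := hfwd hv.neg (hrev hy) (hrev hz) (neg_le_neg h)
    simp only [neg_neg] at this
    convert this using 3
    ring

theorem solution_unique (hv : IsLipschitzField v K) {y z : ℝ → E}
    (hy : ∀ t, HasDerivAt y (v t (y t)) t) (hz : ∀ t, HasDerivAt z (v t (z t)) t) (t₀ : ℝ)
    (h : y t₀ = z t₀) (t : ℝ) : y t = z t := by
  have := hv.dist_solution_le hy hz t₀ t
  rw [h, dist_self, zero_mul] at this
  exact dist_le_zero.1 this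

variable [CompleteSpace E]

/-- The flow of a Lipschitz field: `hv.flow s t x` is the value at time `t` of the solution that
starts from `x` at time `s`. -/
noncomputable def flow (hv : IsLipschitzField v K) (s t : ℝ) (x : E) : E :=
  (hv.exists_solution s x).choose t

variable (hv : IsLipschitzField v K)

theorem flow_self (s : ℝ) (x : E) : hv.flow s s x = x :=
  (hv.exists_solution s x).choose_spec.1

theorem hasDerivAt_flow (s t : ℝ) (x : E) :
    HasDerivAt (fun t => hv.flow s t x) (v t (hv.flow s t x)) t :=
  (hv.exists_solution s x).choose_spec.2 t

theorem continuous_flow_time (s : ℝ) (x : E) : Continuous fun t => hv.flow s t x :=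
  continuous_iff_continuousAt.2 fun t => (hv.hasDerivAt_flow s t x).continuousAt

theorem eq_flow {y : ℝ → E} (hy : ∀ t, HasDerivAt y (v t (y t)) t) (s t : ℝ) :
    y t = hv.flow s t (y s) :=
  hv.solution_unique hy (fun t => hv.hasDerivAt_flow s t (y s)) s (hv.flow_self s (y s)).symm t

theorem flow_flow (r s t : ℝ) (x : E) : hv.flow s t (hv.flow r s x) = hv.flow r t x :=
  (hv.eq_flow (fun t => hv.hasDerivAt_flow r t x) s t).symm

theorem dist_flow_le (s t : ℝ) (x y : E) :
    dist (hv.flow s t x) (hv.flow s t y) ≤ dist x y * Real.exp (K * |t - s|) := by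
  simpa [hv.flow_self] using
    hv.dist_solution_le (fun t => hv.hasDerivAt_flow s t x) (fun t => hv.hasDerivAt_flow s t y) s t

theorem lipschitz_flow (s t : ℝ) :
    LipschitzWith (Real.toNNReal (Real.exp (K * |t - s|))) (hv.flow s t) :=
  LipschitzWith.of_dist_le_mul fun x y => by
    rw [Real.coe_toNNReal _ (Real.exp_pos _).le, mul_comm]
    exact hv.dist_flow_le s t x y

/-- The flow maps as homeomorphisms. -/
noncomputable def flowHomeomorph (s t : ℝ) : E ≃ₜ E where
  toFun := hv.flow s t
  invFun := hv.flow t s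
  left_inv x := by rw [hv.flow_flow, hv.flow_self]
  right_inv x := by rw [hv.flow_flow, hv.flow_self]
  continuous_toFun := (hv.lipschitz_flow s t).continuous
  continuous_invFun := (hv.lipschitz_flow t s).continuous

end IsLipschitzField

/-- The one-step scheme `x_{k+1} = P (kτ) τ x_k`. -/
def oneStep {X : Type*} (P : ℝ → ℝ → X → X) (τ : ℝ) (x : X) : ℕ → X
  | 0 => x
  | k + 1 => P (k * τ) τ (oneStep P τ x k)

/-- Convergence of stable and consistent one-step schemes. -/
theorem tendsto_oneStep {v : ℝ → E → E} {K : ℝ≥0} (hv : IsLipschitzField v K) {y : ℝ → E}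
    (hy : ∀ t, HasDerivAt y (v t (y t)) t) {P : ℝ → ℝ → E → E} {A C : ℝ} (T : ℝ) (hA : 0 ≤ A)
    (hstab : ∀ s τ a b, |τ| ≤ 1 → ‖P s τ a - P s τ b‖ ≤ (1 + A * |τ|) * ‖a - b‖)
    (hcons : ∀ s τ, s ∈ Set.uIcc 0 T → |τ| ≤ 1 → ‖P s τ (y s) - y s - τ • v s (y s)‖ ≤ C * τ ^ 2) :
    Tendsto (fun n : ℕ => oneStep P (T / n) (y 0) n) atTop (𝓝 (y T)) := by
  have hyc : Continuous y := continuous_iff_continuousAt.2 fun t => (hy t).continuousAt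
  have hgc : Continuous fun t => v t (y t) := hv.continuous_comp hyc
  have huc := (isCompact_uIcc (a := (0:ℝ)) (b := T)).uniformContinuousOn_of_continuous hgc.continuousOn
  rw [Metric.uniformContinuousOn_iff_le] at huc
  have hC : 0 ≤ C := by
    have := (norm_nonneg _).trans (hcons 0 1 Set.left_mem_uIcc (by simp))
    simpa using this
  have main : ∀ η > 0, ∀ᶠ n : ℕ in atTop, dist (oneStep P (T / n) (y 0) n) (y T)
      ≤ Real.exp (A * |T|) * (|T| * (η + C * |T / n|)) := by
    intro η hη
    obtain ⟨δ, hδ, hδ'⟩ := huc η hη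
    have hlim : Tendsto (fun n : ℕ => |T / n|) atTop (𝓝 0) := by
      simpa using (tendsto_const_div_atTop_nhds_zero_nat T).abs
    filter_upwards [hlim.eventually (ge_mem_nhds hδ), hlim.eventually (ge_mem_nhds one_pos),
      eventually_ge_atTop 1] with n hn1 hn2 hn3
    have hn0 : (0 : ℝ) < n := by exact_mod_cast hn3
    set τ := T / n with hτ
    have hnτ : n * τ = T := by rw [hτ]; field_simp
    have hmem : ∀ k : ℕ, k ≤ n → (k : ℝ) * τ ∈ Set.uIcc 0 T := by
      intro k hk
      have hk' : (k : ℝ) ≤ n := by exact_mod_cast hk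
      have : (k:ℝ) * τ = (k / n : ℝ) * T := by rw [hτ]; ring
      rw [this]
      have h01 : (k / n : ℝ) ∈ Set.Icc (0:ℝ) 1 := ⟨by positivity, by rw [div_le_one hn0]; exact hk'⟩
      rcases le_total 0 T with h | h
      · rw [Set.uIcc_of_le h]
        exact ⟨mul_nonneg h01.1 h, by nlinarith [h01.2]⟩
      · rw [Set.uIcc_of_ge h]
        exact ⟨by nlinarith [h01.2], mul_nonpos_of_nonneg_of_nonpos h01.1 h⟩
    -- The field is only continuous in time, so the local error of the Euler step is `o(τ)`, not
    -- `O(τ²)`: it comes from uniform continuity of `s ↦ v s (y s)` on the compact time interval.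
    have hloc : ∀ k : ℕ, k + 1 ≤ n →
        ‖y ((k + 1 : ℕ) * τ) - y (k * τ) - τ • v (k * τ) (y (k * τ))‖ ≤ η * |τ| := by
      intro k hk
      have h1 := hmem k (by omega)
      have h2 := hmem (k + 1) hk
      set s := (k : ℝ) * τ with hs
      have hs' : ((k + 1 : ℕ) : ℝ) * τ = s + τ := by push_cast; rw [hs]; ring
      rw [hs'] at h2 ⊢
      have hsub : Set.uIcc s (s + τ) ⊆ Set.uIcc 0 T := Set.uIcc_subset_uIcc h1 h2
      have := (convex_uIcc s (s + τ)).norm_image_sub_le_of_norm_hasDerivWithin_le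
        (f := fun r => y r - (r - s) • v s (y s)) (f' := fun r => v r (y r) - v s (y s)) (C := η)
        (fun r _ => by
          have := (((hasDerivAt_id r).sub_const s).smul_const (v s (y s)))
          simp only [id, one_smul] at this
          exact ((hy r).sub this).hasDerivWithinAt)
        (fun r hr => by
          rw [← dist_eq_norm]
          refine hδ' r (hsub hr) s h1 ?_
          rw [Real.dist_eq]
          refine (Set.abs_sub_left_of_mem_uIcc hr).trans ?_
          simpa using hn1) Set.left_mem_uIcc Set.right_mem_uIcc
      simp only [add_sub_cancel_left, sub_self, zero_smul, sub_zero] at this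
      rw [sub_right_comm]
      simpa [Real.norm_eq_abs] using this
    -- Discrete Grönwall: each step multiplies the old error by `1 + A|τ|` and adds the consistency
    -- error `Cτ²` and the local error `η|τ|`.
    have hrec : ∀ k : ℕ, k ≤ n → ‖oneStep P τ (y 0) k - y (k * τ)‖
        ≤ (1 + A * |τ|) ^ k * (k * (|τ| * (η + C * |τ|))) := by
      intro k
      induction k with
      | zero => intro _; simp [oneStep]
      | succ k ih =>
        intro hk
        have ih' := ih (by omega)
        have h1 := hstab (k * τ) τ (oneStep P τ (y 0) k) (y (k * τ)) hn2
        have h2 := hcons (k * τ) τ (hmem k (by omega)) hn2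
        have h3 := hloc k hk
        have h4 : (1:ℝ) ≤ (1 + A * |τ|) ^ (k + 1) := one_le_pow₀ (by nlinarith [abs_nonneg τ])
        have h5 : 0 ≤ |τ| * (η + C * |τ|) := by positivity
        have h6 : oneStep P τ (y 0) (k + 1) - y ((k + 1 : ℕ) * τ)
          = (P (k * τ) τ (oneStep P τ (y 0) k) - P (k * τ) τ (y (k * τ)))
            + (P (k * τ) τ (y (k * τ)) - y (k * τ) - τ • v (k * τ) (y (k * τ)))
            - (y ((k + 1 : ℕ) * τ) - y (k * τ) - τ • v (k * τ) (y (k * τ))) := by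
          simp only [oneStep]; abel
        rw [h6]
        refine (norm_sub_le _ _).trans ?_
        have h7 := norm_add_le (P (k * τ) τ (oneStep P τ (y 0) k) - P (k * τ) τ (y (k * τ)))
            (P (k * τ) τ (y (k * τ)) - y (k * τ) - τ • v (k * τ) (y (k * τ)))
        have h8 : (1 + A * |τ|) * ‖oneStep P τ (y 0) k - y (k * τ)‖
            ≤ (1 + A * |τ|) * ((1 + A * |τ|) ^ k * (k * (|τ| * (η + C * |τ|)))) := by gcongr
        have h9 : τ ^ 2 = |τ| * |τ| := by rw [← abs_mul, ← sq, abs_sq]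
        calc _ ≤ (1 + A * |τ|) * ((1 + A * |τ|) ^ k * (k * (|τ| * (η + C * |τ|))))
              + 1 * (|τ| * (η + C * |τ|)) := by rw [h9] at h2; linarith
          _ ≤ (1 + A * |τ|) * ((1 + A * |τ|) ^ k * (k * (|τ| * (η + C * |τ|))))
              + (1 + A * |τ|) ^ (k + 1) * (|τ| * (η + C * |τ|)) := by gcongr
          _ = _ := by push_cast; ring
    have h1 := hrec n le_rfl
    rw [hnτ] at h1
    rw [dist_eq_norm]
    refine h1.trans ?_
    have habs : (n : ℝ) * |τ| = |T| := by
      rw [← hnτ, abs_mul, abs_of_pos hn0]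
    have h2 : (1 + A * |τ|) ^ n ≤ Real.exp (A * |T|) := by
      calc (1 + A * |τ|) ^ n ≤ (Real.exp (A * |τ|)) ^ n := by
            gcongr
            linarith [Real.add_one_le_exp (A * |τ|)]
        _ = Real.exp (A * |T|) := by rw [← Real.exp_nat_mul, ← habs]; ring_nf
    rw [← mul_assoc (n : ℝ), habs]
    gcongr
  rw [Metric.tendsto_nhds]
  intro ε hε
  set B := Real.exp (A * |T|) * |T| with hB
  have hB0 : 0 ≤ B := by positivity
  have hlim : Tendsto (fun n : ℕ => B * (C * |T / n|)) atTop (𝓝 0) := by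
    have := (((tendsto_const_div_atTop_nhds_zero_nat T).abs).const_mul C).const_mul B
    simpa using this
  filter_upwards [main (ε / (2 * (B + 1))) (by positivity),
    hlim.eventually (gt_mem_nhds (half_pos hε))] with n h1 h2
  refine h1.trans_lt ?_
  have h3 : B * (ε / (2 * (B + 1))) ≤ ε / 2 := by
    rw [mul_div_assoc', div_le_div_iff₀ (by positivity) (by norm_num)]
    nlinarith
  calc _ = B * (ε / (2 * (B + 1))) + B * (C * |T / n|) := by rw [hB]; ring
    _ < ε := by linarith

end ODE


/-! ### Multiplication operators, translations and the free Schrödinger group -/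

section Multipliers

variable {d : ℕ}

theorem memLp_top_of_norm_le {a : Pos d → ℂ} (ha : AEStronglyMeasurable a volume) {B : ℝ}
    (hB : ∀ x, ‖a x‖ ≤ B) : MemLp a ∞ (volume : Measure (Pos d)) :=
  memLp_top_of_bound ha B (Eventually.of_forall hB)

theorem mulOp_coeFn {a : Pos d → ℂ} (ha : MemLp a ∞ (volume : Measure (Pos d))) (u : L2 d) :
    mulOp a u =ᵐ[volume] fun y => a y * u y := by
  rw [mulOp, dif_pos ha]
  simp only [ContinuousLinearMap.holderL_apply_apply]
  filter_upwards [ContinuousLinearMap.coeFn_holder (r := 2) (ContinuousLinearMap.mul ℂ ℂ) (ha.toLp a) u,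
    ha.coeFn_toLp] with y h1 h2
  rw [h1, h2]
  rfl

theorem L2_norm_le_of_ae {u v : L2 d} {B : ℝ} (h : ∀ᵐ y, ‖u y‖ ≤ B * ‖v y‖) : ‖u‖ ≤ B * ‖v‖ :=
  Lp.norm_le_mul_norm_of_ae_le_mul h

theorem norm_mulOp_apply_le {a : Pos d → ℂ} (ha : MemLp a ∞ (volume : Measure (Pos d))) {B : ℝ}
    (hB : ∀ x, ‖a x‖ ≤ B) (u : L2 d) : ‖mulOp a u‖ ≤ B * ‖u‖ := by
  apply L2_norm_le_of_ae
  filter_upwards [mulOp_coeFn ha u] with y hy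
  rw [hy, norm_mul]
  gcongr
  exact hB y

theorem norm_mulOp_le {a : Pos d → ℂ} (ha : MemLp a ∞ (volume : Measure (Pos d))) {B : ℝ}
    (hB : ∀ x, ‖a x‖ ≤ B) : ‖mulOp a‖ ≤ B :=
  ContinuousLinearMap.opNorm_le_bound _ ((norm_nonneg _).trans (hB 0)) (norm_mulOp_apply_le ha hB)

theorem mulOp_mulOp {a b : Pos d → ℂ} (ha : MemLp a ∞ (volume : Measure (Pos d)))
    (hb : MemLp b ∞ (volume : Measure (Pos d))) (u : L2 d) :
    mulOp a (mulOp b u) = mulOp (fun y => a y * b y) u := by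
  have hab : MemLp (fun y => a y * b y) ∞ (volume : Measure (Pos d)) := hb.mul' ha
  ext1
  filter_upwards [mulOp_coeFn ha (mulOp b u), mulOp_coeFn hb u, mulOp_coeFn hab u] with y h1 h2 h3
  rw [h1, h2, h3, mul_assoc]

theorem mulOp_one : mulOp (fun _ : Pos d => (1 : ℂ)) = 1 := by
  ext1 u
  ext1
  filter_upwards [mulOp_coeFn (memLp_top_const (1 : ℂ)) u] with y h1
  rw [h1, one_mul]
  rfl

theorem mulOp_sub {a b : Pos d → ℂ} (ha : MemLp a ∞ (volume : Measure (Pos d)))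
    (hb : MemLp b ∞ (volume : Measure (Pos d))) :
    mulOp a - mulOp b = mulOp (fun y => a y - b y) := by
  have hab : MemLp (fun y => a y - b y) ∞ (volume : Measure (Pos d)) := ha.sub hb
  ext1 u
  ext1
  filter_upwards [mulOp_coeFn ha u, mulOp_coeFn hb u, mulOp_coeFn hab u,
    Lp.coeFn_sub (mulOp a u) (mulOp b u)] with y h1 h2 h3 h4
  rw [sub_apply, h4, Pi.sub_apply, h1, h2, h3, sub_mul]

theorem inner_mulOp {a : Pos d → ℂ} (ha : MemLp a ∞ (volume : Measure (Pos d))) (u v : L2 d) :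
    inner ℂ u (mulOp a v) = inner ℂ (mulOp (fun y => (starRingEnd ℂ) (a y)) u) v := by
  have ha' : MemLp (fun y => (starRingEnd ℂ) (a y)) ∞ (volume : Measure (Pos d)) :=
    ha.star
  rw [L2.inner_def, L2.inner_def]
  apply integral_congr_ae
  filter_upwards [mulOp_coeFn ha v, mulOp_coeFn ha' u] with y h1 h2
  rw [h1, h2]
  simp only [RCLike.inner_apply, map_mul, RingHomCompTriple.comp_apply, RingHom.id_apply]
  ring

/-- The unimodular function `e^{ig}`. -/
noncomputable def phase (g : Pos d → ℝ) (y : Pos d) : ℂ := Complex.exp ((g y : ℂ) * Complex.I)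

theorem norm_phase (g : Pos d → ℝ) (y : Pos d) : ‖phase g y‖ = 1 :=
  Complex.norm_exp_ofReal_mul_I _

theorem memLp_phase {g : Pos d → ℝ} (hg : Measurable g) :
    MemLp (phase g) ∞ (volume : Measure (Pos d)) := by
  refine memLp_top_of_norm_le (B := 1) ?_ fun y => (norm_phase g y).le
  unfold phase
  exact Measurable.aestronglyMeasurable (by fun_prop)

theorem phase_mul_phase (g h : Pos d → ℝ) (y : Pos d) :
    phase g y * phase h y = phase (fun y => g y + h y) y := by
  simp only [phase]
  rw [← Complex.exp_add]
  push_cast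
  ring_nf

theorem norm_phase_sub_one_le (g : Pos d → ℝ) (y : Pos d) : ‖phase g y - 1‖ ≤ |g y| := by
  rw [phase, mul_comm]
  simpa using Real.norm_exp_I_mul_ofReal_sub_one_le (x := g y)

theorem mulOp_phase_phase {g h : Pos d → ℝ} (hg : Measurable g) (hh : Measurable h) (u : L2 d) :
    mulOp (phase g) (mulOp (phase h) u) = mulOp (phase fun y => g y + h y) u := by
  rw [mulOp_mulOp (memLp_phase hg) (memLp_phase hh)]
  simp_rw [phase_mul_phase]

theorem mulOp_phase_zero : mulOp (phase fun _ : Pos d => 0) = 1 := by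
  rw [← mulOp_one]
  congr 1
  ext y
  simp [phase]

/-- Multiplication by `e^{ig}` as a unitary operator. -/
noncomputable def phaseOp (g : Pos d → ℝ) (hg : Measurable g) : L2 d ≃ₗᵢ[ℂ] L2 d :=
  LinearIsometryEquiv.ofSurjective
    { toLinearMap := (mulOp (phase g)).toLinearMap
      norm_map' := fun u => by
        refine le_antisymm ?_ ?_
        · simpa using norm_mulOp_apply_le (memLp_phase hg) (fun y => (norm_phase g y).le) u
        · have h1 := norm_mulOp_apply_le (memLp_phase hg.neg) (fun y => (norm_phase (-g) y).le)
            (mulOp (phase g) u)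
          rw [mulOp_phase_phase hg.neg hg] at h1
          simpa [mulOp_phase_zero] using h1 }
    (fun u => ⟨mulOp (phase fun y => -g y) u, by
      change mulOp (phase g) _ = _
      rw [mulOp_phase_phase hg (by fun_prop)]
      simp [mulOp_phase_zero]⟩)

theorem phaseOp_apply {g : Pos d → ℝ} (hg : Measurable g) (u : L2 d) :
    phaseOp g hg u = mulOp (phase g) u := rfl

/-- Dominated convergence for `|e^{ig} - 1|²|u|²`, with `4|u|²` as majorant; this is why the filter
has to be countably generated. -/
theorem tendsto_mulOp_phase {ι : Type*} {l : Filter ι} [l.IsCountablyGenerated] {g : ι → Pos d → ℝ}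
    (hg : ∀ i, Measurable (g i)) (h : ∀ y, Tendsto (fun i => g i y) l (𝓝 0)) (u : L2 d) :
    Tendsto (fun i => mulOp (phase (g i)) u) l (𝓝 u) := by
  rw [tendsto_iff_norm_sub_tendsto_zero]
  have h2 : ∀ i, ‖mulOp (phase (g i)) u - u‖ ^ 2 = ∫ y, ‖phase (g i) y - 1‖ ^ 2 * ‖u y‖ ^ 2 := by
    intro i
    have h1 : ‖mulOp (phase (g i)) u - u‖ ^ 2 = ∫ y, ‖(mulOp (phase (g i)) u - u : L2 d) y‖ ^ 2 := by
      have := L2.inner_def (𝕜 := ℂ) (mulOp (phase (g i)) u - u) (mulOp (phase (g i)) u - u)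
      simp only [inner_self_eq_norm_sq_to_K] at this
      have h3 : ((‖mulOp (phase (g i)) u - u‖ ^ 2 : ℝ) : ℂ)
          = ((∫ y, ‖(mulOp (phase (g i)) u - u : L2 d) y‖ ^ 2 : ℝ) : ℂ) := by
        rw [← integral_complex_ofReal]
        push_cast
        exact this
      exact_mod_cast h3
    rw [h1]
    apply integral_congr_ae
    filter_upwards [mulOp_coeFn (memLp_phase (hg i)) u, Lp.coeFn_sub (mulOp (phase (g i)) u) u]
      with y h3 h4
    rw [h4, Pi.sub_apply, h3, ← mul_pow, ← norm_mul, sub_mul, one_mul]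
  have h3 : Tendsto (fun i => ‖mulOp (phase (g i)) u - u‖ ^ 2) l (𝓝 0) := by
    simp_rw [h2]
    have hint : Integrable fun y => 4 * ‖u y‖ ^ 2 := by
      have := (Lp.memLp u).integrable_norm_pow (p := 2) (by norm_num)
      exact this.const_mul 4
    rw [← integral_zero (Pos d) ℝ (μ := volume)]
    refine tendsto_integral_filter_of_dominated_convergence _ ?_ ?_ hint ?_
    · refine Eventually.of_forall fun i => ?_
      have h5 : Measurable (phase (g i)) := by
        have := hg i
        unfold phase
        fun_prop
      have h6 := (Lp.memLp u).1.norm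
      exact ((h5.sub_const 1).norm.pow_const 2).aestronglyMeasurable.mul (h6.pow 2)
    · refine Eventually.of_forall fun i => Eventually.of_forall fun y => ?_
      rw [Real.norm_eq_abs, abs_of_nonneg (by positivity)]
      gcongr
      have : ‖phase (g i) y - 1‖ ≤ 2 := by
        refine (norm_sub_le _ _).trans ?_
        rw [norm_phase]
        norm_num
      nlinarith [norm_nonneg (phase (g i) y - 1)]
    · refine Eventually.of_forall fun y => ?_
      have h5 : Tendsto (fun i => ‖phase (g i) y - 1‖) l (𝓝 0) := by
        refine squeeze_zero (fun i => norm_nonneg _) (fun i => norm_phase_sub_one_le _ _) ?_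
        simpa using (h y).abs
      simpa using (h5.pow 2).mul_const (‖u y‖ ^ 2)
  have h4 := h3.sqrt
  simpa [Real.sqrt_sq] using h4

/-- The translation `u ↦ u(· + h)`. -/
noncomputable def shiftOp (h : Pos d) : L2 d →ₗᵢ[ℂ] L2 d :=
  Lp.compMeasurePreservingₗᵢ ℂ (fun y => y + h) (measurePreserving_add_right volume h)

theorem shiftOp_coeFn (h : Pos d) (u : L2 d) : shiftOp h u =ᵐ[volume] fun y => u (y + h) :=
  Lp.coeFn_compMeasurePreserving u (measurePreserving_add_right volume h)

theorem ae_comp_add {p : Pos d → Prop} (h : ∀ᵐ y, p y) (c : Pos d) : ∀ᵐ y, p (y + c) :=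
  (measurePreserving_add_right volume c).quasiMeasurePreserving.ae h

theorem shiftOp_mulOp {a : Pos d → ℂ} (ha : MemLp a ∞ (volume : Measure (Pos d))) (h : Pos d)
    (u : L2 d) : shiftOp h (mulOp a u) = mulOp (fun y => a (y + h)) (shiftOp h u) := by
  have ha' : MemLp (fun y => a (y + h)) ∞ (volume : Measure (Pos d)) :=
    ha.comp_measurePreserving (measurePreserving_add_right volume h)
  ext1
  filter_upwards [shiftOp_coeFn h (mulOp a u), ae_comp_add (mulOp_coeFn ha u) h,
    mulOp_coeFn ha' (shiftOp h u), shiftOp_coeFn h u] with y h1 h2 h3 h4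
  rw [h1, h2, h3, h4]

theorem measurable_inner_const (b : Pos d) (c : ℝ) : Measurable fun y : Pos d => c * inner ℝ b y := by
  fun_prop

/-- Both sides are continuous in `u`, so Schwartz functions suffice, and for these it is a
substitution in the Fourier integral. -/
theorem fourier_shiftOp (h : Pos d) (u : L2 d) :
    (𝓕 (shiftOp h u) : L2 d)
      = mulOp (phase fun ξ => 2 * Real.pi * inner ℝ h ξ) (𝓕 u : L2 d) := by
  have hm := memLp_phase (measurable_inner_const h (2 * Real.pi))
  refine DenseRange.induction_on (p := fun u : L2 d => (𝓕 (shiftOp h u) : L2 d)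
      = mulOp (phase fun ξ => 2 * Real.pi * inner ℝ h ξ) (𝓕 u : L2 d))
    (SchwartzMap.denseRange_toLpCLM (p := 2) ENNReal.ofNat_ne_top) u ?_ ?_
  · refine isClosed_eq ?_ ?_
    · exact (Lp.fourierTransformₗᵢ (Pos d) ℂ).continuous.comp (shiftOp h).continuous
    · exact (mulOp _).continuous.comp (Lp.fourierTransformₗᵢ (Pos d) ℂ).continuous
  · intro f
    simp only [SchwartzMap.toLpCLM_apply]
    have h1 : shiftOp h (f.toLp 2) = (f.compSubConstCLM ℂ (-h)).toLp 2 := by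
      ext1
      filter_upwards [shiftOp_coeFn h (f.toLp 2),
        ae_comp_add (f.coeFn_toLp 2 (volume : Measure (Pos d))) h,
        (f.compSubConstCLM ℂ (-h)).coeFn_toLp 2 (volume : Measure (Pos d))] with y h1 h2 h3
      rw [h1, h2, h3]
      simp
    rw [h1, SchwartzMap.toLp_fourier_eq, SchwartzMap.toLp_fourier_eq]
    ext1
    filter_upwards [mulOp_coeFn hm ((𝓕 f).toLp 2),
      (𝓕 f).coeFn_toLp 2 (volume : Measure (Pos d)),
      (𝓕 (f.compSubConstCLM ℂ (-h))).coeFn_toLp 2 (volume : Measure (Pos d))] with ξ h2 h3 h4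
    rw [h2, h3, h4, SchwartzMap.fourier_coe, SchwartzMap.fourier_coe, Real.fourier_eq', Real.fourier_eq',
      ← integral_const_mul]
    rw [← integral_sub_right_eq_self _ h]
    congr 1
    ext y
    simp only [SchwartzMap.compSubConstCLM_apply, sub_neg_eq_add, sub_add_cancel, smul_eq_mul, phase]
    rw [← mul_assoc, ← Complex.exp_add]
    congr 2
    rw [inner_sub_left]
    push_cast
    ring

theorem fourier_modulate (b : Pos d) (u : L2 d) :
    (𝓕 (mulOp (phase fun y => 2 * Real.pi * inner ℝ b y) u) : L2 d)
      = shiftOp (-b) (𝓕 u : L2 d) := by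
  have hm := memLp_phase (measurable_inner_const b (2 * Real.pi))
  -- Stated for the inverse transform, the identity is again a substitution on Schwartz functions;
  -- the claim follows on setting `v = 𝓕 u`.
  suffices h : ∀ v : L2 d, mulOp (phase fun y => 2 * Real.pi * inner ℝ b y) (𝓕⁻ v : L2 d)
      = (𝓕⁻ (shiftOp (-b) v) : L2 d) by
    have h1 := h (𝓕 u)
    rw [FourierTransform.fourierInv_fourier_eq] at h1
    rw [h1, FourierTransform.fourier_fourierInv_eq]
  intro v
  refine DenseRange.induction_on (p := fun v : L2 d =>
      mulOp (phase fun y => 2 * Real.pi * inner ℝ b y) (𝓕⁻ v : L2 d)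
      = (𝓕⁻ (shiftOp (-b) v) : L2 d))
    (SchwartzMap.denseRange_toLpCLM (p := 2) ENNReal.ofNat_ne_top) v ?_ ?_
  · refine isClosed_eq ?_ ?_
    · exact (mulOp _).continuous.comp (Lp.fourierTransformₗᵢ (Pos d) ℂ).symm.continuous
    · exact (Lp.fourierTransformₗᵢ (Pos d) ℂ).symm.continuous.comp (shiftOp (-b)).continuous
  · intro f
    simp only [SchwartzMap.toLpCLM_apply]
    have h1 : shiftOp (-b) (f.toLp 2) = (f.compSubConstCLM ℂ b).toLp 2 := by
      ext1
      filter_upwards [shiftOp_coeFn (-b) (f.toLp 2),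
        ae_comp_add (f.coeFn_toLp 2 (volume : Measure (Pos d))) (-b),
        (f.compSubConstCLM ℂ b).coeFn_toLp 2 (volume : Measure (Pos d))] with y h1 h2 h3
      rw [h1, h2, h3]
      simp [sub_eq_add_neg]
    rw [h1, SchwartzMap.toLp_fourierInv_eq, SchwartzMap.toLp_fourierInv_eq]
    ext1
    filter_upwards [mulOp_coeFn hm ((𝓕⁻ f).toLp 2),
      (𝓕⁻ f).coeFn_toLp 2 (volume : Measure (Pos d)),
      (𝓕⁻ (f.compSubConstCLM ℂ b)).coeFn_toLp 2 (volume : Measure (Pos d))] with ξ h2 h3 h4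
    rw [h2, h3, h4, SchwartzMap.fourierInv_coe, SchwartzMap.fourierInv_coe, Real.fourierInv_eq',
      Real.fourierInv_eq', ← integral_const_mul]
    rw [← integral_add_right_eq_self (fun y => Complex.exp (_ * _) • (SchwartzMap.compSubConstCLM ℂ b f) y) b]
    congr 1
    ext y
    simp only [SchwartzMap.compSubConstCLM_apply, add_sub_cancel_right, smul_eq_mul, phase]
    rw [← mul_assoc, ← Complex.exp_add]
    congr 2
    rw [inner_add_left]
    push_cast
    ring

/-- The phase of the multiplier of the free Schrödinger group. -/
noncomputable def freePhase (τ : ℝ) (ξ : Pos d) : ℝ := -(τ * (2 * Real.pi * ‖ξ‖) ^ 2 / 2)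

theorem measurable_freePhase (τ : ℝ) : Measurable (freePhase (d := d) τ) := by
  unfold freePhase
  fun_prop

theorem freeProp_eq (τ : ℝ) (u : L2 d) :
    freeProp τ u = (𝓕⁻ (mulOp (phase (freePhase τ)) (𝓕 u : L2 d)) : L2 d) := by
  unfold freeProp phase freePhase
  congr 3
  ext ξ
  congr 1
  push_cast
  ring

/-- The free Schrödinger group as a family of unitary operators. -/
noncomputable def freeUnitary (τ : ℝ) : L2 d ≃ₗᵢ[ℂ] L2 d :=
  (Lp.fourierTransformₗᵢ (Pos d) ℂ).trans
    ((phaseOp (freePhase τ) (measurable_freePhase τ)).trans (Lp.fourierTransformₗᵢ (Pos d) ℂ).symm)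

theorem freeUnitary_apply (τ : ℝ) (u : L2 d) : freeUnitary τ u = freeProp τ u := by
  rw [freeProp_eq]
  rfl

theorem fourier_freeProp (τ : ℝ) (u : L2 d) :
    (𝓕 (freeProp τ u) : L2 d) = mulOp (phase (freePhase τ)) (𝓕 u : L2 d) := by
  rw [freeProp_eq, FourierTransform.fourier_fourierInv_eq]

theorem freeProp_add (τ σ : ℝ) (u : L2 d) : freeProp (τ + σ) u = freeProp τ (freeProp σ u) := by
  rw [freeProp_eq τ, fourier_freeProp, mulOp_phase_phase (measurable_freePhase τ)
    (measurable_freePhase σ), freeProp_eq]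
  congr 3
  ext ξ
  simp only [freePhase, phase]
  push_cast
  ring_nf

theorem freeProp_zero (u : L2 d) : freeProp 0 u = u := by
  rw [freeProp_eq]
  have : (freePhase 0 : Pos d → ℝ) = fun _ => 0 := by
    ext ξ
    simp [freePhase]
  rw [this, mulOp_phase_zero]
  exact FourierTransform.fourierInv_fourier_eq _

theorem freeProp_neg_freeProp (τ : ℝ) (u : L2 d) : freeProp (-τ) (freeProp τ u) = u := by
  rw [← freeProp_add, neg_add_cancel, freeProp_zero]

theorem freeProp_freeProp_neg (τ : ℝ) (u : L2 d) : freeProp τ (freeProp (-τ) u) = u := by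
  rw [← freeProp_add, add_neg_cancel, freeProp_zero]

theorem norm_freeProp (τ : ℝ) (u : L2 d) : ‖freeProp τ u‖ = ‖u‖ := by
  rw [← freeUnitary_apply, LinearIsometryEquiv.norm_map]

theorem tendsto_freeProp_zero (u : L2 d) : Tendsto (fun τ => freeProp τ u) (𝓝 0) (𝓝 u) := by
  simp_rw [freeProp_eq]
  have h := tendsto_mulOp_phase (l := 𝓝 (0 : ℝ)) (fun τ => measurable_freePhase τ)
    (fun ξ => by
      have : Continuous fun τ : ℝ => freePhase τ ξ := by unfold freePhase; fun_prop
      simpa [freePhase] using this.tendsto 0) (𝓕 u : L2 d)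
  have h2 := ((Lp.fourierTransformₗᵢ (Pos d) ℂ).symm.continuous.tendsto (𝓕 u : L2 d)).comp h
  have h3 : (Lp.fourierTransformₗᵢ (Pos d) ℂ).symm (𝓕 u : L2 d) = u :=
    (Lp.fourierTransformₗᵢ (Pos d) ℂ).symm_apply_apply u
  rw [h3] at h2
  exact h2

theorem continuous_freeProp_time (u : L2 d) : Continuous fun τ => freeProp τ u := by
  rw [continuous_iff_continuousAt]
  intro τ
  have h1 : (fun σ => freeProp σ u) = fun σ => freeProp (σ - τ) (freeProp τ u) := by
    ext1 σ
    rw [← freeProp_add, sub_add_cancel]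
  rw [h1]
  have h2 : Tendsto (fun σ : ℝ => σ - τ) (𝓝 τ) (𝓝 0) := by
    have h4 : Continuous fun σ : ℝ => σ - τ := by fun_prop
    simpa using h4.tendsto τ
  have h3 := (tendsto_freeProp_zero (freeProp τ u)).comp h2
  simpa [ContinuousAt, freeProp_zero, Function.comp_def] using h3

theorem continuous_freeProp : Continuous fun p : ℝ × L2 d => freeProp p.1 p.2 := by
  refine continuous_prod_of_continuous_lipschitzWith' (fun p : ℝ × L2 d => freeProp p.1 p.2) 1
    (fun τ => LipschitzWith.of_dist_le_mul fun u v => ?_) (fun u => continuous_freeProp_time u)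
  rw [← freeUnitary_apply, ← freeUnitary_apply, LinearIsometryEquiv.dist_map]
  simp

theorem continuous_freeProp_comp {X : Type*} [TopologicalSpace X] {τ : X → ℝ} {u : X → L2 d}
    (hτ : Continuous τ) (hu : Continuous u) : Continuous fun x => freeProp (τ x) (u x) := by
  have h : Continuous fun x => (τ x, u x) := hτ.prodMk hu
  have h2 := continuous_freeProp.comp h
  simpa only [Function.comp_def] using h2

theorem freeProp_add_vec (τ : ℝ) (u v : L2 d) : freeProp τ (u + v) = freeProp τ u + freeProp τ v := by
  simp_rw [← freeUnitary_apply, map_add]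

theorem freeProp_sub_vec (τ : ℝ) (u v : L2 d) : freeProp τ (u - v) = freeProp τ u - freeProp τ v := by
  simp_rw [← freeUnitary_apply, map_sub]

theorem freeProp_smul_vec (τ : ℝ) (c : ℂ) (u : L2 d) : freeProp τ (c • u) = c • freeProp τ u := by
  simp_rw [← freeUnitary_apply, map_smul]

end Multipliers


/-! ### The cost form along drifts and kicks -/

section Cost

variable {d : ℕ}

theorem enorm_eq_ofReal_norm {E : Type*} [SeminormedAddCommGroup E] (x : E) :
    ‖x‖ₑ = ENNReal.ofReal ‖x‖ := (ofReal_norm x).symm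

/-- The norm `‖g v‖` of the product of a real function `g` with `v ∈ L²`, possibly infinite. -/
noncomputable def wNorm (g : Pos d → ℝ) (v : L2 d) : ℝ≥0∞ :=
  eLpNorm (fun y => (g y : ℂ) * v y) 2 volume

theorem aestronglyMeasurable_mul {g : Pos d → ℝ} (hg : Measurable g) (v : L2 d) :
    AEStronglyMeasurable (fun y => (g y : ℂ) * v y) volume := by
  have h : Measurable fun y => (g y : ℂ) := by fun_prop
  exact h.aestronglyMeasurable.mul (Lp.aestronglyMeasurable v)

theorem wNorm_sq (g : Pos d → ℝ) (v : L2 d) :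
    wNorm g v ^ 2 = ∫⁻ y, ‖g y‖ₑ ^ 2 * ‖v y‖ₑ ^ 2 := by
  have h := eLpNorm_nnreal_pow_eq_lintegral (μ := volume) (f := fun y => (g y : ℂ) * v y)
    (p := 2) (by norm_num)
  simp only [NNReal.coe_ofNat, ENNReal.coe_ofNat, ENNReal.rpow_ofNat] at h
  rw [wNorm, h]
  congr 1
  ext y
  rw [enorm_mul, mul_pow]
  congr 2
  simp [enorm_eq_nnnorm]

theorem wNorm_le_add {g g₁ g₂ : Pos d → ℝ} (h₁ : Measurable g₁) (h₂ : Measurable g₂)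
    (h : ∀ y, |g y| ≤ |g₁ y| + |g₂ y|) (v : L2 d) : wNorm g v ≤ wNorm g₁ v + wNorm g₂ v := by
  have h1 : wNorm g v ≤ wNorm (fun y => |g₁ y| + |g₂ y|) v := by
    refine eLpNorm_mono fun y => ?_
    rw [norm_mul, norm_mul, Complex.norm_real, Complex.norm_real, Real.norm_eq_abs, Real.norm_eq_abs]
    exact mul_le_mul_of_nonneg_right ((h y).trans (le_abs_self _)) (norm_nonneg _)
  have h2 : ∀ k : Pos d → ℝ, wNorm (fun y => |k y|) v = wNorm k v := by
    intro k
    refine eLpNorm_congr_norm_ae (Eventually.of_forall fun y => ?_)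
    rw [norm_mul, norm_mul, Complex.norm_real, Complex.norm_real, Real.norm_eq_abs, Real.norm_eq_abs,
      abs_abs]
  rw [← h2 g₁, ← h2 g₂]
  refine h1.trans ?_
  have h3 := eLpNorm_add_le (μ := volume) (p := 2) (aestronglyMeasurable_mul (g := fun y => |g₁ y|) (by fun_prop) v)
    (aestronglyMeasurable_mul (g := fun y => |g₂ y|) (by fun_prop) v) (by norm_num)
  refine le_trans (le_of_eq ?_) h3
  unfold wNorm
  congr 1
  ext y
  simp [add_mul]

theorem wNorm_const_mul (c : ℝ) (g : Pos d → ℝ) (v : L2 d) :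
    wNorm (fun y => c * g y) v = ENNReal.ofReal |c| * wNorm g v := by
  have := eLpNorm_const_smul (c : ℂ) (fun y => (g y : ℂ) * v y) 2 (volume : Measure (Pos d))
  rw [enorm_eq_ofReal_norm, Complex.norm_real, Real.norm_eq_abs] at this
  unfold wNorm
  rw [← this]
  congr 1
  ext y
  simp [mul_assoc]

theorem wNorm_const (c : ℝ) (v : L2 d) :
    wNorm (fun _ => c) v = ENNReal.ofReal |c| * ‖v‖ₑ := by
  have := wNorm_const_mul c (fun _ => 1) v
  simp only [mul_one] at this
  rw [this, wNorm]
  simp [Lp.enorm_def]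

/-- The direct half of the dictionary between the unbounded multiplier `κ` and the unitary `e^{iκ}`;
`wNorm_le_of_phase` is the converse half. -/
theorem enorm_mulOp_phase_sub_le {κ : Pos d → ℝ} (hκ : Measurable κ) (v : L2 d) :
    ‖mulOp (phase κ) v - v‖ₑ ≤ wNorm κ v := by
  rw [Lp.enorm_def]
  refine eLpNorm_mono_ae ?_
  filter_upwards [mulOp_coeFn (memLp_phase hκ) v, Lp.coeFn_sub (mulOp (phase κ) v) v] with y h1 h2
  rw [h2, Pi.sub_apply, h1, norm_mul, Complex.norm_real, Real.norm_eq_abs, ← sub_one_mul, norm_mul]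
  gcongr
  exact norm_phase_sub_one_le κ y

theorem tendsto_phase_div (c : ℝ) :
    Tendsto (fun n : ℕ => ((n + 1 : ℝ) : ℂ) * (Complex.exp (((1 / (n + 1 : ℝ) * c : ℝ) : ℂ) * Complex.I) - 1))
      atTop (𝓝 (c * Complex.I)) := by
  have h1 : HasDerivAt (fun a : ℝ => Complex.exp ((a : ℂ) * (c * Complex.I))) (c * Complex.I) 0 := by
    have h2 : HasDerivAt (fun z : ℂ => Complex.exp (z * (c * Complex.I))) (c * Complex.I) ((0 : ℝ) : ℂ) := by
      simpa using ((hasDerivAt_id (0 : ℂ)).mul_const (c * Complex.I)).cexp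
    exact h2.comp_ofReal
  have h2 := h1.tendsto_slope_zero
  have h3 : Tendsto (fun n : ℕ => 1 / ((n : ℝ) + 1)) atTop (𝓝[≠] 0) := by
    rw [tendsto_nhdsWithin_iff]
    refine ⟨tendsto_one_div_add_atTop_nhds_zero_nat, Eventually.of_forall fun n => ?_⟩
    simp only [Set.mem_compl_iff, Set.mem_singleton_iff]
    positivity
  refine (h2.comp h3).congr fun n => ?_
  simp only [Function.comp_def, zero_add, Complex.ofReal_zero, zero_mul, Complex.exp_zero]
  rw [one_div, inv_inv, Complex.real_smul]
  push_cast
  ring_nf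

/-- The quotients `(e^{iag} - 1)v / a` converge pointwise to `i g v` as `a → 0`, and Fatou's lemma
bounds the limit. Estimates for the unbounded `g` thus follow from exact identities between
unitaries, and phases of order `a²` disappear in the term `C a`. -/
theorem wNorm_le_of_phase {g : Pos d → ℝ} (hg : Measurable g) {v : L2 d} {M : ℝ≥0∞} {C : ℝ}
    (h : ∀ a : ℝ, 0 < a → a ≤ 1 →
      ‖mulOp (phase fun y => a * g y) v - v‖ₑ ≤ ENNReal.ofReal a * (M + ENNReal.ofReal (C * a))) :
    wNorm g v ≤ M := by
  let a : ℕ → ℝ := fun n => 1 / ((n : ℝ) + 1)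
  have ha : ∀ n, 0 < a n := fun n => by positivity
  have ha1 : ∀ n, a n ≤ 1 := fun n => by
    simp only [a]
    rw [div_le_one (by positivity)]
    linarith [(Nat.cast_nonneg n : (0:ℝ) ≤ n)]
  let f : ℕ → Pos d → ℂ := fun n y =>
    ((n + 1 : ℝ) : ℂ) * (Complex.exp (((1 / (n + 1 : ℝ) * g y : ℝ) : ℂ) * Complex.I) - 1) * v y
  have hf : ∀ n, AEStronglyMeasurable (f n) volume := fun n => by
    have : Measurable fun y => ((n + 1 : ℝ) : ℂ) * (Complex.exp (((1 / (n + 1 : ℝ) * g y : ℝ) : ℂ) * Complex.I) - 1) := by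
      fun_prop
    exact this.aestronglyMeasurable.mul (Lp.aestronglyMeasurable v)
  have h1 := Lp.eLpNorm_lim_le_liminf_eLpNorm (p := 2) (μ := volume) hf
    (fun y => (g y * Complex.I) * v y)
    (Eventually.of_forall fun y => (tendsto_phase_div (g y)).mul_const (v y))
  have h2 : wNorm g v = eLpNorm (fun y => (g y * Complex.I) * v y) 2 volume := by
    refine eLpNorm_congr_norm_ae (Eventually.of_forall fun y => ?_)
    simp
  have h3 : ∀ n, eLpNorm (f n) 2 volume ≤ M + ENNReal.ofReal (C * a n) := by
    intro n
    have h4 : eLpNorm (f n) 2 volume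
        = ENNReal.ofReal ((n : ℝ) + 1) * ‖mulOp (phase fun y => a n * g y) v - v‖ₑ := by
      rw [Lp.enorm_def]
      have h5 := eLpNorm_const_smul ((n + 1 : ℝ) : ℂ)
        (mulOp (phase fun y => a n * g y) v - v : L2 d) 2 (volume : Measure (Pos d))
      rw [enorm_eq_ofReal_norm, Complex.norm_real, Real.norm_eq_abs, abs_of_nonneg (by positivity)] at h5
      rw [← h5]
      refine eLpNorm_congr_ae ?_
      filter_upwards [mulOp_coeFn (memLp_phase (hg.const_mul (a n))) v,
        Lp.coeFn_sub (mulOp (phase fun y => a n * g y) v) v] with y h6 h7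
      simp only [Pi.smul_apply, h7, Pi.sub_apply, h6, f, phase, a, smul_eq_mul]
      ring
    rw [h4]
    calc _ ≤ ENNReal.ofReal ((n : ℝ) + 1) * (ENNReal.ofReal (a n) * (M + ENNReal.ofReal (C * a n))) := by
          gcongr
          exact h _ (ha n) (ha1 n)
      _ = _ := by
          rw [← mul_assoc, ← ENNReal.ofReal_mul (by positivity)]
          have : ((n : ℝ) + 1) * a n = 1 := by simp only [a]; field_simp
          rw [this, ENNReal.ofReal_one, one_mul]
  rw [h2]
  refine h1.trans ?_
  have h4 : Tendsto (fun n => M + ENNReal.ofReal (C * a n)) atTop (𝓝 (M + ENNReal.ofReal (C * 0))) := by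
    refine tendsto_const_nhds.add (ENNReal.tendsto_ofReal ?_)
    exact tendsto_one_div_add_atTop_nhds_zero_nat.const_mul C
  simp only [mul_zero, ENNReal.ofReal_zero, add_zero] at h4
  rw [← h4.liminf_eq]
  exact liminf_le_liminf (Eventually.of_forall h3)

theorem wNorm_mulOp_phase (h : Pos d → ℝ) {g : Pos d → ℝ} (hg : Measurable g) (v : L2 d) :
    wNorm h (mulOp (phase g) v) = wNorm h v := by
  refine eLpNorm_congr_norm_ae ?_
  filter_upwards [mulOp_coeFn (memLp_phase hg) v] with y hy
  rw [hy, norm_mul, norm_mul, norm_mul, norm_phase, one_mul]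

theorem mulOp_phase_const (c : ℝ) (v : L2 d) :
    mulOp (phase fun _ => c) v = Complex.exp (c * Complex.I) • v := by
  ext1
  filter_upwards [mulOp_coeFn (memLp_phase (measurable_const (a := c))) v,
    Lp.coeFn_smul (Complex.exp (c * Complex.I)) v] with y h1 h2
  rw [h1, h2]
  rfl

theorem shiftOp_mulOp_phase {g : Pos d → ℝ} (hg : Measurable g) (h : Pos d) (u : L2 d) :
    shiftOp h (mulOp (phase g) u) = mulOp (phase fun y => g (y + h)) (shiftOp h u) :=
  shiftOp_mulOp (memLp_phase hg) h u

theorem fourier_smul_L2 (c : ℂ) (u : L2 d) : (𝓕 (c • u) : L2 d) = c • (𝓕 u : L2 d) :=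
  (Lp.fourierTransformₗᵢ (Pos d) ℂ).map_smul c u

theorem fourier_sub_L2 (u v : L2 d) : (𝓕 (u - v) : L2 d) = (𝓕 u : L2 d) - (𝓕 v : L2 d) :=
  (Lp.fourierTransformₗᵢ (Pos d) ℂ).map_sub u v

theorem enorm_fourier (u : L2 d) : ‖(𝓕 u : L2 d)‖ₑ = ‖u‖ₑ := by
  rw [enorm_eq_ofReal_norm, enorm_eq_ofReal_norm, Lp.norm_fourier_eq]

theorem fourier_injective_L2 {u v : L2 d} (h : (𝓕 u : L2 d) = (𝓕 v : L2 d)) : u = v :=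
  (Lp.fourierTransformₗᵢ (Pos d) ℂ).injective h

theorem fourier_mulOp_affine (b : Pos d) (c : ℝ) (u : L2 d) :
    (𝓕 (mulOp (phase fun y => 2 * Real.pi * inner ℝ b y + c) u) : L2 d)
      = mulOp (phase fun _ => c) (shiftOp (-b) (𝓕 u : L2 d)) := by
  rw [← mulOp_phase_phase (measurable_inner_const b _) measurable_const, mulOp_phase_const,
    fourier_modulate, fourier_smul_L2, map_smul, mulOp_phase_const]

theorem inner_single (j : Fin d) (c : ℝ) (y : Pos d) :
    inner ℝ (EuclideanSpace.single j c) y = c * y j := by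
  simp [EuclideanSpace.inner_single_left]

theorem measurable_coord (j : Fin d) : Measurable fun y : Pos d => y j := by
  fun_prop

/-- `e^{ia(x̂ - x - τp)} S(ħτ) = S(ħτ) e^{ia((x̂ - x) + τ(p̂ - p))}`, one coordinate at a time. -/
theorem modulate_freeProp (j : Fin d) (ħ τ a x p : ℝ) (u : L2 d) :
    mulOp (phase fun y : Pos d => a * (y j - (x + τ * p))) (freeProp (ħ * τ) u)
      = freeProp (ħ * τ) ((𝓕⁻ (mulOp (phase fun ξ : Pos d =>
          a * τ * (2 * Real.pi * ħ * ξ j - p) - ħ * τ * a ^ 2 / 2)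
        (𝓕 (mulOp (phase fun y : Pos d => a * (y j - x)) u) : L2 d)) : L2 d)) := by
  have hpi : Real.pi ≠ 0 := Real.pi_ne_zero
  set b : Pos d := EuclideanSpace.single j (a / (2 * Real.pi)) with hb
  have h1 : ∀ c : ℝ, (fun y : Pos d => a * (y j - c))
      = fun y => 2 * Real.pi * inner ℝ b y + -(a * c) := by
    intro c
    ext y
    rw [hb, inner_single]
    field_simp
    ring
  have hmf := measurable_freePhase (d := d) (ħ * τ)
  have hm1 : Measurable fun ξ : Pos d => a * τ * (2 * Real.pi * ħ * ξ j - p) - ħ * τ * a ^ 2 / 2 := by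
    fun_prop
  apply fourier_injective_L2
  rw [h1, h1, fourier_mulOp_affine, fourier_freeProp, fourier_freeProp,
    FourierTransform.fourier_fourierInv_eq, fourier_mulOp_affine,
    shiftOp_mulOp_phase hmf, mulOp_phase_phase measurable_const (by fun_prop),
    mulOp_phase_phase hm1 measurable_const, mulOp_phase_phase hmf (by fun_prop)]
  congr 2
  ext ξ
  -- Expanding the square in the free phase at `ξ - b`: the cross term is the displacement `aτ ·
  -- 2πħξ_j`, and `|b|²` leaves the constant Weyl phase `-ħτa²/2`.
  have h2 : ‖ξ + -b‖ ^ 2 = ‖ξ‖ ^ 2 - 2 * (a / (2 * Real.pi) * ξ j) + (a / (2 * Real.pi)) ^ 2 := by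
    rw [← sub_eq_add_neg, norm_sub_sq_real, real_inner_comm, hb, inner_single]
    congr 1
    rw [PiLp.norm_single, Real.norm_eq_abs, sq_abs]
  simp only [freePhase, phase, mul_pow, h2]
  congr 3
  field_simp
  ring

/-- In the Heisenberg picture the free evolution turns `x̂` into `x̂ + τp̂`, while the classical
drift turns `x` into `x + τp`; the deviation becomes `(x̂ - x) + τ(p̂ - p)`. The triangle inequality
is applied to the exponentials, whose Weyl phase is quadratic in `a`. -/
theorem wNorm_position_freeProp_le (j : Fin d) {ħ : ℝ} (hħ : 0 < ħ) (τ x p : ℝ) (u : L2 d) :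
    wNorm (fun y => y j - (x + τ * p)) (freeProp (ħ * τ) u)
      ≤ wNorm (fun y => y j - x) u
        + ENNReal.ofReal |τ| * wNorm (fun ξ => 2 * Real.pi * ħ * ξ j - p) (𝓕 u : L2 d) := by
  refine wNorm_le_of_phase (C := ħ * |τ| / 2 * ‖u‖) (by fun_prop) fun a ha _ => ?_
  rw [modulate_freeProp, ← freeProp_sub_vec]
  set w := mulOp (phase fun y : Pos d => a * (y j - x)) u with hw
  set θ : Pos d → ℝ := fun ξ => a * τ * (2 * Real.pi * ħ * ξ j - p) - ħ * τ * a ^ 2 / 2 with hθ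
  have hθm : Measurable θ := by fun_prop
  have e1 : ‖freeProp (ħ * τ) ((𝓕⁻ (mulOp (phase θ) (𝓕 w : L2 d)) : L2 d) - u)‖ₑ
      = ‖mulOp (phase θ) (𝓕 w : L2 d) - (𝓕 u : L2 d)‖ₑ := by
    rw [enorm_eq_ofReal_norm, norm_freeProp, ← enorm_eq_ofReal_norm, ← enorm_fourier, fourier_sub_L2,
      FourierTransform.fourier_fourierInv_eq]
  have e2 : mulOp (phase θ) (𝓕 w : L2 d) - (𝓕 u : L2 d)
      = phaseOp θ hθm (𝓕 (w - u) : L2 d) + (mulOp (phase θ) (𝓕 u : L2 d) - (𝓕 u : L2 d)) := by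
    rw [phaseOp_apply, fourier_sub_L2, map_sub]
    abel
  have e3 : ‖phaseOp θ hθm (𝓕 (w - u) : L2 d)‖ₑ = ‖w - u‖ₑ := by
    rw [enorm_eq_ofReal_norm, LinearIsometryEquiv.norm_map, ← enorm_eq_ofReal_norm, enorm_fourier]
  have e4 : ‖w - u‖ₑ ≤ ENNReal.ofReal a * wNorm (fun y => y j - x) u := by
    refine (enorm_mulOp_phase_sub_le (by fun_prop) u).trans (le_of_eq ?_)
    rw [wNorm_const_mul, abs_of_pos ha]
  have e5 : ‖mulOp (phase θ) (𝓕 u : L2 d) - (𝓕 u : L2 d)‖ₑ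
      ≤ ENNReal.ofReal a * (ENNReal.ofReal |τ| * wNorm (fun ξ => 2 * Real.pi * ħ * ξ j - p) (𝓕 u : L2 d))
        + ENNReal.ofReal a * ENNReal.ofReal (ħ * |τ| / 2 * ‖u‖ * a) := by
    refine (enorm_mulOp_phase_sub_le hθm _).trans ?_
    refine (wNorm_le_add (g₁ := fun ξ => a * τ * (2 * Real.pi * ħ * ξ j - p))
      (g₂ := fun _ => ħ * τ * a ^ 2 / 2) (by fun_prop) (by fun_prop) (fun ξ => abs_sub _ _) _).trans ?_
    rw [wNorm_const_mul, wNorm_const, enorm_fourier, abs_mul, abs_of_pos ha, ENNReal.ofReal_mul ha.le,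
      mul_assoc]
    refine add_le_add le_rfl ?_
    rw [enorm_eq_ofReal_norm, ← ENNReal.ofReal_mul (by positivity), ← ENNReal.ofReal_mul ha.le]
    apply le_of_eq
    congr 1
    rw [abs_div, abs_mul, abs_mul, abs_of_pos hħ, abs_of_nonneg (by positivity : 0 ≤ a ^ 2),
      abs_of_pos (by norm_num : (0:ℝ) < 2)]
    ring
  rw [e1, e2]
  refine (enorm_add_le _ _).trans ?_
  rw [e3]
  refine (add_le_add e4 e5).trans (le_of_eq ?_)
  ring

theorem wNorm_momentum_freeProp (g : Pos d → ℝ) (τ : ℝ) (u : L2 d) :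
    wNorm g (𝓕 (freeProp τ u) : L2 d) = wNorm g (𝓕 u : L2 d) := by
  rw [fourier_freeProp, wNorm_mulOp_phase _ (measurable_freePhase τ)]

/-- A kick with potential `W`, where `-∇W = G`, against the kick of a classical momentum with
force `F`. -/
theorem wNorm_momentum_kick_le (j : Fin d) {ħ : ℝ} (hħ : 0 < ħ) (τ p F : ℝ) {W : Pos d → ℝ}
    (hW : Measurable W) {G : Pos d → Pos d} (hG : Measurable G) {L : ℝ}
    (hWG : ∀ y h, |W (y + h) - W y + inner ℝ (G y) h| ≤ L * ‖h‖ ^ 2) (u : L2 d) :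
    wNorm (fun ξ => 2 * Real.pi * ħ * ξ j - (p + τ * F))
        (𝓕 (mulOp (phase fun y => -(τ / ħ) * W y) u) : L2 d)
      ≤ wNorm (fun ξ => 2 * Real.pi * ħ * ξ j - p) (𝓕 u : L2 d)
        + ENNReal.ofReal |τ| * wNorm (fun y => F - G y j) u := by
  refine wNorm_le_of_phase (C := |τ| * L * ħ * ‖u‖) (by fun_prop) fun a ha _ => ?_
  have hL : 0 ≤ L := by
    have := (abs_nonneg _).trans (hWG 0 (EuclideanSpace.single j 1))
    simpa using this
  -- The modulation of the Fourier transform by `a · 2πħξ_j` is the translation by `h = aħ e_j`.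
  -- Moving it past `e^{-iτW/ħ}` produces the phase `-(τ/ħ)(W(y + h) - W(y)) ≈ aτ G_j(y)`, so `κ ≈
  -- -aτ(F - G_j)` with an error of at most `|τ|Lħa²`.
  set h : Pos d := EuclideanSpace.single j (a * ħ) with hh
  have hmW : Measurable fun y => -(τ / ħ) * W y := by fun_prop
  set κ : Pos d → ℝ := fun y => -(τ / ħ) * (W (y + h) - W y) - a * τ * F with hκ
  have hκm : Measurable κ := by fun_prop
  have f1 : ∀ (q : ℝ) (v : L2 d), mulOp (phase fun ξ : Pos d => a * (2 * Real.pi * ħ * ξ j - q)) (𝓕 v : L2 d)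
      = (𝓕 (mulOp (phase fun _ => -(a * q)) (shiftOp h v)) : L2 d) := by
    intro q v
    rw [mulOp_phase_const, fourier_smul_L2, fourier_shiftOp, ← mulOp_phase_const,
      mulOp_phase_phase measurable_const (by fun_prop)]
    congr 2
    ext ξ
    simp only [phase]
    congr 3
    rw [hh, inner_single]
    ring
  set v' := mulOp (phase fun _ => -(a * p)) (shiftOp h u) with hv'
  have f2 : mulOp (phase fun _ => -(a * (p + τ * F))) (shiftOp h (mulOp (phase fun y => -(τ / ħ) * W y) u))
      = phaseOp _ hmW (phaseOp κ hκm v') := by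
    rw [phaseOp_apply, phaseOp_apply, hv', shiftOp_mulOp_phase hmW,
      mulOp_phase_phase measurable_const (by fun_prop), mulOp_phase_phase hκm measurable_const,
      mulOp_phase_phase hmW (by fun_prop)]
    congr 2
    ext y
    simp only [phase, hκ]
    congr 3
    ring
  rw [f1, f2, ← fourier_sub_L2, enorm_fourier, ← phaseOp_apply hmW, ← map_sub]
  have f3 : ∀ (w : L2 d), ‖phaseOp _ hmW w‖ₑ = ‖w‖ₑ := fun w => by
    rw [enorm_eq_ofReal_norm, LinearIsometryEquiv.norm_map, ← enorm_eq_ofReal_norm]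
  have f3' : ∀ (w : L2 d), ‖phaseOp κ hκm w‖ₑ = ‖w‖ₑ := fun w => by
    rw [enorm_eq_ofReal_norm, LinearIsometryEquiv.norm_map, ← enorm_eq_ofReal_norm]
  rw [f3]
  have f4 : phaseOp κ hκm v' - u = phaseOp κ hκm (v' - u) + (mulOp (phase κ) u - u) := by
    rw [map_sub, phaseOp_apply, phaseOp_apply]
    abel
  have f5 : ‖v' - u‖ₑ ≤ ENNReal.ofReal a * wNorm (fun ξ => 2 * Real.pi * ħ * ξ j - p) (𝓕 u : L2 d) := by
    rw [← enorm_fourier, fourier_sub_L2, ← f1]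
    refine (enorm_mulOp_phase_sub_le (by fun_prop) _).trans (le_of_eq ?_)
    rw [wNorm_const_mul, abs_of_pos ha]
  have f6 : ‖mulOp (phase κ) u - u‖ₑ ≤ ENNReal.ofReal a * (ENNReal.ofReal |τ| * wNorm (fun y => F - G y j) u)
      + ENNReal.ofReal a * ENNReal.ofReal (|τ| * L * ħ * ‖u‖ * a) := by
    refine (enorm_mulOp_phase_sub_le hκm _).trans ?_
    have hGj : Measurable fun y => G y j := (measurable_coord j).comp hG
    refine (wNorm_le_add (g₁ := fun y => a * τ * (F - G y j))
      (g₂ := fun _ => |τ| * L * ħ * a ^ 2) (by fun_prop) (by fun_prop) (fun y => ?_) _).trans ?_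
    · have h1 := hWG y h
      have h2 : inner ℝ (G y) h = a * ħ * G y j := by
        rw [real_inner_comm, hh, inner_single]
      have h3 : ‖h‖ ^ 2 = (a * ħ) ^ 2 := by
        rw [hh, PiLp.norm_single, Real.norm_eq_abs, sq_abs]
      rw [h2, h3] at h1
      have h4 : κ y = -(τ / ħ) * (W (y + h) - W y + a * ħ * G y j) - a * τ * (F - G y j) := by
        simp only [hκ]
        field_simp
        ring
      have h5 : |-(τ / ħ) * (W (y + h) - W y + a * ħ * G y j)| ≤ |τ| * L * ħ * a ^ 2 := by
        rw [abs_mul, abs_neg, abs_div, abs_of_pos hħ]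
        calc |τ| / ħ * |W (y + h) - W y + a * ħ * G y j| ≤ |τ| / ħ * (L * (a * ħ) ^ 2) := by gcongr
          _ = _ := by field_simp
      rw [h4, abs_of_nonneg (by positivity : 0 ≤ |τ| * L * ħ * a ^ 2)]
      refine (abs_sub _ _).trans ?_
      rw [add_comm]
      exact add_le_add_right h5 _
    · rw [wNorm_const_mul, wNorm_const, abs_mul, abs_of_pos ha, ENNReal.ofReal_mul ha.le, mul_assoc]
      refine add_le_add le_rfl ?_
      rw [enorm_eq_ofReal_norm, ← ENNReal.ofReal_mul (by positivity), ← ENNReal.ofReal_mul ha.le]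
      apply le_of_eq
      congr 1
      rw [abs_of_nonneg (by positivity)]
      ring
  rw [f4]
  refine (enorm_add_le _ _).trans ?_
  rw [f3']
  refine (add_le_add f5 f6).trans (le_of_eq ?_)
  ring

theorem enorm_sq_eq_sum (x : Pos d) : ‖x‖ₑ ^ 2 = ∑ j, ‖x j‖ₑ ^ 2 := by
  have h := EuclideanSpace.norm_sq_eq x
  simp_rw [enorm_eq_ofReal_norm, ← ENNReal.ofReal_pow (norm_nonneg _)]
  rw [h, ENNReal.ofReal_sum_of_nonneg (fun i _ => by positivity)]

theorem lintegral_enorm_sq_eq_sum {g : Pos d → Pos d} (hg : Measurable g) (v : L2 d) :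
    ∫⁻ y, ‖g y‖ₑ ^ 2 * ‖v y‖ₑ ^ 2 = ∑ j, wNorm (fun y => g y j) v ^ 2 := by
  simp_rw [wNorm_sq, enorm_sq_eq_sum, Finset.sum_mul]
  rw [lintegral_finsetSum']
  intro j _
  have h1 : Measurable fun y => g y j := (measurable_coord j).comp hg
  exact (h1.enorm.pow_const 2).aemeasurable.mul ((Lp.aestronglyMeasurable v).enorm.pow_const 2)

theorem wNorm_neg (g : Pos d → ℝ) (v : L2 d) : wNorm (fun y => -g y) v = wNorm g v := by
  have := wNorm_const_mul (-1) g v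
  simpa using this

theorem costForm_eq_sum (ħ : ℝ) (x p : Pos d) (u : L2 d) :
    costForm ħ x p u = 2⁻¹ * ∑ j, wNorm (fun y => y j - x j) u ^ 2
      + 2⁻¹ * ∑ j, wNorm (fun ξ => 2 * Real.pi * ħ * ξ j - p j) (𝓕 u : L2 d) ^ 2 := by
  unfold costForm
  rw [lintegral_enorm_sq_eq_sum (g := fun y => x - y) (by fun_prop),
    lintegral_enorm_sq_eq_sum (g := fun ξ => p - (2 * Real.pi * ħ) • ξ) (by fun_prop)]
  congr 3
  · ext j
    rw [← wNorm_neg]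
    simp
  · ext j
    rw [← wNorm_neg]
    simp

/-- Young's inequality `2ab ≤ a² + b²`, weighted so that `a²` keeps a coefficient `1 + O(c)`. A step
of length `c` then costs a factor that can be iterated. -/
theorem ennreal_add_mul_sq_le (a b : ℝ≥0∞) {c : ℝ} (hc : 0 ≤ c) :
    (a + ENNReal.ofReal c * b) ^ 2
      ≤ ENNReal.ofReal (1 + c) * a ^ 2 + ENNReal.ofReal (c + c ^ 2) * b ^ 2 := by
  rcases eq_or_lt_of_le hc with rfl | hc
  · simp
  induction a using ENNReal.recTopCoe with
  | top =>
    have : ENNReal.ofReal (1 + c) ≠ 0 := by simp; linarith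
    simp [ENNReal.mul_top this]
  | coe a =>
    induction b using ENNReal.recTopCoe with
    | top =>
      have : ENNReal.ofReal (c + c ^ 2) ≠ 0 := by simp; positivity
      simp [ENNReal.mul_top this]
    | coe b =>
      rw [← ENNReal.ofReal_coe_nnreal, ← ENNReal.ofReal_coe_nnreal, ← ENNReal.ofReal_mul hc.le,
        ← ENNReal.ofReal_add (by positivity) (by positivity), ← ENNReal.ofReal_pow (by positivity),
        ← ENNReal.ofReal_pow (by positivity), ← ENNReal.ofReal_pow (by positivity),
        ← ENNReal.ofReal_mul (by positivity), ← ENNReal.ofReal_mul (by positivity),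
        ← ENNReal.ofReal_add (by positivity) (by positivity)]
      apply ENNReal.ofReal_le_ofReal
      nlinarith [mul_nonneg hc.le (sq_nonneg ((a : ℝ) - b))]

/-- A drift leaves the momentum part unchanged and lets it leak into the position part with
coefficient `|τ| + τ²`, which is at most `2|τ|`. -/
theorem costForm_drift_le {ħ : ℝ} (hħ : 0 < ħ) {τ : ℝ} (hτ : |τ| ≤ 1) (x p : Pos d) (u : L2 d) :
    costForm ħ (x + τ • p) p (freeProp (ħ * τ) u) ≤ ENNReal.ofReal (1 + 2 * |τ|) * costForm ħ x p u := by
  rw [costForm_eq_sum, costForm_eq_sum]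
  simp_rw [wNorm_momentum_freeProp]
  have h0 : ∀ j, wNorm (fun y => y j - (x + τ • p) j) (freeProp (ħ * τ) u) ^ 2
      ≤ ENNReal.ofReal (1 + |τ|) * wNorm (fun y => y j - x j) u ^ 2
        + ENNReal.ofReal (|τ| + |τ| ^ 2) * wNorm (fun ξ => 2 * Real.pi * ħ * ξ j - p j) (𝓕 u : L2 d) ^ 2 := by
    intro j
    refine le_trans ?_ (ennreal_add_mul_sq_le _ _ (abs_nonneg τ))
    gcongr
    simpa using wNorm_position_freeProp_le j hħ τ (x j) (p j) u
  calc _ ≤ 2⁻¹ * ∑ j, (ENNReal.ofReal (1 + |τ|) * wNorm (fun y => y j - x j) u ^ 2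
        + ENNReal.ofReal (|τ| + |τ| ^ 2) * wNorm (fun ξ => 2 * Real.pi * ħ * ξ j - p j) (𝓕 u : L2 d) ^ 2)
        + 2⁻¹ * ∑ j, wNorm (fun ξ => 2 * Real.pi * ħ * ξ j - p j) (𝓕 u : L2 d) ^ 2 := by
          gcongr with j
          exact h0 j
    _ = ENNReal.ofReal (1 + |τ|) * (2⁻¹ * ∑ j, wNorm (fun y => y j - x j) u ^ 2)
        + (ENNReal.ofReal (|τ| + |τ| ^ 2) + 1)
          * (2⁻¹ * ∑ j, wNorm (fun ξ => 2 * Real.pi * ħ * ξ j - p j) (𝓕 u : L2 d) ^ 2) := by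
          rw [Finset.sum_add_distrib, ← Finset.mul_sum, ← Finset.mul_sum]
          ring
    _ ≤ ENNReal.ofReal (1 + 2 * |τ|) * (2⁻¹ * ∑ j, wNorm (fun y => y j - x j) u ^ 2)
        + ENNReal.ofReal (1 + 2 * |τ|)
          * (2⁻¹ * ∑ j, wNorm (fun ξ => 2 * Real.pi * ħ * ξ j - p j) (𝓕 u : L2 d) ^ 2) := by
          gcongr
          · linarith [abs_nonneg τ]
          · rw [← ENNReal.ofReal_one, ← ENNReal.ofReal_add (by positivity) (by norm_num)]
            apply ENNReal.ofReal_le_ofReal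
            nlinarith [abs_nonneg τ]
    _ = _ := by ring

/-- A kick leaves the position part unchanged and adds `τ(F - G(ŷ))` to the momentum deviation. Its
Lipschitz part `L'|x - ŷ|` is absorbed by the position part of the cost; only `Δ` remains as an
inhomogeneous term. -/
theorem costForm_kick_le {ħ : ℝ} (hħ : 0 < ħ) {τ : ℝ} (hτ : |τ| ≤ 1) (x p F : Pos d) {W : Pos d → ℝ}
    (hW : Measurable W) {G : Pos d → Pos d} (hG : Measurable G) {L L' Δ : ℝ}
    (hWG : ∀ y h, |W (y + h) - W y + inner ℝ (G y) h| ≤ L * ‖h‖ ^ 2)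
    (hFG : ∀ y, ‖F - G y‖ ≤ L' * ‖x - y‖ + Δ) (u : L2 d) :
    costForm ħ x (p + τ • F) (mulOp (phase fun y => -(τ / ħ) * W y) u)
      ≤ ENNReal.ofReal (1 + (1 + 4 * L' ^ 2) * |τ|) * costForm ħ x p u
        + ENNReal.ofReal (2 * |τ| * Δ ^ 2) * ‖u‖ₑ ^ 2 := by
  have hm : Measurable fun y => -(τ / ħ) * W y := by fun_prop
  have hc : 2⁻¹ * (∑ j, wNorm (fun y => y j - x j) u ^ 2) = 2⁻¹ * ∫⁻ y, ‖x - y‖ₑ ^ 2 * ‖u y‖ₑ ^ 2 := by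
    rw [lintegral_enorm_sq_eq_sum (g := fun y => x - y) (by fun_prop)]
    congr 2
    ext j
    rw [← wNorm_neg]
    simp
  have h0 : ∀ j, wNorm (fun ξ => 2 * Real.pi * ħ * ξ j - (p + τ • F) j)
        (𝓕 (mulOp (phase fun y => -(τ / ħ) * W y) u) : L2 d) ^ 2
      ≤ ENNReal.ofReal (1 + |τ|) * wNorm (fun ξ => 2 * Real.pi * ħ * ξ j - p j) (𝓕 u : L2 d) ^ 2
        + ENNReal.ofReal (|τ| + |τ| ^ 2) * wNorm (fun y => F j - G y j) u ^ 2 := by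
    intro j
    refine le_trans ?_ (ennreal_add_mul_sq_le _ _ (abs_nonneg τ))
    gcongr
    simpa using wNorm_momentum_kick_le j hħ τ (p j) (F j) hW hG hWG u
  have hsum : ∑ j, wNorm (fun y => F j - G y j) u ^ 2
      ≤ ENNReal.ofReal (2 * L' ^ 2) * (∫⁻ y, ‖x - y‖ₑ ^ 2 * ‖u y‖ₑ ^ 2)
        + ENNReal.ofReal (2 * Δ ^ 2) * ‖u‖ₑ ^ 2 := by
    have h1 := lintegral_enorm_sq_eq_sum (g := fun y => F - G y) (by fun_prop) u
    simp only [PiLp.sub_apply] at h1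
    have h2 : ‖u‖ₑ ^ 2 = ∫⁻ y, ‖u y‖ₑ ^ 2 := by
      have := wNorm_sq (fun _ => 1) u
      rw [wNorm_const] at this
      simpa using this
    rw [← h1, h2, ← lintegral_const_mul' _ _ ENNReal.ofReal_ne_top,
      ← lintegral_const_mul' _ _ ENNReal.ofReal_ne_top, ← lintegral_add_right']
    · refine lintegral_mono fun y => ?_
      rw [← mul_assoc, ← add_mul]
      gcongr
      rw [enorm_eq_ofReal_norm, enorm_eq_ofReal_norm, ← ENNReal.ofReal_pow (norm_nonneg _),
        ← ENNReal.ofReal_pow (norm_nonneg _), ← ENNReal.ofReal_mul (by positivity),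
        ← ENNReal.ofReal_add (by positivity) (by positivity)]
      apply ENNReal.ofReal_le_ofReal
      have h3 := hFG y
      calc ‖F - G y‖ ^ 2 ≤ (L' * ‖x - y‖ + Δ) ^ 2 := by gcongr
        _ ≤ _ := by nlinarith [sq_nonneg (L' * ‖x - y‖ - Δ)]
    · exact ((Lp.aestronglyMeasurable u).enorm.pow_const 2).const_mul _
  rw [costForm_eq_sum, costForm_eq_sum]
  simp_rw [wNorm_mulOp_phase _ hm]
  set A := 2⁻¹ * ∑ j, wNorm (fun y => y j - x j) u ^ 2 with hA
  set B := 2⁻¹ * ∑ j, wNorm (fun ξ => 2 * Real.pi * ħ * ξ j - p j) (𝓕 u : L2 d) ^ 2 with hB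
  have hτ2 : |τ| ^ 2 ≤ |τ| := by nlinarith [abs_nonneg τ]
  have e1 : 2⁻¹ * (ENNReal.ofReal (|τ| + |τ| ^ 2) * ∑ j, wNorm (fun y => F j - G y j) u ^ 2)
      ≤ ENNReal.ofReal (4 * L' ^ 2 * |τ|) * A + ENNReal.ofReal (2 * |τ| * Δ ^ 2) * ‖u‖ₑ ^ 2 := by
    rw [hc]
    calc _ ≤ 2⁻¹ * (ENNReal.ofReal (2 * |τ|) * (ENNReal.ofReal (2 * L' ^ 2) * (∫⁻ y, ‖x - y‖ₑ ^ 2 * ‖u y‖ₑ ^ 2)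
        + ENNReal.ofReal (2 * Δ ^ 2) * ‖u‖ₑ ^ 2)) := by
          gcongr
          linarith
      _ = (ENNReal.ofReal (2 * |τ|) * ENNReal.ofReal (2 * L' ^ 2)) * (2⁻¹ * (∫⁻ y, ‖x - y‖ₑ ^ 2 * ‖u y‖ₑ ^ 2))
          + (2⁻¹ * (ENNReal.ofReal (2 * |τ|) * ENNReal.ofReal (2 * Δ ^ 2))) * ‖u‖ₑ ^ 2 := by ring
      _ = _ := by
          have h2 : (2⁻¹ : ℝ≥0∞) = ENNReal.ofReal (2⁻¹) := by
            rw [ENNReal.ofReal_inv_of_pos (by norm_num)]; simp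
          have h3 : 2⁻¹ * (ENNReal.ofReal (2 * |τ|) * ENNReal.ofReal (2 * Δ ^ 2))
              = ENNReal.ofReal (2 * |τ| * Δ ^ 2) := by
            rw [h2, ← ENNReal.ofReal_mul (by positivity), ← ENNReal.ofReal_mul (by positivity)]
            congr 1
            ring
          rw [h3, ← ENNReal.ofReal_mul (by positivity)]
          congr 3
          ring
  calc _ ≤ A + 2⁻¹ * ∑ j, (ENNReal.ofReal (1 + |τ|) * wNorm (fun ξ => 2 * Real.pi * ħ * ξ j - p j) (𝓕 u : L2 d) ^ 2
        + ENNReal.ofReal (|τ| + |τ| ^ 2) * wNorm (fun y => F j - G y j) u ^ 2) := by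
          gcongr with j
          exact h0 j
    _ = A + ENNReal.ofReal (1 + |τ|) * B
        + 2⁻¹ * (ENNReal.ofReal (|τ| + |τ| ^ 2) * ∑ j, wNorm (fun y => F j - G y j) u ^ 2) := by
          rw [Finset.sum_add_distrib, ← Finset.mul_sum, ← Finset.mul_sum, hB]
          ring
    _ ≤ A + ENNReal.ofReal (1 + |τ|) * B
        + (ENNReal.ofReal (4 * L' ^ 2 * |τ|) * A + ENNReal.ofReal (2 * |τ| * Δ ^ 2) * ‖u‖ₑ ^ 2) := by gcongr
    _ = (1 + ENNReal.ofReal (4 * L' ^ 2 * |τ|)) * A + ENNReal.ofReal (1 + |τ|) * B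
        + ENNReal.ofReal (2 * |τ| * Δ ^ 2) * ‖u‖ₑ ^ 2 := by ring
    _ ≤ ENNReal.ofReal (1 + (1 + 4 * L' ^ 2) * |τ|) * A + ENNReal.ofReal (1 + (1 + 4 * L' ^ 2) * |τ|) * B
        + ENNReal.ofReal (2 * |τ| * Δ ^ 2) * ‖u‖ₑ ^ 2 := by
          gcongr
          · rw [← ENNReal.ofReal_one, ← ENNReal.ofReal_add (by norm_num) (by positivity)]
            apply ENNReal.ofReal_le_ofReal
            nlinarith [abs_nonneg τ]
          · nlinarith [abs_nonneg τ, mul_nonneg (sq_nonneg L') (abs_nonneg τ)]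
    _ = _ := by ring

/-- One kick followed by one drift. -/
theorem costForm_step_le {ħ : ℝ} (hħ : 0 < ħ) {τ : ℝ} (hτ : |τ| ≤ 1) (x p F : Pos d) {W : Pos d → ℝ}
    (hW : Measurable W) {G : Pos d → Pos d} (hG : Measurable G) {L L' Δ : ℝ}
    (hWG : ∀ y h, |W (y + h) - W y + inner ℝ (G y) h| ≤ L * ‖h‖ ^ 2)
    (hFG : ∀ y, ‖F - G y‖ ≤ L' * ‖x - y‖ + Δ) (u : L2 d) :
    costForm ħ (x + τ • (p + τ • F)) (p + τ • F)
        (freeProp (ħ * τ) (mulOp (phase fun y => -(τ / ħ) * W y) u))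
      ≤ ENNReal.ofReal (1 + (5 + 12 * L' ^ 2) * |τ|) * costForm ħ x p u
        + ENNReal.ofReal (6 * |τ| * Δ ^ 2) * ‖u‖ₑ ^ 2 := by
  refine (costForm_drift_le hħ hτ _ _ _).trans ?_
  calc _ ≤ ENNReal.ofReal (1 + 2 * |τ|) * (ENNReal.ofReal (1 + (1 + 4 * L' ^ 2) * |τ|) * costForm ħ x p u
        + ENNReal.ofReal (2 * |τ| * Δ ^ 2) * ‖u‖ₑ ^ 2) := by
          gcongr
          exact costForm_kick_le hħ hτ x p F hW hG hWG hFG u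
    _ = ENNReal.ofReal ((1 + 2 * |τ|) * (1 + (1 + 4 * L' ^ 2) * |τ|)) * costForm ħ x p u
        + ENNReal.ofReal ((1 + 2 * |τ|) * (2 * |τ| * Δ ^ 2)) * ‖u‖ₑ ^ 2 := by
          rw [ENNReal.ofReal_mul (p := 1 + 2 * |τ|) (by positivity),
            ENNReal.ofReal_mul (p := 1 + 2 * |τ|) (by positivity)]
          ring
    _ ≤ _ := by
          have h0 := abs_nonneg τ
          -- By `|τ|² ≤ |τ|` the constants add up to `2 + (1 + 4L'²) + 2(1 + 4L'²) = 5 + 12L'²` and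
          -- to `2 + 4 = 6`.
          refine add_le_add (mul_le_mul_left (ENNReal.ofReal_le_ofReal ?_) _)
            (mul_le_mul_left (ENNReal.ofReal_le_ofReal ?_) _)
          · have h1 : |τ| * |τ| ≤ |τ| := by nlinarith
            nlinarith [sq_nonneg L', mul_le_mul_of_nonneg_right h1 (sq_nonneg L')]
          · have h1 : |τ| * |τ| ≤ |τ| := by nlinarith
            nlinarith [mul_le_mul_of_nonneg_right h1 (sq_nonneg Δ)]

/-- Lower semicontinuity, the only continuity that an unbounded form offers. Along a subsequence
both `us` and its Fourier transforms converge almost everywhere, and Fatou's lemma applies to the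
nonnegative integrand. -/
theorem costForm_le_of_tendsto {ħ : ℝ} {x p : Pos d} {u : L2 d} {xs ps : ℕ → Pos d} {us : ℕ → L2 d}
    (hx : Tendsto xs atTop (𝓝 x)) (hp : Tendsto ps atTop (𝓝 p)) (hu : Tendsto us atTop (𝓝 u))
    {B : ℝ≥0∞} (h : ∀ᶠ n in atTop, costForm ħ (xs n) (ps n) (us n) ≤ B) : costForm ħ x p u ≤ B := by
  have hF : Tendsto (fun n => (𝓕 (us n) : L2 d)) atTop (𝓝 (𝓕 u : L2 d)) :=
    ((Lp.fourierTransformₗᵢ (Pos d) ℂ).continuous.tendsto u).comp hu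
  obtain ⟨n₁, hn₁, h₁⟩ := (tendstoInMeasure_of_tendsto_Lp hu).exists_seq_tendsto_ae
  obtain ⟨n₂, hn₂, h₂⟩ := (tendstoInMeasure_of_tendsto_Lp
    (hF.comp hn₁.tendsto_atTop)).exists_seq_tendsto_ae
  have hn : Tendsto (fun k => n₁ (n₂ k)) atTop atTop := hn₁.tendsto_atTop.comp hn₂.tendsto_atTop
  let I : Pos d → Pos d → L2 d → Pos d → ℝ≥0∞ := fun x p u y =>
    2⁻¹ * (‖x - y‖ₑ ^ 2 * ‖u y‖ₑ ^ 2)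
      + 2⁻¹ * (‖p - (2 * Real.pi * ħ) • y‖ₑ ^ 2 * ‖(𝓕 u : L2 d) y‖ₑ ^ 2)
  have hm1 : ∀ x u, AEMeasurable (fun y => ‖x - y‖ₑ ^ 2 * ‖(u : L2 d) y‖ₑ ^ 2) volume := fun x u =>
    (Measurable.aemeasurable (by fun_prop)).mul ((Lp.aestronglyMeasurable u).enorm.pow_const 2)
  have hm2 : ∀ p u, AEMeasurable (fun y => ‖p - (2 * Real.pi * ħ) • y‖ₑ ^ 2 * ‖(u : L2 d) y‖ₑ ^ 2) volume :=
    fun p u => (Measurable.aemeasurable (by fun_prop)).mul ((Lp.aestronglyMeasurable u).enorm.pow_const 2)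
  have hI : ∀ x p u, costForm ħ x p u = ∫⁻ y, I x p u y := by
    intro x p u
    simp only [I]
    rw [lintegral_add_left' ((hm1 x u).const_mul _), lintegral_const_mul' _ _ (by simp),
      lintegral_const_mul' _ _ (by simp)]
    rfl
  have hIm : ∀ x p u, AEMeasurable (I x p u) volume := fun x p u =>
    ((hm1 x u).const_mul _).add ((hm2 p _).const_mul _)
  have hlim : ∀ᵐ y, Tendsto (fun k => I (xs (n₁ (n₂ k))) (ps (n₁ (n₂ k))) (us (n₁ (n₂ k))) y) atTop
      (𝓝 (I x p u y)) := by
    filter_upwards [h₁, h₂] with y hy1 hy2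
    have hfin : ∀ z : ℂ, ‖z‖ₑ ^ 2 ≠ ∞ := fun z => by simp
    have hfin' : ∀ z : Pos d, ‖z‖ₑ ^ 2 ≠ ∞ := fun z => by simp
    have t1 : Tendsto (fun k => ‖xs (n₁ (n₂ k)) - y‖ₑ ^ 2) atTop (𝓝 (‖x - y‖ₑ ^ 2)) :=
      ((ENNReal.continuous_pow 2).tendsto _).comp ((hx.comp hn).sub_const y).enorm
    have t2 : Tendsto (fun k => ‖us (n₁ (n₂ k)) y‖ₑ ^ 2) atTop (𝓝 (‖u y‖ₑ ^ 2)) :=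
      ((ENNReal.continuous_pow 2).tendsto _).comp (hy1.comp hn₂.tendsto_atTop).enorm
    have t3 : Tendsto (fun k => ‖ps (n₁ (n₂ k)) - (2 * Real.pi * ħ) • y‖ₑ ^ 2) atTop
        (𝓝 (‖p - (2 * Real.pi * ħ) • y‖ₑ ^ 2)) :=
      ((ENNReal.continuous_pow 2).tendsto _).comp ((hp.comp hn).sub_const _).enorm
    have t4 : Tendsto (fun k => ‖(𝓕 (us (n₁ (n₂ k))) : L2 d) y‖ₑ ^ 2) atTop (𝓝 (‖(𝓕 u : L2 d) y‖ₑ ^ 2)) :=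
      ((ENNReal.continuous_pow 2).tendsto _).comp hy2.enorm
    refine Tendsto.add (ENNReal.Tendsto.const_mul ?_ (by simp)) (ENNReal.Tendsto.const_mul ?_ (by simp))
    · exact ENNReal.Tendsto.mul t1 (Or.inr (hfin _)) t2 (Or.inr (hfin' _))
    · exact ENNReal.Tendsto.mul t3 (Or.inr (hfin _)) t4 (Or.inr (hfin' _))
  rw [hI]
  calc ∫⁻ y, I x p u y
      = ∫⁻ y, liminf (fun k => I (xs (n₁ (n₂ k))) (ps (n₁ (n₂ k))) (us (n₁ (n₂ k))) y) atTop := by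
        apply lintegral_congr_ae
        filter_upwards [hlim] with y hy using hy.liminf_eq.symm
    _ ≤ liminf (fun k => ∫⁻ y, I (xs (n₁ (n₂ k))) (ps (n₁ (n₂ k))) (us (n₁ (n₂ k))) y) atTop :=
        lintegral_liminf_le' fun k => hIm _ _ _
    _ ≤ B := by
        simp_rw [← hI]
        exact (liminf_le_liminf (v := fun _ => B) (hn.eventually h)).trans (by simp)

end Cost


/-! ### Hilbert–Schmidt sums, traces and position densities -/

section HilbertSchmidt

variable {H : Type*} [NormedAddCommGroup H] [InnerProductSpace ℂ H] [CompleteSpace H]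
variable {ι κ : Type*}

/-- Parseval families. -/
def IsParseval (g : ι → H) : Prop := ∀ x, ∑' i, ‖inner ℂ (g i) x‖ₑ ^ 2 = ‖x‖ₑ ^ 2

theorem ennreal_sq_ofReal_norm {E : Type*} [SeminormedAddCommGroup E] (x : E) :
    ‖x‖ₑ ^ 2 = ENNReal.ofReal (‖x‖ ^ 2) := by
  rw [enorm_eq_ofReal_norm, ENNReal.ofReal_pow (norm_nonneg _)]

theorem isParseval_hilbertBasis (b : HilbertBasis ι ℂ H) : IsParseval b := by
  intro x
  have h := b.hasSum_inner_mul_inner x x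
  have h2 : HasSum (fun i => ‖inner ℂ (b i) x‖ ^ 2) (‖x‖ ^ 2) := by
    have h3 := h.mapL Complex.reCLM
    convert h3 using 1
    · ext i
      simp only [Complex.reCLM_apply]
      rw [← inner_conj_symm x (b i), ← Complex.normSq_eq_conj_mul_self, Complex.ofReal_re,
        Complex.normSq_eq_norm_sq]
    · simp only [Complex.reCLM_apply]
      rw [inner_self_eq_norm_sq_to_K]
      norm_cast
  simp_rw [ennreal_sq_ofReal_norm]
  rw [← h2.tsum_eq, ENNReal.ofReal_tsum_of_nonneg (fun i => by positivity) h2.summable]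

variable (H) in
theorem isParseval_onb : IsParseval (onb H) := isParseval_hilbertBasis (onb H)

theorem IsParseval.map_symm {g : ι → H} (hg : IsParseval g) (U : H ≃ₗᵢ[ℂ] H) :
    IsParseval fun i => U.symm (g i) := by
  intro x
  have h := hg (U x)
  rw [enorm_eq_ofReal_norm, LinearIsometryEquiv.norm_map, ← enorm_eq_ofReal_norm] at h
  rw [← h]
  congr 1
  ext i
  rw [← LinearIsometryEquiv.inner_map_map U, LinearIsometryEquiv.apply_symm_apply]

/-- Both sides are the double sum of `|⟨k_j, B g_i⟩|²`, summed in the two orders. Working in `[0,∞]`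
removes any Hilbert–Schmidt assumption. -/
theorem IsParseval.tsum_adjoint {g : ι → H} {k : κ → H} (hg : IsParseval g) (hk : IsParseval k)
    (B : H →L[ℂ] H) :
    ∑' i, ‖B (g i)‖ₑ ^ 2 = ∑' j, ‖ContinuousLinearMap.adjoint B (k j)‖ₑ ^ 2 := by
  simp_rw [← hk (B _), ← hg (ContinuousLinearMap.adjoint B _)]
  rw [ENNReal.tsum_comm]
  congr 1
  ext j
  congr 1
  ext i
  rw [ContinuousLinearMap.adjoint_inner_right, ← inner_conj_symm, enorm_eq_ofReal_norm,
    enorm_eq_ofReal_norm, RCLike.norm_conj]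

theorem IsParseval.tsum_eq {g : ι → H} {k : κ → H} (hg : IsParseval g) (hk : IsParseval k)
    (B : H →L[ℂ] H) : ∑' i, ‖B (g i)‖ₑ ^ 2 = ∑' j, ‖B (k j)‖ₑ ^ 2 := by
  rw [hg.tsum_adjoint hg, hk.tsum_adjoint hg]

theorem opSqrt_nonneg (Q : H →L[ℂ] H) : 0 ≤ opSqrt Q := CFC.sqrt_nonneg Q

theorem adjoint_of_nonneg {Q : H →L[ℂ] H} (hQ : 0 ≤ Q) : ContinuousLinearMap.adjoint Q = Q :=
  ((ContinuousLinearMap.nonneg_iff_isPositive Q).1 hQ).isSelfAdjoint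

theorem adjoint_opSqrt (Q : H →L[ℂ] H) : ContinuousLinearMap.adjoint (opSqrt Q) = opSqrt Q :=
  adjoint_of_nonneg (opSqrt_nonneg Q)

theorem inner_opSqrt (Q : H →L[ℂ] H) (x y : H) :
    inner ℂ (opSqrt Q x) y = inner ℂ x (opSqrt Q y) := by
  conv_lhs => rw [← adjoint_opSqrt, ContinuousLinearMap.adjoint_inner_left]

theorem opSqrt_opSqrt {Q : H →L[ℂ] H} (hQ : 0 ≤ Q) (x : H) : opSqrt Q (opSqrt Q x) = Q x := by
  have : opSqrt Q * opSqrt Q = Q := CFC.sqrt_mul_sqrt_self Q hQ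
  conv_rhs => rw [← this]
  rfl

theorem inner_nonneg_op {Q : H →L[ℂ] H} (hQ : 0 ≤ Q) (x : H) :
    inner ℂ x (Q x) = ((‖opSqrt Q x‖ ^ 2 : ℝ) : ℂ) := by
  rw [← opSqrt_opSqrt hQ, ← inner_opSqrt, inner_self_eq_norm_sq_to_K]
  push_cast
  rfl

theorem ofReal_inner_nonneg_op {Q : H →L[ℂ] H} (hQ : 0 ≤ Q) (x : H) :
    ENNReal.ofReal (inner ℂ x (Q x)).re = ‖opSqrt Q x‖ₑ ^ 2 := by
  rw [inner_nonneg_op hQ, Complex.ofReal_re, ennreal_sq_ofReal_norm]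

theorem traceNorm_eq {Q : H →L[ℂ] H} (hQ : 0 ≤ Q) :
    traceNorm Q = ∑' i, ‖opSqrt Q (onb H i)‖ₑ ^ 2 := by
  unfold traceNorm
  have : opAbs Q = Q := CFC.abs_of_nonneg Q hQ
  rw [this]
  congr 1
  ext i
  exact ofReal_inner_nonneg_op hQ _

theorem traceNorm_eq_parseval {Q : H →L[ℂ] H} (hQ : 0 ≤ Q) {g : ι → H} (hg : IsParseval g) :
    traceNorm Q = ∑' i, ‖opSqrt Q (g i)‖ₑ ^ 2 := by
  rw [traceNorm_eq hQ, (isParseval_onb H).tsum_eq hg]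

theorem opTrace_eq {Q : H →L[ℂ] H} (hQ : 0 ≤ Q) :
    opTrace Q = (((traceNorm Q).toReal : ℝ) : ℂ) := by
  unfold opTrace
  simp_rw [inner_nonneg_op hQ]
  rw [← Complex.ofReal_tsum, traceNorm_eq hQ, ENNReal.tsum_toReal_eq (fun i => by simp)]
  simp

/-- With `P = |A|^{1/2}`, Parseval and Cauchy–Schwarz give `‖Px‖² ≤ Tr|A| ‖x‖²`, hence `‖A‖ = ‖P²‖ ≤
Tr|A|`. It turns trace-norm continuity of the fermion state into operator-norm continuity. -/
theorem enorm_le_traceNorm (A : H →L[ℂ] H) : ‖A‖ₑ ≤ traceNorm A := by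
  have h0 : (0 : H →L[ℂ] H) ≤ opAbs A := CFC.abs_nonneg A
  have h1 : traceNorm A = ∑' i, ‖opSqrt (opAbs A) (onb H i)‖ₑ ^ 2 := by
    unfold traceNorm
    congr 1
    ext i
    exact ofReal_inner_nonneg_op h0 _
  have h2 : ‖A‖ = ‖opAbs A‖ := CFC.norm_abs.symm
  set P := opSqrt (opAbs A) with hP
  have h3 : ∀ x, ‖P x‖ₑ ^ 2 ≤ traceNorm A * ‖x‖ₑ ^ 2 := by
    intro x
    rw [h1, ← isParseval_onb H (P x), ← ENNReal.tsum_mul_right]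
    refine ENNReal.tsum_le_tsum fun i => ?_
    rw [← inner_opSqrt, ← mul_pow]
    gcongr
    rw [enorm_eq_ofReal_norm, enorm_eq_ofReal_norm, enorm_eq_ofReal_norm,
      ← ENNReal.ofReal_mul (norm_nonneg _)]
    exact ENNReal.ofReal_le_ofReal (norm_inner_le_norm _ _)
  by_cases ht : traceNorm A = ∞
  · rw [ht]; exact le_top
  set T := (traceNorm A).toReal with hT
  have hT' : traceNorm A = ENNReal.ofReal T := (ENNReal.ofReal_toReal ht).symm
  have hT0 : 0 ≤ T := ENNReal.toReal_nonneg
  have h4 : ∀ x, ‖P x‖ ^ 2 ≤ T * ‖x‖ ^ 2 := by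
    intro x
    have := h3 x
    rw [hT', ennreal_sq_ofReal_norm, ennreal_sq_ofReal_norm, ← ENNReal.ofReal_mul hT0] at this
    rwa [ENNReal.ofReal_le_ofReal_iff (by positivity)] at this
  have h5 : ∀ x, ‖P x‖ ≤ Real.sqrt T * ‖x‖ := by
    intro x
    rw [← Real.sqrt_sq (norm_nonneg x), ← Real.sqrt_mul hT0]
    exact Real.le_sqrt_of_sq_le (h4 x)
  rw [hT', enorm_eq_ofReal_norm, h2]
  apply ENNReal.ofReal_le_ofReal
  refine ContinuousLinearMap.opNorm_le_bound _ hT0 fun x => ?_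
  rw [← opSqrt_opSqrt h0]
  calc ‖P (P x)‖ ≤ Real.sqrt T * (Real.sqrt T * ‖x‖) := (h5 _).trans (by gcongr; exact h5 x)
    _ = T * ‖x‖ := by rw [← mul_assoc, Real.mul_self_sqrt hT0]

/-- Conjugation `U A U*` of an operator with a unitary operator. -/
noncomputable def conjOp (U : H ≃ₗᵢ[ℂ] H) (A : H →L[ℂ] H) : H →L[ℂ] H :=
  (U.toContinuousLinearEquiv : H →L[ℂ] H) ∘L A ∘L (U.symm.toContinuousLinearEquiv : H →L[ℂ] H)

theorem conjOp_apply (U : H ≃ₗᵢ[ℂ] H) (A : H →L[ℂ] H) (x : H) : conjOp U A x = U (A (U.symm x)) := rfl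

theorem inner_conjOp (U : H ≃ₗᵢ[ℂ] H) (A : H →L[ℂ] H) (x y : H) :
    inner ℂ x (conjOp U A y) = inner ℂ (U.symm x) (A (U.symm y)) := by
  rw [conjOp_apply, ← LinearIsometryEquiv.inner_map_map U (U.symm x),
    LinearIsometryEquiv.apply_symm_apply]

theorem conjOp_nonneg (U : H ≃ₗᵢ[ℂ] H) {A : H →L[ℂ] H} (hA : 0 ≤ A) : 0 ≤ conjOp U A := by
  rw [ContinuousLinearMap.nonneg_iff_isPositive] at hA ⊢
  refine ⟨fun x y => ?_, fun x => ?_⟩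
  · have h := hA.isSymmetric (U.symm x) (U.symm y)
    simp only [ContinuousLinearMap.coe_coe] at h ⊢
    rw [inner_conjOp, ← h, conjOp_apply, ← LinearIsometryEquiv.inner_map_map U _ (U.symm y),
      LinearIsometryEquiv.apply_symm_apply]
  · rw [ContinuousLinearMap.reApplyInnerSelf, conjOp_apply]
    have := hA.2 (U.symm x)
    rw [ContinuousLinearMap.reApplyInnerSelf] at this
    rwa [← LinearIsometryEquiv.inner_map_map U, LinearIsometryEquiv.apply_symm_apply] at this

/-- The right-hand side is nonnegative and squares to `U A U*`; nonnegative square roots are unique.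
-/
theorem opSqrt_conjOp (U : H ≃ₗᵢ[ℂ] H) {A : H →L[ℂ] H} (hA : 0 ≤ A) :
    opSqrt (conjOp U A) = conjOp U (opSqrt A) := by
  refine CFC.sqrt_unique ?_ (conjOp_nonneg U (opSqrt_nonneg A))
  ext1 x
  change conjOp U (opSqrt A) (conjOp U (opSqrt A) x) = _
  rw [conjOp_apply, conjOp_apply, conjOp_apply,
    LinearIsometryEquiv.symm_apply_apply, opSqrt_opSqrt hA]

theorem traceNorm_conjOp (U : H ≃ₗᵢ[ℂ] H) {A : H →L[ℂ] H} (hA : 0 ≤ A) :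
    traceNorm (conjOp U A) = traceNorm A := by
  rw [traceNorm_eq (conjOp_nonneg U hA), traceNorm_eq_parseval hA ((isParseval_onb H).map_symm U),
    opSqrt_conjOp U hA]
  congr 1
  ext i
  rw [conjOp_apply, enorm_eq_ofReal_norm, LinearIsometryEquiv.norm_map, ← enorm_eq_ofReal_norm]

theorem opTrace_conjOp (U : H ≃ₗᵢ[ℂ] H) {A : H →L[ℂ] H} (hA : 0 ≤ A) (ht : IsTraceClass A) :
    IsTraceClass (conjOp U A) ∧ opTrace (conjOp U A) = opTrace A := by
  have h1 : IsTraceClass (conjOp U A) := by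
    unfold IsTraceClass
    rw [traceNorm_conjOp U hA]
    exact ht
  exact ⟨h1, by rw [opTrace_eq hA, opTrace_eq (conjOp_nonneg U hA), traceNorm_conjOp U hA]⟩

/-- Cyclicity of the trace for Hilbert–Schmidt operators. -/
theorem tsum_inner_comm {g : ι → H} (b : HilbertBasis ι ℂ H) (hgb : ⇑b = g) {X Y : H →L[ℂ] H}
    (hX : ∑' i, ‖X (g i)‖ₑ ^ 2 ≠ ∞) (hY : ∑' i, ‖Y (g i)‖ₑ ^ 2 ≠ ∞) :
    ∑' i, inner ℂ (g i) (X (Y (g i))) = ∑' i, inner ℂ (g i) (Y (X (g i))) := by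
  have hg : IsParseval g := hgb ▸ isParseval_hilbertBasis b
  let x : ι → ι → ℂ := fun i j => inner ℂ (g i) (X (g j))
  let y : ι → ι → ℂ := fun i j => inner ℂ (g i) (Y (g j))
  have hexp : ∀ (A B : H →L[ℂ] H) (i : ι), inner ℂ (g i) (A (B (g i)))
      = ∑' j, inner ℂ (g i) (A (g j)) * inner ℂ (g j) (B (g i)) := by
    intro A B i
    have := (b.hasSum_inner_mul_inner (ContinuousLinearMap.adjoint A (g i)) (B (g i))).tsum_eq
    rw [ContinuousLinearMap.adjoint_inner_left] at this
    rw [← this, hgb]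
    congr 1
    ext j
    rw [ContinuousLinearMap.adjoint_inner_left]
  have hsum : ∀ (A : H →L[ℂ] H), ∑' i, ‖A (g i)‖ₑ ^ 2 ≠ ∞ →
      Summable fun p : ι × ι => ‖inner ℂ (g p.1) (A (g p.2))‖ ^ 2 := by
    intro A hA
    have h1 : ∑' p : ι × ι, ‖inner ℂ (g p.1) (A (g p.2))‖ₑ ^ 2 ≠ ∞ := by
      rw [ENNReal.tsum_prod' (f := fun p : ι × ι => ‖inner ℂ (g p.1) (A (g p.2))‖ₑ ^ 2), ENNReal.tsum_comm]
      simp_rw [hg (A _)]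
      exact hA
    refine (ENNReal.summable_toReal h1).congr fun p => ?_
    simp
  -- `2|xy| ≤ |x|² + |y|²` and the two Hilbert–Schmidt bounds give absolute summability of the
  -- double series, which permits the exchange of the sums.
  have hxy : Summable (Function.uncurry fun i j => x i j * y j i) := by
    have hy := hsum Y hY
    have hy' := (Equiv.prodComm ι ι).summable_iff.2 hy
    refine Summable.of_norm_bounded ((hsum X hX).add hy') fun p => ?_
    simp only [Function.uncurry, x, y, norm_mul, Function.comp, Equiv.prodComm_apply, Prod.fst_swap,
      Prod.snd_swap]
    nlinarith [sq_nonneg (‖inner ℂ (g p.1) (X (g p.2))‖ - ‖inner ℂ (g p.2) (Y (g p.1))‖),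
      sq_nonneg ‖inner ℂ (g p.1) (X (g p.2))‖, sq_nonneg ‖inner ℂ (g p.2) (Y (g p.1))‖]
  simp_rw [hexp]
  have hc := hxy.tsum_comm
  simp only [x, y] at hc
  rw [← hc]
  congr 1
  ext i
  congr 1
  ext j
  ring

/-- Basis vectors are at distance `√2`, so the balls of radius `1/2` around them are disjoint open
sets in a separable space. Countability lets sums over the basis be exchanged with integrals. -/
theorem countable_hilbertBasis [TopologicalSpace.SeparableSpace H] (b : HilbertBasis ι ℂ H) :
    Countable ι := by
  have h : Pairwise (Function.onFun Disjoint fun i => Metric.ball (b i) (1 / 2)) := by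
    intro i j hij
    refine Metric.ball_disjoint_ball ?_
    have h1 : ‖b i - b j‖ ^ 2 = 2 := by
      rw [@norm_sub_sq ℂ, b.orthonormal.1, b.orthonormal.1, b.orthonormal.2 hij]
      norm_num
    rw [dist_eq_norm]
    nlinarith [norm_nonneg (b i - b j)]
  exact Pairwise.countable_of_isOpen_disjoint h (fun i => Metric.isOpen_ball)
    fun i => ⟨b i, Metric.mem_ball_self (by norm_num)⟩

end HilbertSchmidt

/-! ### Basis independence of weighted traces, and position densities of nonnegative trace-class
operators. -/

section Density

variable {d : ℕ} {ι κ : Type*}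

instance countable_basisIndex : Countable (basisIndex (L2 d)) := by
  have : Fact ((2 : ℝ≥0∞) ≠ ∞) := ⟨by simp⟩
  exact countable_hilbertBasis (onb (L2 d))

/-- Truncating the weight at height `n` gives bounded operators, to which the basis independence of
Hilbert–Schmidt sums applies; monotone convergence removes the truncation. -/
theorem wNorm_eq_iSup {g : Pos d → ℝ} (hg : Measurable g) (v : L2 d) :
    wNorm g v ^ 2 = ⨆ n : ℕ, ‖mulOp (fun y => ((min |g y| n : ℝ) : ℂ)) v‖ₑ ^ 2 := by
  have hm : ∀ n : ℕ, MemLp (fun y => ((min |g y| n : ℝ) : ℂ)) ∞ (volume : Measure (Pos d)) := by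
    intro n
    refine memLp_top_of_norm_le (B := n) (Measurable.aestronglyMeasurable (by fun_prop)) fun y => ?_
    rw [Complex.norm_real, Real.norm_eq_abs, abs_of_nonneg (le_min (abs_nonneg _) (Nat.cast_nonneg _))]
    exact min_le_right _ _
  have h1 : ∀ n : ℕ, ‖mulOp (fun y => ((min |g y| n : ℝ) : ℂ)) v‖ₑ ^ 2
      = ∫⁻ y, ENNReal.ofReal (min |g y| n) ^ 2 * ‖v y‖ₑ ^ 2 := by
    intro n
    have h2 := wNorm_sq (fun _ => 1) (mulOp (fun y => ((min |g y| n : ℝ) : ℂ)) v)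
    rw [wNorm_const] at h2
    simp only [abs_one, ENNReal.ofReal_one, one_mul, enorm_one, one_pow] at h2
    rw [h2]
    apply lintegral_congr_ae
    filter_upwards [mulOp_coeFn (hm n) v] with y hy
    rw [hy, enorm_mul, mul_pow]
    congr 2
    rw [enorm_eq_ofReal_norm, Complex.norm_real, Real.norm_eq_abs, abs_of_nonneg (by positivity)]
  simp_rw [h1]
  rw [wNorm_sq, ← lintegral_iSup']
  · congr 1
    ext y
    rw [← ENNReal.iSup_mul]
    congr 1
    apply le_antisymm
    · obtain ⟨n, hn⟩ := exists_nat_ge |g y|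
      refine le_iSup_of_le n ?_
      rw [min_eq_left hn, enorm_eq_ofReal_norm, Real.norm_eq_abs]
    · refine iSup_le fun n => ?_
      rw [enorm_eq_ofReal_norm, Real.norm_eq_abs]
      gcongr
      exact min_le_left _ _
  · intro n
    have : Measurable fun y => ENNReal.ofReal (min |g y| n) ^ 2 := by fun_prop
    exact this.aemeasurable.mul ((Lp.aestronglyMeasurable v).enorm.pow_const 2)
  · refine Eventually.of_forall fun y m n hmn => ?_
    have : (m : ℝ) ≤ n := by exact_mod_cast hmn
    simp only
    gcongr

/-- For a finite partial sum the supremum over the truncations may be taken outside; each truncated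
sum is basis independent. The roles of `b` and `c` are symmetric, so one inequality suffices. -/
theorem IsParseval.tsum_wNorm_le {b : ι → L2 d} {c : κ → L2 d} (hb : IsParseval b) (hc : IsParseval c)
    {g : Pos d → ℝ} (hg : Measurable g) (A : Op d) :
    ∑' i, wNorm g (A (b i)) ^ 2 ≤ ∑' j, wNorm g (A (c j)) ^ 2 := by
  rw [ENNReal.tsum_eq_iSup_sum]
  refine iSup_le fun s => ?_
  have hmono : ∀ (v : L2 d), Monotone fun n : ℕ => ‖mulOp (fun y => ((min |g y| n : ℝ) : ℂ)) v‖ₑ ^ 2 := by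
    intro v m n hmn
    simp only
    gcongr
    rw [Lp.enorm_def, Lp.enorm_def]
    have hm : ∀ n : ℕ, MemLp (fun y => ((min |g y| n : ℝ) : ℂ)) ∞ (volume : Measure (Pos d)) := by
      intro n
      refine memLp_top_of_norm_le (B := n) (Measurable.aestronglyMeasurable (by fun_prop)) fun y => ?_
      rw [Complex.norm_real, Real.norm_eq_abs, abs_of_nonneg (le_min (abs_nonneg _) (Nat.cast_nonneg _))]
      exact min_le_right _ _
    refine eLpNorm_mono_ae ?_
    filter_upwards [mulOp_coeFn (hm m) v, mulOp_coeFn (hm n) v] with y h1 h2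
    have : (m : ℝ) ≤ n := by exact_mod_cast hmn
    rw [h1, h2, norm_mul, norm_mul, Complex.norm_real, Complex.norm_real, Real.norm_eq_abs,
      Real.norm_eq_abs, abs_of_nonneg (le_min (abs_nonneg (g y)) (Nat.cast_nonneg m)),
      abs_of_nonneg (le_min (abs_nonneg (g y)) (Nat.cast_nonneg n))]
    gcongr
  simp_rw [wNorm_eq_iSup hg]
  rw [ENNReal.finsetSum_iSup_of_monotone fun i => hmono _]
  refine iSup_le fun n => ?_
  calc ∑ i ∈ s, ‖mulOp (fun y => ((min |g y| n : ℝ) : ℂ)) (A (b i))‖ₑ ^ 2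
      ≤ ∑' i, ‖(mulOp (fun y => ((min |g y| n : ℝ) : ℂ)) * A) (b i)‖ₑ ^ 2 := ENNReal.sum_le_tsum s
    _ = ∑' j, ‖(mulOp (fun y => ((min |g y| n : ℝ) : ℂ)) * A) (c j)‖ₑ ^ 2 := hb.tsum_eq hc _
    _ ≤ _ := ENNReal.tsum_le_tsum fun j =>
        le_iSup (fun n : ℕ => ‖mulOp (fun y => ((min |g y| n : ℝ) : ℂ)) (A (c j))‖ₑ ^ 2) n

theorem IsParseval.tsum_costForm_le {b : ι → L2 d} {c : κ → L2 d} (hb : IsParseval b)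
    (hc : IsParseval c) (ħ : ℝ) (x p : Pos d) (A : Op d) :
    ∑' i, costForm ħ x p (A (b i)) ≤ ∑' j, costForm ħ x p (A (c j)) := by
  let FA : Op d := ((Lp.fourierTransformₗᵢ (Pos d) ℂ).toContinuousLinearEquiv : Op d) ∘L A
  simp_rw [costForm_eq_sum]
  rw [ENNReal.tsum_add, ENNReal.tsum_add, ENNReal.tsum_mul_left, ENNReal.tsum_mul_left,
    ENNReal.tsum_mul_left, ENNReal.tsum_mul_left,
    Summable.tsum_finsetSum (fun _ _ => ENNReal.summable),
    Summable.tsum_finsetSum (fun _ _ => ENNReal.summable),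
    Summable.tsum_finsetSum (fun _ _ => ENNReal.summable),
    Summable.tsum_finsetSum (fun _ _ => ENNReal.summable)]
  gcongr with j _ j _
  · exact hb.tsum_wNorm_le hc (by fun_prop) A
  · exact hb.tsum_wNorm_le hc (by fun_prop) FA

theorem IsParseval.tsum_costForm_eq {b : ι → L2 d} {c : κ → L2 d} (hb : IsParseval b)
    (hc : IsParseval c) (ħ : ℝ) (x p : Pos d) (A : Op d) :
    ∑' i, costForm ħ x p (A (b i)) = ∑' j, costForm ħ x p (A (c j)) :=
  le_antisymm (hb.tsum_costForm_le hc ħ x p A) (hc.tsum_costForm_le hb ħ x p A)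

/-- The square root is conjugated along with `Q`, and `U*` maps the fixed basis to another Parseval
family. Basis independence brings the family back, so costs can be compared vector by vector. -/
theorem traceForm_conjOp (ħ : ℝ) (x p : Pos d) (U : L2 d ≃ₗᵢ[ℂ] L2 d) {Q : Op d} (hQ : 0 ≤ Q)
    {b : ι → L2 d} (hb : IsParseval b) :
    traceForm (costForm ħ x p) (conjOp U Q) = ∑' i, costForm ħ x p (U (opSqrt Q (b i))) := by
  unfold traceForm
  rw [opSqrt_conjOp U hQ]
  simp_rw [conjOp_apply]
  exact ((isParseval_onb (L2 d)).map_symm U).tsum_costForm_eq hb ħ x p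
    ((U.toContinuousLinearEquiv : Op d) ∘L opSqrt Q)

/-- `Tr (a Q)` for a nonnegative multiplier `a` and a nonnegative operator `Q`. -/
noncomputable def mulTrace (a : Pos d → ℝ) (Q : Op d) : ℝ≥0∞ :=
  ∑' i, ∫⁻ y, ENNReal.ofReal (a y) * ‖opSqrt Q (onb (L2 d) i) y‖ₑ ^ 2

theorem lintegral_mul_enorm_sq {a : Pos d → ℝ} (ham : Measurable a) (ha0 : ∀ y, 0 ≤ a y) {B : ℝ}
    (haB : ∀ y, a y ≤ B) (v : L2 d) :
    ∫⁻ y, ENNReal.ofReal (a y) * ‖v y‖ₑ ^ 2 = ‖mulOp (fun y => ((Real.sqrt (a y) : ℝ) : ℂ)) v‖ₑ ^ 2 := by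
  have hm : MemLp (fun y => ((Real.sqrt (a y) : ℝ) : ℂ)) ∞ (volume : Measure (Pos d)) := by
    refine memLp_top_of_norm_le (B := Real.sqrt B) (Measurable.aestronglyMeasurable (by fun_prop)) fun y => ?_
    rw [Complex.norm_real, Real.norm_eq_abs, abs_of_nonneg (by positivity)]
    exact Real.sqrt_le_sqrt (haB y)
  have h2 := wNorm_sq (fun _ => 1) (mulOp (fun y => ((Real.sqrt (a y) : ℝ) : ℂ)) v)
  rw [wNorm_const] at h2
  simp only [abs_one, ENNReal.ofReal_one, one_mul, enorm_one, one_pow] at h2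
  rw [h2]
  apply lintegral_congr_ae
  filter_upwards [mulOp_coeFn hm v] with y hy
  rw [hy, enorm_mul, mul_pow]
  congr 1
  rw [enorm_eq_ofReal_norm, Complex.norm_real, Real.norm_eq_abs, abs_of_nonneg (by positivity),
    ← ENNReal.ofReal_pow (by positivity), Real.sq_sqrt (ha0 y)]

theorem mulTrace_conjOp {a : Pos d → ℝ} (ham : Measurable a) (ha0 : ∀ y, 0 ≤ a y) {B : ℝ}
    (haB : ∀ y, a y ≤ B) (U : L2 d ≃ₗᵢ[ℂ] L2 d) {Q : Op d} (hQ : 0 ≤ Q) :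
    mulTrace a (conjOp U Q)
      = ∑' i, ∫⁻ y, ENNReal.ofReal (a y) * ‖U (opSqrt Q (onb (L2 d) i)) y‖ₑ ^ 2 := by
  unfold mulTrace
  rw [opSqrt_conjOp U hQ]
  simp_rw [lintegral_mul_enorm_sq ham ha0 haB, conjOp_apply]
  exact ((isParseval_onb (L2 d)).map_symm U).tsum_eq (isParseval_onb (L2 d))
    (mulOp (fun y => ((Real.sqrt (a y) : ℝ) : ℂ)) ∘L (U.toContinuousLinearEquiv : Op d) ∘L opSqrt Q)

/-- The square root is not linear in `Q`. Passing to the adjoint of `a^{1/2} Q^{1/2}` gives a series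
whose terms are linear in `Q`, so that a weak integral of operators can be taken term by term. -/
theorem mulTrace_eq_tsum_inner {a : Pos d → ℝ} (ham : Measurable a) (ha0 : ∀ y, 0 ≤ a y) {B : ℝ}
    (haB : ∀ y, a y ≤ B) {Q : Op d} (hQ : 0 ≤ Q) :
    mulTrace a Q = ∑' i, ENNReal.ofReal
      (inner ℂ (mulOp (fun y => ((Real.sqrt (a y) : ℝ) : ℂ)) (onb (L2 d) i))
        (Q (mulOp (fun y => ((Real.sqrt (a y) : ℝ) : ℂ)) (onb (L2 d) i)))).re := by
  set S := mulOp (fun y => ((Real.sqrt (a y) : ℝ) : ℂ)) with hS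
  have hm : MemLp (fun y => ((Real.sqrt (a y) : ℝ) : ℂ)) ∞ (volume : Measure (Pos d)) := by
    refine memLp_top_of_norm_le (B := Real.sqrt B) (Measurable.aestronglyMeasurable (by fun_prop)) fun y => ?_
    rw [Complex.norm_real, Real.norm_eq_abs, abs_of_nonneg (by positivity)]
    exact Real.sqrt_le_sqrt (haB y)
  have hadj : ContinuousLinearMap.adjoint S = S := by
    symm
    rw [ContinuousLinearMap.eq_adjoint_iff]
    intro u v
    rw [hS, inner_mulOp hm]
    simp
  have h1 : mulTrace a Q = ∑' i, ‖(S * opSqrt Q) (onb (L2 d) i)‖ₑ ^ 2 := by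
    unfold mulTrace
    simp_rw [lintegral_mul_enorm_sq ham ha0 haB]
    rfl
  rw [h1, (isParseval_onb _).tsum_adjoint (isParseval_onb _)]
  have h2 : ContinuousLinearMap.adjoint (S * opSqrt Q) = opSqrt Q * S := by
    rw [ContinuousLinearMap.mul_def, ContinuousLinearMap.adjoint_comp, adjoint_opSqrt, hadj]
    rfl
  rw [h2]
  congr 1
  ext i
  rw [ofReal_inner_nonneg_op hQ]
  rfl

/-- The integral of `Tr (a Q(z))` against a weakly integrable operator-valued function. -/
theorem lintegral_mulTrace {Z : Type*} [MeasurableSpace Z] {μ : Measure Z} {a : Pos d → ℝ} (ham : Measurable a)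
    (ha0 : ∀ y, 0 ≤ a y) {B : ℝ} (haB : ∀ y, a y ≤ B) {Q : Z → Op d} {ω : Op d} (hQ : ∀ᵐ z ∂μ, 0 ≤ Q z)
    (hω : 0 ≤ ω) (hint : ∀ u, Integrable (fun z => inner ℂ u (Q z u)) μ ∧
      ∫ z, inner ℂ u (Q z u) ∂μ = inner ℂ u (ω u)) :
    ∫⁻ z, mulTrace a (Q z) ∂μ = mulTrace a ω := by
  rw [mulTrace_eq_tsum_inner ham ha0 haB hω]
  have h1 : ∫⁻ z, mulTrace a (Q z) ∂μ = ∫⁻ z, ∑' i, ENNReal.ofReal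
      (inner ℂ (mulOp (fun y => ((Real.sqrt (a y) : ℝ) : ℂ)) (onb (L2 d) i))
        (Q z (mulOp (fun y => ((Real.sqrt (a y) : ℝ) : ℂ)) (onb (L2 d) i)))).re ∂μ := by
    apply lintegral_congr_ae
    filter_upwards [hQ] with z hz
    exact mulTrace_eq_tsum_inner ham ha0 haB hz
  have h2 : ∀ u, Integrable (fun z => (inner ℂ u (Q z u)).re) μ := fun u => (hint u).1.re
  rw [h1, lintegral_tsum fun i => (h2 _).aestronglyMeasurable.aemeasurable.ennreal_ofReal]
  congr 1
  ext i
  set u := mulOp (fun y => ((Real.sqrt (a y) : ℝ) : ℂ)) (onb (L2 d) i)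
  rw [← ofReal_integral_eq_lintegral_ofReal (h2 u), ← (hint u).2]
  · have h3 := Complex.reCLM.integral_comp_comm (hint u).1
    simp only [Complex.reCLM_apply] at h3
    rw [h3]
  · filter_upwards [hQ] with z hz
    simp only [Pi.zero_apply]
    rw [inner_nonneg_op hz, Complex.ofReal_re]
    positivity

/-- The position density of `Q`, with values in `[0,∞]`. -/
noncomputable def eDensity (Q : Op d) (y : Pos d) : ℝ≥0∞ :=
  ∑' i, ‖opSqrt Q (onb (L2 d) i) y‖ₑ ^ 2

theorem aemeasurable_eDensity (Q : Op d) : AEMeasurable (eDensity Q) volume := by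
  unfold eDensity
  exact AEMeasurable.tsum fun i => (Lp.aestronglyMeasurable _).enorm.pow_const 2

theorem lintegral_mul_eDensity {a : Pos d → ℝ} (ham : Measurable a) (Q : Op d) :
    ∫⁻ y, ENNReal.ofReal (a y) * eDensity Q y = mulTrace a Q := by
  unfold mulTrace eDensity
  simp_rw [← ENNReal.tsum_mul_left]
  exact lintegral_tsum fun i =>
    ham.ennreal_ofReal.aemeasurable.mul ((Lp.aestronglyMeasurable _).enorm.pow_const 2)

theorem lintegral_eDensity {Q : Op d} (hQ : 0 ≤ Q) : ∫⁻ y, eDensity Q y = traceNorm Q := by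
  have h := lintegral_mul_eDensity (a := fun _ => 1) measurable_const Q
  simp only [ENNReal.ofReal_one, one_mul] at h
  rw [h, traceNorm_eq hQ]
  unfold mulTrace
  congr 1
  ext i
  have h2 := wNorm_sq (fun _ => 1) (opSqrt Q (onb (L2 d) i))
  rw [wNorm_const] at h2
  simp only [abs_one, ENNReal.ofReal_one, one_mul, enorm_one, one_pow] at h2
  rw [h2]
  simp

/-- Cyclicity gives `Tr(aQ) = Tr(Q^{1/2} a Q^{1/2})`, both `aQ^{1/2}` and `Q^{1/2}` being
Hilbert–Schmidt, and the right-hand side is the integral of `a` against `∑ |Q^{1/2} e_i|²`. In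
particular `positionDensity` does not take its default value `0` for such `Q`. -/
theorem isPositionDensity_eDensity {Q : Op d} (hQ : 0 ≤ Q) (ht : IsTraceClass Q) :
    IsPositionDensity Q fun y => (((eDensity Q y).toReal : ℝ) : ℂ) := by
  have hfin : ∫⁻ y, eDensity Q y ≠ ∞ := by rw [lintegral_eDensity hQ]; exact ht.ne
  have hae : ∀ᵐ y, eDensity Q y < ∞ := ae_lt_top' (aemeasurable_eDensity Q) hfin
  refine ⟨(integrable_toReal_of_lintegral_ne_top (aemeasurable_eDensity Q) hfin).ofReal, fun a ha => ?_⟩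
  have hS : ∑' i, ‖opSqrt Q (onb (L2 d) i)‖ₑ ^ 2 ≠ ∞ := by
    rw [← traceNorm_eq hQ]; exact ht.ne
  have hMS : ∑' i, ‖(mulOp a * opSqrt Q) (onb (L2 d) i)‖ₑ ^ 2 ≠ ∞ := by
    have : ∑' i, ‖(mulOp a * opSqrt Q) (onb (L2 d) i)‖ₑ ^ 2
        ≤ ‖mulOp a‖ₑ ^ 2 * ∑' i, ‖opSqrt Q (onb (L2 d) i)‖ₑ ^ 2 := by
      rw [← ENNReal.tsum_mul_left]
      refine ENNReal.tsum_le_tsum fun i => ?_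
      rw [← mul_pow]
      gcongr
      exact (mulOp a).le_opENorm _
    exact ne_top_of_le_ne_top (ENNReal.mul_ne_top (by simp) hS) this
  unfold opTrace
  have h1 := tsum_inner_comm (onb (L2 d)) rfl hMS hS
  have h2 : ∀ i, inner ℂ (onb (L2 d) i) ((mulOp a * Q) (onb (L2 d) i))
      = inner ℂ (onb (L2 d) i) ((mulOp a * opSqrt Q) (opSqrt Q (onb (L2 d) i))) := by
    intro i
    change inner ℂ _ (mulOp a (Q _)) = inner ℂ _ (mulOp a (opSqrt Q (opSqrt Q _)))
    rw [opSqrt_opSqrt hQ]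
  simp_rw [h2]
  rw [h1]
  have h3 : ∀ i, inner ℂ (onb (L2 d) i) (opSqrt Q ((mulOp a * opSqrt Q) (onb (L2 d) i)))
      = ∫ y, a y * ((‖opSqrt Q (onb (L2 d) i) y‖ ^ 2 : ℝ) : ℂ) := by
    intro i
    change inner ℂ _ (opSqrt Q (mulOp a (opSqrt Q _))) = _
    rw [← inner_opSqrt, L2.inner_def]
    apply integral_congr_ae
    filter_upwards [mulOp_coeFn ha (opSqrt Q (onb (L2 d) i))] with y hy
    rw [hy, RCLike.inner_apply]
    have := Complex.mul_conj (opSqrt Q (onb (L2 d) i) y)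
    rw [mul_assoc, this, Complex.normSq_eq_norm_sq]
  simp_rw [h3]
  have hint : ∀ i, Integrable fun y => ((‖opSqrt Q (onb (L2 d) i) y‖ ^ 2 : ℝ) : ℂ) := fun i =>
    ((Lp.memLp (opSqrt Q (onb (L2 d) i))).integrable_norm_pow (p := 2) (by norm_num)).ofReal
  have hint' : ∀ i, Integrable fun y => a y * ((‖opSqrt Q (onb (L2 d) i) y‖ ^ 2 : ℝ) : ℂ) := fun i => by
    exact (hint i).mul_of_top_right ha
  rw [← integral_tsum (fun i => (hint' i).aestronglyMeasurable)]
  · apply integral_congr_ae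
    filter_upwards [hae] with y hy
    rw [tsum_mul_left, ← Complex.ofReal_tsum]
    congr 2
    unfold eDensity
    rw [ENNReal.tsum_toReal_eq (fun i => by simp)]
    simp
  · obtain ⟨C, hC⟩ : ∃ C : ℝ≥0, ∀ᵐ y, ‖a y‖ₑ ≤ C := by
      have h4 := ha.2
      rw [eLpNorm_exponent_top] at h4
      refine ⟨(eLpNormEssSup a volume).toNNReal, ?_⟩
      rw [ENNReal.coe_toNNReal h4.ne]
      exact enorm_ae_le_eLpNormEssSup a volume
    refine ne_top_of_le_ne_top (b := C * traceNorm Q) (ENNReal.mul_ne_top (by simp) ht.ne) ?_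
    rw [traceNorm_eq hQ, ← ENNReal.tsum_mul_left]
    refine ENNReal.tsum_le_tsum fun i => ?_
    have h5 := wNorm_sq (fun _ => 1) (opSqrt Q (onb (L2 d) i))
    rw [wNorm_const] at h5
    simp only [abs_one, ENNReal.ofReal_one, one_mul, enorm_one, one_pow] at h5
    rw [h5, ← lintegral_const_mul' _ _ (by simp)]
    apply lintegral_mono_ae
    filter_upwards [hC] with y hy
    rw [enorm_mul, enorm_eq_ofReal_norm ((‖opSqrt Q (onb (L2 d) i) y‖ ^ 2 : ℝ) : ℂ),
      Complex.norm_real, Real.norm_eq_abs, abs_of_nonneg (by positivity), ← ennreal_sq_ofReal_norm]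
    gcongr

/-- Integrals against the position density. -/
theorem integral_mul_positionDensity {Q : Op d} (hQ : 0 ≤ Q) (ht : IsTraceClass Q) {a : Pos d → ℝ}
    (ham : Measurable a) {B : ℝ} (haB : ∀ y, |a y| ≤ B) :
    ∫ y, (a y : ℂ) * positionDensity Q y = ((∫ y, a y * (eDensity Q y).toReal : ℝ) : ℂ) := by
  have hex : ∃ ρ, IsPositionDensity Q ρ := ⟨_, isPositionDensity_eDensity hQ ht⟩
  have h1 : IsPositionDensity Q (positionDensity Q) := by
    rw [positionDensity, dif_pos hex]
    exact hex.choose_spec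
  have hm : MemLp (fun y => (a y : ℂ)) ∞ (volume : Measure (Pos d)) := by
    refine memLp_top_of_norm_le (B := B) (Measurable.aestronglyMeasurable (by fun_prop)) fun y => ?_
    rw [Complex.norm_real]
    exact haB y
  rw [← h1.2 _ hm, (isPositionDensity_eDensity hQ ht).2 _ hm, ← integral_complex_ofReal]
  push_cast
  rfl

end Density


/-! ### Schrödinger propagators with bounded time-dependent potentials -/

section Propagator

variable {d : ℕ}

/-- Norm-continuous families of bounded symmetric operators. -/
structure IsBoundedHamiltonian (M : ℝ → Op d) (B : ℝ≥0) : Prop where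
  continuous : Continuous M
  norm_le : ∀ t, ‖M t‖ ≤ B
  symmetric : ∀ t u v, inner ℂ (M t u) v = inner ℂ u (M t v)

/-- The generator `-iκ S(-ct) M(t) S(ct)` of the interaction picture, `S` being the free group. -/
noncomputable def interactionField (c κ : ℝ) (M : ℝ → Op d) (t : ℝ) (y : L2 d) : L2 d :=
  (-(Complex.I * κ)) • freeProp (-(c * t)) (M t (freeProp (c * t) y))

theorem norm_neg_I_mul (κ : ℝ) : ‖(-(Complex.I * κ) : ℂ)‖ = |κ| := by simp

namespace IsBoundedHamiltonian

variable {M : ℝ → Op d} {B : ℝ≥0} (hM : IsBoundedHamiltonian M B) (c κ : ℝ)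

-- The interaction picture removes the Laplacian: what remains is bounded by `|κ|B` in operator norm
-- and strongly continuous in time, so the Picard theory above applies.
include hM in
theorem isLipschitzField : IsLipschitzField (interactionField c κ M) (‖κ‖₊ * B) where
  continuous x := by
    unfold interactionField
    have h : Continuous fun t => freeProp (-(c * t)) (M t (freeProp (c * t) x)) :=
      continuous_freeProp_comp (by fun_prop)
        (hM.continuous.clm_apply (continuous_freeProp_comp (by fun_prop) continuous_const))
    exact h.const_smul (-(Complex.I * κ) : ℂ)
  lipschitz t := by
    refine LipschitzWith.of_dist_le_mul fun x y => ?_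
    rw [dist_eq_norm, dist_eq_norm]
    unfold interactionField
    rw [← smul_sub, norm_smul, norm_neg_I_mul, ← freeProp_sub_vec, norm_freeProp, ← map_sub,
      ← freeProp_sub_vec]
    calc |κ| * ‖M t (freeProp (c * t) (x - y))‖ ≤ |κ| * (B * ‖x - y‖) := by
          gcongr
          refine ((M t).le_of_opNorm_le (hM.norm_le t) _).trans ?_
          rw [norm_freeProp]
      _ = _ := by push_cast; rw [Real.norm_eq_abs]; ring
  bounded x := by
    refine ⟨|κ| * (B * ‖x‖), fun t => ?_⟩
    unfold interactionField
    rw [norm_smul, norm_neg_I_mul, norm_freeProp]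
    gcongr
    refine ((M t).le_of_opNorm_le (hM.norm_le t) _).trans ?_
    rw [norm_freeProp]

-- The derivative of `⟨y, y⟩` vanishes, because the generator is `-iκ` times a symmetric operator.
include hM in
theorem norm_solution {y : ℝ → L2 d} (hy : ∀ t, HasDerivAt y (interactionField c κ M t (y t)) t)
    (s t : ℝ) : ‖y s‖ = ‖y t‖ := by
  have h1 : ∀ t, HasDerivAt (fun t => inner ℂ (y t) (y t)) 0 t := by
    intro t
    have h2 := HasDerivAt.inner ℂ (hy t) (hy t)
    refine h2.congr_deriv ?_
    unfold interactionField
    rw [inner_smul_left, inner_smul_right]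
    have h3 : inner ℂ (freeProp (-(c * t)) (M t (freeProp (c * t) (y t)))) (y t)
        = inner ℂ (y t) (freeProp (-(c * t)) (M t (freeProp (c * t) (y t)))) := by
      conv_lhs => rw [← freeUnitary_apply, ← LinearIsometryEquiv.inner_map_map (freeUnitary (c * t)),
        freeUnitary_apply, freeUnitary_apply, freeUnitary_apply, freeProp_freeProp_neg]
      conv_rhs => rw [← freeUnitary_apply (-(c * t)),
        ← LinearIsometryEquiv.inner_map_map (freeUnitary (c * t)),
        freeUnitary_apply, freeUnitary_apply, freeUnitary_apply, freeProp_freeProp_neg]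
      exact hM.symmetric _ _ _
    rw [h3, map_neg, map_mul, Complex.conj_I, Complex.conj_ofReal]
    ring
  have h4 := is_const_of_deriv_eq_zero (fun t => (h1 t).differentiableAt) (fun t => (h1 t).deriv) s t
  rw [inner_self_eq_norm_sq_to_K, inner_self_eq_norm_sq_to_K] at h4
  have h5 : ‖y s‖ ^ 2 = ‖y t‖ ^ 2 := by exact_mod_cast h4
  exact (sq_eq_sq₀ (norm_nonneg _) (norm_nonneg _)).1 h5

/-- The propagator of the interaction picture from time `0`. -/
noncomputable def interactionUnitary (t : ℝ) : L2 d ≃ₗᵢ[ℂ] L2 d where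
  toFun := (hM.isLipschitzField c κ).flow 0 t
  invFun := (hM.isLipschitzField c κ).flow t 0
  left_inv x := by rw [IsLipschitzField.flow_flow, IsLipschitzField.flow_self]
  right_inv x := by rw [IsLipschitzField.flow_flow, IsLipschitzField.flow_self]
  -- Linearity comes from uniqueness: the sum of two solutions solves the same linear equation.
  map_add' x y := by
    set hv := hM.isLipschitzField c κ
    have h : ∀ s, HasDerivAt (fun s => hv.flow 0 s x + hv.flow 0 s y)
        (interactionField c κ M s (hv.flow 0 s x + hv.flow 0 s y)) s := by
      intro s
      refine ((hv.hasDerivAt_flow 0 s x).add (hv.hasDerivAt_flow 0 s y)).congr_deriv ?_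
      unfold interactionField
      rw [freeProp_add_vec, map_add, freeProp_add_vec, smul_add]
    have h2 := hv.eq_flow h 0 t
    rw [hv.flow_self, hv.flow_self] at h2
    exact h2.symm
  map_smul' a x := by
    set hv := hM.isLipschitzField c κ
    have h : ∀ s, HasDerivAt (fun s => a • hv.flow 0 s x)
        (interactionField c κ M s (a • hv.flow 0 s x)) s := by
      intro s
      refine ((hv.hasDerivAt_flow 0 s x).const_smul a).congr_deriv ?_
      unfold interactionField
      rw [freeProp_smul_vec, map_smul, freeProp_smul_vec, smul_comm]
    have h2 := hv.eq_flow h 0 t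
    rw [hv.flow_self] at h2
    exact h2.symm
  norm_map' x := by
    set hv := hM.isLipschitzField c κ
    have h := hM.norm_solution c κ (fun t => hv.hasDerivAt_flow 0 t x) t 0
    rw [hv.flow_self] at h
    exact h

theorem interactionUnitary_apply (t : ℝ) (x : L2 d) :
    hM.interactionUnitary c κ t x = (hM.isLipschitzField c κ).flow 0 t x := rfl

/-- The propagator of `i ∂ₜψ = c (-Δ/2) ψ + κ M(t) ψ` from time `0`. -/
noncomputable def propagator (t : ℝ) : L2 d ≃ₗᵢ[ℂ] L2 d :=
  (hM.interactionUnitary c κ t).trans (freeUnitary (c * t))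

theorem propagator_apply (t : ℝ) (x : L2 d) :
    hM.propagator c κ t x = freeProp (c * t) (hM.interactionUnitary c κ t x) := by
  unfold propagator
  rw [LinearIsometryEquiv.trans_apply, freeUnitary_apply]

theorem continuous_interactionUnitary (x : L2 d) :
    Continuous fun t => hM.interactionUnitary c κ t x :=
  (hM.isLipschitzField c κ).continuous_flow_time 0 x

theorem continuous_propagator (x : L2 d) : Continuous fun t => hM.propagator c κ t x := by
  simp_rw [propagator_apply]
  exact continuous_freeProp_comp (by fun_prop) (hM.continuous_interactionUnitary c κ x)

end IsBoundedHamiltonian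

/-- `freeProp τ` commutes with integrals. -/
theorem freeProp_intervalIntegral (τ : ℝ) {g : ℝ → L2 d} {a b : ℝ}
    (hg : IntervalIntegrable g volume a b) :
    freeProp τ (∫ s in a..b, g s) = ∫ s in a..b, freeProp τ (g s) := by
  have h := ((freeUnitary τ : L2 d ≃ₗᵢ[ℂ] L2 d).toContinuousLinearEquiv : Op d).intervalIntegral_comp_comm
    hg
  simp only [ContinuousLinearEquiv.coe_coe, LinearIsometryEquiv.coe_toContinuousLinearEquiv,
    freeUnitary_apply] at h
  exact h.symm

namespace IsBoundedHamiltonian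

variable {M : ℝ → Op d} {B : ℝ≥0} (hM : IsBoundedHamiltonian M B) (c κ : ℝ)

/-- Continuous mild solutions are given by the propagator. -/
theorem eq_propagator_of_mild {φ₀ : L2 d} {φ : ℝ → L2 d} (hφ : Continuous φ)
    (h : ∀ t, φ t = freeProp (c * t) φ₀
      - (Complex.I * κ) • ∫ s in (0 : ℝ)..t, freeProp (c * (t - s)) (M s (φ s))) (t : ℝ) :
    φ t = hM.propagator c κ t φ₀ := by
  set g : ℝ → L2 d := fun s => freeProp (-(c * s)) (M s (φ s)) with hg
  have hgc : Continuous g := continuous_freeProp_comp (by fun_prop) (hM.continuous.clm_apply hφ)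
  -- The group law takes `S(ct)` out of the Duhamel integral. The remaining bracket is a primitive
  -- of a continuous function and is differentiable, although `φ` itself need not be.
  have h1 : ∀ t, φ t = freeProp (c * t) (φ₀ - (Complex.I * κ) • ∫ s in (0 : ℝ)..t, g s) := by
    intro t
    rw [freeProp_sub_vec, freeProp_smul_vec, freeProp_intervalIntegral _ (hgc.intervalIntegrable _ _), h t]
    congr 3
    ext1 s
    rw [hg]
    simp only
    rw [← freeProp_add]
    congr 1
    ring
  set y : ℝ → L2 d := fun t => φ₀ - (Complex.I * κ) • ∫ s in (0 : ℝ)..t, g s with hy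
  have h2 : ∀ t, HasDerivAt y (interactionField c κ M t (y t)) t := by
    intro t
    have h3 := ((hgc.integral_hasStrictDerivAt 0 t).hasDerivAt.const_smul (Complex.I * κ)).const_sub φ₀
    refine h3.congr_deriv ?_
    unfold interactionField
    rw [neg_smul, hg]
    simp only
    rw [h1 t]
  have h4 := (hM.isLipschitzField c κ).eq_flow h2 0 t
  rw [h1 t, propagator_apply, interactionUnitary_apply]
  change freeProp _ (y t) = _
  rw [h4]
  simp [hy]

/-- Continuous mild solutions of the von Neumann equation are given by conjugation with the
propagator. The Hamiltonian `M'` of the equation has to agree with `M` on `(-T, T)` only. -/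
theorem eq_conjOp_of_mild {M' : ℝ → Op d} (hM' : Continuous M') {T : ℝ}
    (hMM' : ∀ s ∈ Set.Ioo (-T) T, M' s = M s) {ω₀ : Op d} {ω : ℝ → Op d} (hω : Continuous ω)
    (h : ∀ (t : ℝ) (u : L2 d), ω t u = freeProp (c * t) (ω₀ (freeProp (-(c * t)) u))
      - (Complex.I * κ) • ∫ s in (0 : ℝ)..t,
          freeProp (c * (t - s)) ((M' s * ω s - ω s * M' s) (freeProp (-(c * (t - s))) u))) {t : ℝ} (ht : t ∈ Set.Ioo (-T) T) :
    ω t = conjOp (hM.propagator c κ t) ω₀ := by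
  -- the interaction picture
  let S : ℝ → Op d := fun τ => ((freeUnitary τ : L2 d ≃ₗᵢ[ℂ] L2 d).toContinuousLinearEquiv : Op d)
  have hS : ∀ τ u, S τ u = freeProp τ u := fun τ u => freeUnitary_apply τ u
  let η : ℝ → Op d := fun t => S (-(c * t)) * ω t * S (c * t)
  have hη : ∀ t u, η t u = freeProp (-(c * t)) (ω t (freeProp (c * t) u)) := by
    intro t u
    change S _ (ω t (S _ u)) = _
    rw [hS, hS]
  have hcomm : ∀ u, Continuous fun s =>
      freeProp (-(c * s)) ((M' s * ω s - ω s * M' s) (freeProp (c * s) u)) := by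
    intro u
    refine continuous_freeProp_comp (by fun_prop) ?_
    refine Continuous.clm_apply ?_ (continuous_freeProp_comp (by fun_prop) continuous_const)
    exact (hM'.mul hω).sub (hω.mul hM')
  have h1 : ∀ t u, η t u = ω₀ u - (Complex.I * κ) • ∫ s in (0 : ℝ)..t,
      freeProp (-(c * s)) ((M' s * ω s - ω s * M' s) (freeProp (c * s) u)) := by
    intro t u
    have h2 : freeProp (c * t) (η t u) = freeProp (c * t) (ω₀ u - (Complex.I * κ) • ∫ s in (0 : ℝ)..t,
        freeProp (-(c * s)) ((M' s * ω s - ω s * M' s) (freeProp (c * s) u))) := by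
      rw [hη, freeProp_freeProp_neg, h, freeProp_neg_freeProp, freeProp_sub_vec, freeProp_smul_vec,
        freeProp_intervalIntegral _ ((hcomm u).intervalIntegrable _ _)]
      congr 3
      ext1 s
      rw [← freeProp_add, ← freeProp_add]
      congr 2
      · ring
      · congr 1
        ring
    rw [← freeProp_neg_freeProp (c * t) (η t u), h2, freeProp_neg_freeProp]
  have hderiv : ∀ t u, HasDerivAt (fun t => η t u)
      ((-(Complex.I * κ)) • freeProp (-(c * t)) ((M' t * ω t - ω t * M' t) (freeProp (c * t) u))) t := by
    intro t u
    have h3 := (((hcomm u).integral_hasStrictDerivAt 0 t).hasDerivAt.const_smul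
      (Complex.I * κ)).const_sub (ω₀ u)
    simp_rw [h1, neg_smul]
    exact h3
  -- `η` is differentiated only on fixed vectors, so the product rule for `η t (y t)` needs joint
  -- continuity in time and vector.
  have hηc : ∀ t u, Tendsto (fun p : ℝ × L2 d => η p.1 p.2) (𝓝 t ×ˢ 𝓝 u) (𝓝 (η t u)) := by
    intro t u
    have h4 : Continuous fun p : ℝ × L2 d => freeProp (-(c * p.1)) (ω p.1 (freeProp (c * p.1) p.2)) := by
      refine continuous_freeProp_comp (by fun_prop) ?_
      exact (hω.comp continuous_fst).clm_apply (continuous_freeProp_comp (by fun_prop) continuous_snd)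
    simp_rw [hη]
    have h5 := h4.tendsto (t, u)
    rwa [nhds_prod_eq] at h5
  -- With `W` the interaction propagator, `η t (W t u)` and `W t (ω₀ u)` solve the same equation
  -- with the same initial value: the commutator in the derivative of `η` replaces `η` applied to
  -- the generator by the generator applied to `η`.
  have hmain : ∀ u, η t (hM.interactionUnitary c κ t u) = hM.interactionUnitary c κ t (ω₀ u) := by
    intro u
    have hz : ∀ t ∈ Set.Ioo (-T) T, HasDerivAt (fun t => η t (hM.interactionUnitary c κ t u))
        (interactionField c κ M t (η t (hM.interactionUnitary c κ t u))) t := by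
      intro t ht
      have hy : HasDerivAt (fun t => hM.interactionUnitary c κ t u)
          (interactionField c κ M t (hM.interactionUnitary c κ t u)) t :=
        (hM.isLipschitzField c κ).hasDerivAt_flow 0 t u
      have h6 := hasDerivAt_iff_tendsto_slope.1 hy
      have h7 := hasDerivAt_iff_tendsto_slope.1 (hderiv t (hM.interactionUnitary c κ t u))
      rw [hasDerivAt_iff_tendsto_slope]
      -- The slope of the product is `η s` applied to the slope of `W`, plus the slope of `η` on the
      -- fixed vector `W t u`.
      have h8 := (hηc t _).comp ((tendsto_id'.2 nhdsWithin_le_nhds).prodMk h6)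
      convert h8.add h7 using 1
      · ext1 s
        simp only [slope_def_module, Function.comp, id]
        rw [LinearMapClass.map_smul_of_tower (η s), ← smul_add, map_sub]
        congr 1
        abel
      · congr 1
        rw [hη]
        unfold interactionField
        rw [hη, freeProp_smul_vec, map_smul, freeProp_smul_vec, ← smul_add, ← freeProp_add_vec]
        congr 2
        simp only [sub_apply, freeProp_freeProp_neg, hMM' t ht]
        change _ = ω t (M t _) + (M t (ω t _) - ω t (M t _))
        rw [add_sub_cancel]
    have h10 : η 0 (hM.interactionUnitary c κ 0 u) = hM.interactionUnitary c κ 0 (ω₀ u) := by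
      rw [interactionUnitary_apply, interactionUnitary_apply, IsLipschitzField.flow_self,
        IsLipschitzField.flow_self, h1]
      simp
    have hT : (0 : ℝ) ∈ Set.Ioo (-T) T := by
      have := ht.1.trans ht.2
      constructor <;> linarith
    exact ODE_solution_unique_of_mem_Ioo (v := interactionField c κ M) (s := fun _ => Set.univ)
      (fun t _ => ((hM.isLipschitzField c κ).lipschitz t).lipschitzOnWith) hT
      (fun t ht => ⟨hz t ht, Set.mem_univ _⟩)
      (fun t _ => ⟨(hM.isLipschitzField c κ).hasDerivAt_flow 0 t (ω₀ u), Set.mem_univ _⟩) h10 ht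
  ext1 u
  rw [conjOp_apply, propagator_apply, ← hmain, hη, freeProp_freeProp_neg, ← propagator_apply,
    LinearIsometryEquiv.apply_symm_apply]

end IsBoundedHamiltonian

/-- Bounded potentials that are continuous in time, uniformly in space. -/
structure IsRegularPotential (w : ℝ → Pos d → ℝ) (B : ℝ≥0) : Prop where
  measurable : ∀ t, Measurable (w t)
  bound : ∀ t y, |w t y| ≤ B
  equicontinuous : ∀ s, ∀ ε > 0, ∀ᶠ t in 𝓝 s, ∀ y, |w t y - w s y| ≤ ε

namespace IsRegularPotential

variable {w : ℝ → Pos d → ℝ} {B : ℝ≥0}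

theorem memLp (hw : IsRegularPotential w B) (t : ℝ) :
    MemLp (fun y => (w t y : ℂ)) ∞ (volume : Measure (Pos d)) := by
  have := hw.measurable t
  refine memLp_top_of_norm_le (B := B) (Measurable.aestronglyMeasurable (by fun_prop)) fun y => ?_
  rw [Complex.norm_real]
  exact hw.bound t y

theorem isBoundedHamiltonian (hw : IsRegularPotential w B) :
    IsBoundedHamiltonian (fun t => mulOp fun y => (w t y : ℂ)) B where
  continuous := by
    refine continuous_iff_continuousAt.2 fun s => ?_
    rw [ContinuousAt, Metric.tendsto_nhds]
    intro ε hε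
    filter_upwards [hw.equicontinuous s (ε / 2) (by positivity)] with t ht
    rw [dist_eq_norm, mulOp_sub (hw.memLp t) (hw.memLp s)]
    refine lt_of_le_of_lt (norm_mulOp_le (B := ε / 2) ((hw.memLp t).sub (hw.memLp s)) fun y => ?_)
      (by linarith)
    simp only [Pi.sub_apply]
    rw [← Complex.ofReal_sub, Complex.norm_real]
    exact ht y
  norm_le t := norm_mulOp_le (hw.memLp t) fun y => by
    rw [Complex.norm_real]
    exact hw.bound t y
  symmetric t u v := by
    rw [inner_mulOp (hw.memLp t)]
    simp

end IsRegularPotential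

end Propagator


/-! ### Splitting of the classical and the quantum evolution into kicks and drifts -/

section Splitting

variable {d : ℕ}

/-- Bounded Lipschitz forces that are continuous in time. -/
structure IsRegularForce (F : ℝ → Pos d → Pos d) (B L : ℝ≥0) : Prop where
  continuous : ∀ x, Continuous fun t => F t x
  bound : ∀ t x, ‖F t x‖ ≤ B
  lipschitz : ∀ t, LipschitzWith L (F t)

/-- The Newton vector field `(x, p) ↦ (p, F(t, x))`. -/
def newtonField (F : ℝ → Pos d → Pos d) (t : ℝ) (z : Phase d) : Phase d := (z.2, F t z.1)

/-- A kick by the force at time `s`, followed by a drift, of duration `τ`. -/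
def kickDrift (F : ℝ → Pos d → Pos d) (s τ : ℝ) (z : Phase d) : Phase d :=
  (z.1 + τ • (z.2 + τ • F s z.1), z.2 + τ • F s z.1)

namespace IsRegularForce

variable {F : ℝ → Pos d → Pos d} {B L : ℝ≥0}

theorem isLipschitzField (hF : IsRegularForce F B L) : IsLipschitzField (newtonField F) (max 1 L) where
  continuous z := by
    unfold newtonField
    exact continuous_const.prodMk (hF.continuous z.1)
  lipschitz t := by
    have h1 : LipschitzWith 1 fun z : Phase d => z.2 := LipschitzWith.prod_snd
    have h2 : LipschitzWith (L * 1) fun z : Phase d => F t z.1 :=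
      (hF.lipschitz t).comp LipschitzWith.prod_fst
    rw [mul_one] at h2
    exact h1.prodMk h2
  bounded z := ⟨max ‖z.2‖ B, fun t => by
    unfold newtonField
    rw [Prod.norm_mk]
    exact max_le_max le_rfl (hF.bound t z.1)⟩

/-- A kick followed by a drift differs from the Euler step by exactly `(τ²F, 0)`, which gives
consistency with constant `B`; the Lipschitz bound on `F` gives stability with constant `1 + 2L`. -/
theorem tendsto_kickDrift (hF : IsRegularForce F B L) (T : ℝ) (z : Phase d) :
    Tendsto (fun n : ℕ => oneStep (kickDrift F) (T / n) z n) atTop (𝓝 (hF.isLipschitzField.flow 0 T z)) := by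
  have hv := hF.isLipschitzField
  have hL : (0 : ℝ) ≤ L := L.2
  have h := tendsto_oneStep hv (fun t => hv.hasDerivAt_flow 0 t z) (P := kickDrift F) (A := 1 + 2 * L) (C := B)
    T (by positivity) ?_ ?_
  · simpa only [hv.flow_self] using h
  · intro s τ a b hτ
    have h1 : ‖F s a.1 - F s b.1‖ ≤ L * ‖a - b‖ := by
      refine ((hF.lipschitz s).norm_sub_le a.1 b.1).trans ?_
      gcongr
      exact norm_fst_le (a - b)
    have ha1 : ‖a.1 - b.1‖ ≤ ‖a - b‖ := norm_fst_le (a - b)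
    have ha2 : ‖a.2 - b.2‖ ≤ ‖a - b‖ := norm_snd_le (a - b)
    have h2 : ‖(a.2 + τ • F s a.1) - (b.2 + τ • F s b.1)‖ ≤ ‖a.2 - b.2‖ + |τ| * (L * ‖a - b‖) := by
      have : (a.2 + τ • F s a.1) - (b.2 + τ • F s b.1) = (a.2 - b.2) + τ • (F s a.1 - F s b.1) := by
        rw [smul_sub]; abel
      rw [this]
      refine (norm_add_le _ _).trans ?_
      rw [norm_smul, Real.norm_eq_abs]
      gcongr
    have hN : 0 ≤ ‖a - b‖ := norm_nonneg _
    have hτ0 : 0 ≤ |τ| := abs_nonneg τ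
    have h3 : ‖(a.1 + τ • (a.2 + τ • F s a.1)) - (b.1 + τ • (b.2 + τ • F s b.1))‖
        ≤ (1 + (1 + 2 * L) * |τ|) * ‖a - b‖ := by
      have : (a.1 + τ • (a.2 + τ • F s a.1)) - (b.1 + τ • (b.2 + τ • F s b.1))
          = (a.1 - b.1) + τ • ((a.2 + τ • F s a.1) - (b.2 + τ • F s b.1)) := by
        rw [smul_sub]; abel
      rw [this]
      refine (norm_add_le _ _).trans ?_
      rw [norm_smul, Real.norm_eq_abs]
      have h4 : |τ| * ‖(a.2 + τ • F s a.1) - (b.2 + τ • F s b.1)‖ ≤ |τ| * (‖a - b‖ + 1 * (L * ‖a - b‖)) := by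
        gcongr
        refine h2.trans ?_
        gcongr
      have h5 : 0 ≤ |τ| * (L * ‖a - b‖) := by positivity
      nlinarith
    unfold kickDrift
    rw [Prod.mk_sub_mk, Prod.norm_mk]
    refine max_le h3 (h2.trans ?_)
    have h5 : 0 ≤ |τ| * (L * ‖a - b‖) := by positivity
    nlinarith [mul_nonneg hτ0 hN]
  · intro s τ _ hτ
    set y := hv.flow 0 s z
    have : kickDrift F s τ y - y - τ • newtonField F s y = (τ ^ 2 • F s y.1, 0) := by
      unfold kickDrift newtonField
      ext1
      · simp only [Prod.fst_sub, Prod.smul_fst, smul_add, smul_smul, pow_two]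
        abel
      · simp
    rw [this, Prod.norm_mk, norm_zero, max_eq_left (norm_nonneg _), norm_smul, Real.norm_eq_abs,
      abs_of_nonneg (sq_nonneg τ), mul_comm]
    gcongr
    exact hF.bound s y.1

end IsRegularForce

/-- For `|g| ≤ 1` this is the Taylor bound of the exponential; for `|g| > 1` the trivial bound
`2|g|` is enough. -/
theorem norm_phase_sub_le (g : Pos d → ℝ) (y : Pos d) :
    ‖phase g y - 1 - Complex.I * (g y : ℂ)‖ ≤ 2 * |g y| ^ 2 := by
  have h1 := norm_phase_sub_one_le g y
  have h2 : ‖(Complex.I * (g y : ℂ))‖ = |g y| := by simp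
  rcases le_or_gt |g y| 1 with h | h
  · have h3 := Complex.norm_exp_sub_one_sub_id_le (x := (g y : ℂ) * Complex.I) (by simpa using h)
    unfold phase
    rw [mul_comm Complex.I]
    rw [mul_comm, h2] at h3
    rw [mul_comm]
    nlinarith [sq_nonneg |g y|]
  · refine (norm_sub_le _ _).trans ?_
    rw [h2]
    nlinarith

namespace IsRegularPotential

variable {w : ℝ → Pos d → ℝ} {B : ℝ≥0}

/-- A kick with the potential at time `s`, followed by a free evolution, of duration `τ`. -/
noncomputable def _root_.quantumKickDrift (ħ : ℝ) (w : ℝ → Pos d → ℝ) (s τ : ℝ) (u : L2 d) : L2 d :=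
  freeProp (ħ * τ) (mulOp (phase fun y => -(τ / ħ) * w s y) u)

/-- The Trotter product formula, proved in the interaction picture. There the conjugated kicks are
isometries, so that `A = 0`, and they differ from the Euler step of the bounded interaction field by
`O(τ²)`. -/
theorem tendsto_quantumKickDrift (hw : IsRegularPotential w B) (ħ : ℝ) (T : ℝ) (u : L2 d) :
    Tendsto (fun n : ℕ => oneStep (quantumKickDrift ħ w) (T / n) u n) atTop
      (𝓝 (hw.isBoundedHamiltonian.propagator ħ ħ⁻¹ T u)) := by
  have hM := hw.isBoundedHamiltonian
  have hv := hM.isLipschitzField ħ ħ⁻¹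
  have hmeas : ∀ s τ, Measurable fun y => -(τ / ħ) * w s y := fun s τ => (hw.measurable s).const_mul _
  let P : ℝ → ℝ → L2 d → L2 d := fun s τ y =>
    freeProp (-(ħ * s)) (mulOp (phase fun y => -(τ / ħ) * w s y) (freeProp (ħ * s) y))
  have h := tendsto_oneStep hv (fun t => hv.hasDerivAt_flow 0 t u) (P := P) (A := 0)
    (C := 2 * (B / |ħ|) ^ 2 * ‖u‖) T le_rfl ?_ ?_
  · rw [hv.flow_self] at h
    -- The free factors of successive steps telescope, so the scheme is the interaction scheme
    -- followed by one free evolution over the elapsed time.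
    have hstep : ∀ τ k, oneStep (quantumKickDrift ħ w) τ u k = freeProp (ħ * (k * τ)) (oneStep P τ u k) := by
      intro τ k
      induction k with
      | zero => simp [oneStep, freeProp_zero]
      | succ k ih =>
        simp only [oneStep, quantumKickDrift, P, ih]
        rw [← freeProp_add]
        congr 1
        push_cast
        ring
    have h2 : Tendsto (fun n : ℕ => freeProp (ħ * T) (oneStep P (T / n) u n)) atTop
        (𝓝 (hM.propagator ħ ħ⁻¹ T u)) := by
      rw [IsBoundedHamiltonian.propagator_apply]
      exact ((continuous_freeProp_comp continuous_const continuous_id).tendsto _).comp h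
    refine h2.congr' ?_
    filter_upwards [eventually_ge_atTop 1] with n hn
    have hn0 : (n : ℝ) ≠ 0 := by positivity
    rw [hstep, mul_div_cancel₀ _ hn0]
  · intro s τ a b _
    simp only [P]
    rw [← freeProp_sub_vec, norm_freeProp, ← map_sub, ← freeProp_sub_vec, ← phaseOp_apply (hmeas s τ),
      LinearIsometryEquiv.norm_map, norm_freeProp]
    simp
  · intro s τ _ _
    set y := hv.flow 0 s u with hy
    have hyn : ‖y‖ = ‖u‖ := by
      have := hM.norm_solution ħ ħ⁻¹ (fun t => hv.hasDerivAt_flow 0 t u) s 0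
      rwa [hv.flow_self] at this
    set x := freeProp (ħ * s) y with hx
    have hxn : ‖x‖ = ‖u‖ := by rw [hx, norm_freeProp, hyn]
    have hyx : y = freeProp (-(ħ * s)) x := by rw [hx, freeProp_neg_freeProp]
    have h1 : P s τ y - y - τ • interactionField ħ ħ⁻¹ (fun t => mulOp fun y => (w t y : ℂ)) s y
        = freeProp (-(ħ * s)) (mulOp (phase fun y => -(τ / ħ) * w s y) x - x
            - ((τ : ℂ) * (-(Complex.I * (ħ⁻¹ : ℝ)))) • mulOp (fun y => (w s y : ℂ)) x) := by
      rw [freeProp_sub_vec, freeProp_sub_vec, ← hyx, freeProp_smul_vec, mul_smul]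
      rfl
    rw [h1, norm_freeProp]
    have h2 : ‖mulOp (phase fun y => -(τ / ħ) * w s y) x - x
            - ((τ : ℂ) * (-(Complex.I * (ħ⁻¹ : ℝ)))) • mulOp (fun y => (w s y : ℂ)) x‖
        ≤ (2 * (B / |ħ|) ^ 2 * τ ^ 2) * ‖x‖ := by
      apply L2_norm_le_of_ae
      filter_upwards [mulOp_coeFn (memLp_phase (hmeas s τ)) x, mulOp_coeFn (hw.memLp s) x,
        Lp.coeFn_sub (mulOp (phase fun y => -(τ / ħ) * w s y) x - x)
          (((τ : ℂ) * (-(Complex.I * (ħ⁻¹ : ℝ)))) • mulOp (fun y => (w s y : ℂ)) x),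
        Lp.coeFn_sub (mulOp (phase fun y => -(τ / ħ) * w s y) x) x,
        Lp.coeFn_smul ((τ : ℂ) * (-(Complex.I * (ħ⁻¹ : ℝ)))) (mulOp (fun y => (w s y : ℂ)) x)]
        with y h1 h2 h3 h4 h5
      rw [h3, Pi.sub_apply, h4, Pi.sub_apply, h5, Pi.smul_apply, h1, h2, smul_eq_mul]
      have h6 : phase (fun y => -(τ / ħ) * w s y) y * x y - x y
            - ((τ : ℂ) * (-(Complex.I * (ħ⁻¹ : ℝ)))) * ((w s y : ℂ) * x y)
          = (phase (fun y => -(τ / ħ) * w s y) y - 1 - Complex.I * ((-(τ / ħ) * w s y : ℝ) : ℂ)) * x y := by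
        push_cast
        ring
      rw [h6, norm_mul]
      gcongr
      refine (norm_phase_sub_le _ y).trans ?_
      have h7 : |-(τ / ħ) * w s y| ≤ (|τ| / |ħ|) * B := by
        rw [abs_mul, abs_neg, abs_div]
        gcongr
        exact hw.bound s y
      calc 2 * |-(τ / ħ) * w s y| ^ 2 ≤ 2 * ((|τ| / |ħ|) * B) ^ 2 := by gcongr
        _ = 2 * (B / |ħ|) ^ 2 * τ ^ 2 := by rw [← sq_abs τ]; ring
    rw [hxn] at h2
    linarith

end IsRegularPotential

/-- Propagation of the quantum cost along the classical and the quantum evolution. -/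
theorem costForm_propagator_le {ħ : ℝ} (hħ : 0 < ħ) {F G : ℝ → Pos d → Pos d} {w : ℝ → Pos d → ℝ}
    {BF LF B : ℝ≥0} (hF : IsRegularForce F BF LF) (hw : IsRegularPotential w B)
    (hG : ∀ s, Measurable (G s)) {L L' Δ lam : ℝ} (hL' : 5 + 12 * L' ^ 2 ≤ lam) (hlam : 6 ≤ lam)
    (hwG : ∀ s y h, |w s (y + h) - w s y + inner ℝ (G s y) h| ≤ L * ‖h‖ ^ 2) {T : ℝ}
    (hFG : ∀ s ∈ Set.uIcc 0 T, ∀ x y, ‖F s x - G s y‖ ≤ L' * ‖x - y‖ + Δ * Real.exp (lam * |s|))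
    (z : Phase d) (u : L2 d) :
    costForm ħ (hF.isLipschitzField.flow 0 T z).1 (hF.isLipschitzField.flow 0 T z).2
        (hw.isBoundedHamiltonian.propagator ħ ħ⁻¹ T u)
      ≤ ENNReal.ofReal (Real.exp (2 * lam * |T|))
          * (costForm ħ z.1 z.2 u + ENNReal.ofReal (Δ ^ 2) * ‖u‖ₑ ^ 2) := by
  have hlim := hF.tendsto_kickDrift T z
  refine costForm_le_of_tendsto ((continuous_fst.tendsto _).comp hlim)
    ((continuous_snd.tendsto _).comp hlim) (hw.tendsto_quantumKickDrift ħ T u) ?_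
  have hlimτ : Tendsto (fun n : ℕ => |T / n|) atTop (𝓝 0) := by
    simpa using (tendsto_const_div_atTop_nhds_zero_nat T).abs
  filter_upwards [hlimτ.eventually (ge_mem_nhds one_pos), eventually_ge_atTop 1] with n hτ hn
  have hn0 : (0 : ℝ) < n := by exact_mod_cast hn
  set τ := T / n with hτdef
  have hnτ : n * τ = T := by rw [hτdef]; field_simp
  set X := costForm ħ z.1 z.2 u + ENNReal.ofReal (Δ ^ 2) * ‖u‖ₑ ^ 2 with hX
  have hnorm : ∀ k, ‖oneStep (quantumKickDrift ħ w) τ u k‖ₑ = ‖u‖ₑ := by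
    intro k
    induction k with
    | zero => rfl
    | succ k ih =>
      simp only [oneStep, quantumKickDrift]
      rw [enorm_eq_ofReal_norm, norm_freeProp, ← phaseOp_apply ((hw.measurable _).const_mul _),
        LinearIsometryEquiv.norm_map, ← enorm_eq_ofReal_norm, ih]
  -- In step `k` the squared perturbation is `Δ²e^{2λk|τ|}`, with the same exponential as the bound
  -- to be proved. Its coefficient `6|τ|` is at most `λ|τ|`, so a step costs the factor `1 + 2λ|τ| ≤
  -- e^{2λ|τ|}`.
  have hmain : ∀ k : ℕ, k ≤ n →
      costForm ħ (oneStep (kickDrift F) τ z k).1 (oneStep (kickDrift F) τ z k).2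
        (oneStep (quantumKickDrift ħ w) τ u k) ≤ ENNReal.ofReal (Real.exp (2 * lam * (k * |τ|))) * X := by
    intro k
    induction k with
    | zero =>
      intro _
      simp only [oneStep, Nat.cast_zero, zero_mul, mul_zero, Real.exp_zero, ENNReal.ofReal_one, one_mul]
      exact le_self_add
    | succ k ih =>
      intro hk
      have hk' : k ≤ n := by omega
      have hs : (k * τ : ℝ) ∈ Set.uIcc 0 T := by
        rw [← hnτ]
        have h1 : (k : ℝ) ≤ n := by exact_mod_cast hk'
        have h0 : (0 : ℝ) ≤ k := Nat.cast_nonneg k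
        rcases le_total 0 τ with h | h
        · rw [Set.uIcc_of_le (by positivity)]
          exact ⟨by positivity, by gcongr⟩
        · rw [Set.uIcc_of_ge (mul_nonpos_of_nonneg_of_nonpos hn0.le h)]
          exact ⟨by nlinarith, mul_nonpos_of_nonneg_of_nonpos h0 h⟩
      have hstep := costForm_step_le hħ hτ (oneStep (kickDrift F) τ z k).1 (oneStep (kickDrift F) τ z k).2
        (F (k * τ) (oneStep (kickDrift F) τ z k).1) (hw.measurable (k * τ)) (hG (k * τ)) (hwG (k * τ))
        (hFG (k * τ) hs (oneStep (kickDrift F) τ z k).1) (oneStep (quantumKickDrift ħ w) τ u k)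
      refine hstep.trans ?_
      rw [hnorm]
      have habs : |(k * τ : ℝ)| = k * |τ| := by rw [abs_mul, Nat.abs_cast]
      rw [habs]
      set e := Real.exp (2 * lam * (k * |τ|)) with he
      have he2 : Real.exp (lam * (k * |τ|)) ^ 2 = e := by
        rw [he, ← Real.exp_nat_mul]
        congr 1
        push_cast
        ring
      have he0 : 0 < e := Real.exp_pos _
      have hτ0 : 0 ≤ |τ| := abs_nonneg τ
      have hA : ENNReal.ofReal (1 + (5 + 12 * L' ^ 2) * |τ|) ≤ ENNReal.ofReal (1 + lam * |τ|) := by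
        gcongr
      have hB : ENNReal.ofReal (6 * |τ| * (Δ * Real.exp (lam * (k * |τ|))) ^ 2) * ‖u‖ₑ ^ 2
          ≤ ENNReal.ofReal (lam * |τ|) * (ENNReal.ofReal e * X) := by
        have h1 : 6 * |τ| * (Δ * Real.exp (lam * (k * |τ|))) ^ 2 = (6 * |τ|) * (e * Δ ^ 2) := by
          rw [mul_pow, he2]; ring
        rw [h1, ENNReal.ofReal_mul (by positivity), ENNReal.ofReal_mul he0.le, mul_assoc, mul_assoc]
        gcongr
        exact le_add_self
      have hE : Real.exp (2 * lam * ((k + 1 : ℕ) * |τ|)) = Real.exp (2 * lam * |τ|) * e := by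
        rw [he, ← Real.exp_add]
        congr 1
        push_cast
        ring
      calc _ ≤ ENNReal.ofReal (1 + lam * |τ|) * (ENNReal.ofReal e * X)
            + ENNReal.ofReal (lam * |τ|) * (ENNReal.ofReal e * X) := by
            gcongr
            exact ih hk'
        _ = ENNReal.ofReal (1 + 2 * lam * |τ|) * (ENNReal.ofReal e * X) := by
            rw [← add_mul, ← ENNReal.ofReal_add (by positivity) (by positivity)]
            congr 2
            ring
        _ ≤ ENNReal.ofReal (Real.exp (2 * lam * |τ|)) * (ENNReal.ofReal e * X) := by
            gcongr
            have := Real.add_one_le_exp (2 * lam * |τ|)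
            linarith
        _ = _ := by
            rw [hE, ENNReal.ofReal_mul (Real.exp_pos _).le]
            exact (mul_assoc _ _ _).symm
  have hfin := hmain n le_rfl
  have habs : n * |τ| = |T| := by rw [← hnτ, abs_mul, Nat.abs_cast]
  rw [habs] at hfin
  exact hfin

end Splitting


/-! ### Mean-field potentials and forces generated by `|φ|²` -/

section MeanField

variable {d : ℕ}

theorem integrable_norm_sq (φ : L2 d) : Integrable fun y => ‖φ y‖ ^ 2 :=
  (Lp.memLp φ).integrable_norm_pow (p := 2) (by norm_num)

theorem integral_norm_sq (φ : L2 d) : ∫ y, ‖φ y‖ ^ 2 = ‖φ‖ ^ 2 := by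
  have h := @L2.inner_def (Pos d) ℂ ℂ _ _ _ _ _ φ φ
  rw [inner_self_eq_norm_sq_to_K] at h
  have h2 : ∀ y, inner ℂ (φ y) (φ y) = ((‖φ y‖ ^ 2 : ℝ) : ℂ) := fun y => by
    rw [inner_self_eq_norm_sq_to_K]; norm_cast
  simp_rw [h2] at h
  rw [integral_complex_ofReal] at h
  exact (Complex.ofReal_injective (by push_cast at h ⊢; exact h)).symm

theorem integrable_norm_mul_norm (u v : L2 d) : Integrable fun y => ‖u y‖ * ‖v y‖ :=
  (Lp.memLp u).norm.integrable_mul (Lp.memLp v).norm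

theorem integral_norm_mul_norm_le (u v : L2 d) : ∫ y, ‖u y‖ * ‖v y‖ ≤ ‖u‖ * ‖v‖ := by
  have hu : MemLp (fun y => u y) (ENNReal.ofReal 2) volume := by
    simpa using Lp.memLp u
  have hv : MemLp (fun y => v y) (ENNReal.ofReal 2) volume := by
    simpa using Lp.memLp v
  have h := integral_mul_norm_le_Lp_mul_Lq (by constructor <;> norm_num : (2 : ℝ).HolderConjugate 2) hu hv
  have h2 : ∀ w : L2 d, (∫ y, ‖w y‖ ^ (2 : ℝ)) ^ (1 / (2 : ℝ)) = ‖w‖ := by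
    intro w
    simp_rw [Real.rpow_two]
    rw [integral_norm_sq, ← Real.sqrt_eq_rpow, Real.sqrt_sq (norm_nonneg _)]
  rwa [h2, h2] at h

/-- Pointwise `| |a|² - |b|² | ≤ (|a| + |b|)|a - b|`, followed by Cauchy–Schwarz. -/
theorem integral_abs_norm_sq_sub_le (φ ψ : L2 d) :
    ∫ y, |‖φ y‖ ^ 2 - ‖ψ y‖ ^ 2| ≤ (‖φ‖ + ‖ψ‖) * ‖φ - ψ‖ := by
  have h1 : ∫ y, |‖φ y‖ ^ 2 - ‖ψ y‖ ^ 2|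
      ≤ ∫ y, (‖φ y‖ * ‖(φ - ψ) y‖ + ‖ψ y‖ * ‖(φ - ψ) y‖) := by
    apply integral_mono_ae ((integrable_norm_sq φ).sub (integrable_norm_sq ψ)).abs
      ((integrable_norm_mul_norm _ _).add (integrable_norm_mul_norm _ _))
    filter_upwards [Lp.coeFn_sub φ ψ] with y hy
    simp only [Pi.add_apply]
    rw [hy]
    simp only [Pi.sub_apply]
    have h2 := abs_norm_sub_norm_le (φ y) (ψ y)
    have h3 : ‖φ y‖ ^ 2 - ‖ψ y‖ ^ 2 = (‖φ y‖ + ‖ψ y‖) * (‖φ y‖ - ‖ψ y‖) := by ring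
    rw [h3, abs_mul, abs_of_nonneg (by positivity)]
    nlinarith [mul_le_mul_of_nonneg_left h2 (norm_nonneg (φ y)), mul_le_mul_of_nonneg_left h2 (norm_nonneg (ψ y))]
  rw [integral_add (integrable_norm_mul_norm _ _) (integrable_norm_mul_norm _ _)] at h1
  have h2 := integral_norm_mul_norm_le φ (φ - ψ)
  have h3 := integral_norm_mul_norm_le ψ (φ - ψ)
  linarith

/-- The real-valued potential `V * |φ|²`. -/
noncomputable def bosonPotential (V : Pos d → ℝ) (φ : L2 d) (x : Pos d) : ℝ := ∫ y, V (x - y) * ‖φ y‖ ^ 2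

theorem potential_bosonDensity (V : Pos d → ℝ) (φ : L2 d) :
    potential V (bosonDensity φ) = fun x => (bosonPotential V φ x : ℂ) := by
  ext x
  unfold potential bosonDensity bosonPotential
  rw [← integral_complex_ofReal]
  push_cast
  rfl

section Kernel

variable {E : Type*} [NormedAddCommGroup E] [NormedSpace ℝ E] {g : Pos d → E} {B : ℝ}

theorem integrable_smul_kernel (hg : Continuous g) (hB : ∀ x, ‖g x‖ ≤ B) (φ : L2 d) (x : Pos d) :
    Integrable fun y => (‖φ y‖ ^ 2) • g (x - y) := by
  have hm : AEStronglyMeasurable (fun y => g (x - y)) volume :=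
    (hg.comp (continuous_const.sub continuous_id)).aestronglyMeasurable
  exact (integrable_norm_sq φ).smul_bdd B hm (Eventually.of_forall fun y => hB _)

theorem norm_integral_smul_kernel_le (φ : L2 d) {k : Pos d → E} (hB : ∀ y, ‖k y‖ ≤ B) :
    ‖∫ y, (‖φ y‖ ^ 2) • k y‖ ≤ B * ‖φ‖ ^ 2 := by
  rw [← integral_norm_sq, ← integral_const_mul]
  refine norm_integral_le_of_norm_le ((integrable_norm_sq φ).const_mul B) (Eventually.of_forall fun y => ?_)
  rw [norm_smul, Real.norm_eq_abs, abs_of_nonneg (by positivity), mul_comm]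
  gcongr
  exact hB y

theorem norm_integral_smul_kernel_sub_le (hg : Continuous g) (hB : ∀ x, ‖g x‖ ≤ B) (φ ψ : L2 d) (x : Pos d) :
    ‖(∫ y, (‖φ y‖ ^ 2) • g (x - y)) - ∫ y, (‖ψ y‖ ^ 2) • g (x - y)‖ ≤ B * ((‖φ‖ + ‖ψ‖) * ‖φ - ψ‖) := by
  have hB0 : 0 ≤ B := (norm_nonneg _).trans (hB 0)
  rw [← integral_sub (integrable_smul_kernel hg hB φ x) (integrable_smul_kernel hg hB ψ x)]
  refine le_trans ?_ (mul_le_mul_of_nonneg_left (integral_abs_norm_sq_sub_le φ ψ) hB0)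
  rw [← integral_const_mul]
  refine norm_integral_le_of_norm_le
    (((integrable_norm_sq φ).sub (integrable_norm_sq ψ)).abs.const_mul B) (Eventually.of_forall fun y => ?_)
  rw [← sub_smul, norm_smul, Real.norm_eq_abs, mul_comm]
  gcongr
  exact hB _

end Kernel

theorem bosonPotential_eq (V : Pos d → ℝ) (φ : L2 d) (x : Pos d) :
    bosonPotential V φ x = ∫ y, (‖φ y‖ ^ 2) • V (x - y) := by
  unfold bosonPotential
  congr 1
  ext y
  rw [smul_eq_mul, mul_comm]

/-- Quantitative form of `IsC11`. -/
structure IsC11With (V : Pos d → ℝ) (B B' L : ℝ≥0) : Prop where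
  contDiff : ContDiff ℝ 1 V
  bound : ∀ x, ‖V x‖ ≤ B
  gradient_bound : ∀ x, ‖gradient V x‖ ≤ B'
  gradient_lipschitz : LipschitzWith L (gradient V)

theorem _root_.IsC11.exists_with {V : Pos d → ℝ} (hV : IsC11 V) : ∃ B B' L : ℝ≥0, IsC11With V B B' L := by
  obtain ⟨B, hB⟩ := hV.bounded
  obtain ⟨B', hB'⟩ := hV.gradient_bounded
  obtain ⟨L, hL⟩ := hV.gradient_lipschitz
  exact ⟨B.toNNReal, B'.toNNReal, L, hV.contDiff, fun x => (hB x).trans (Real.le_coe_toNNReal B),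
    fun x => (hB' x).trans (Real.le_coe_toNNReal B'), hL⟩

namespace IsC11With

variable {V : Pos d → ℝ} {B B' L : ℝ≥0} (hV : IsC11With V B B' L)

include hV

/-- Mean value inequality on the segment from `x` to `x + h`, along which the gradient moves by at
most `L‖h‖`; no second derivative is used. -/
theorem taylor (x h : Pos d) : |V (x + h) - V x - inner ℝ (gradient V x) h| ≤ L * ‖h‖ ^ 2 := by
  have hd : ∀ z, HasFDerivAt V (InnerProductSpace.toDual ℝ (Pos d) (gradient V z)) z := fun z =>
    ((hV.contDiff.differentiable one_ne_zero) z).hasGradientAt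
  have h1 := (convex_segment x (x + h)).norm_image_sub_le_of_norm_hasFDerivWithin_le'
    (C := L * ‖h‖) (φ := InnerProductSpace.toDual ℝ (Pos d) (gradient V x))
    (fun z _ => (hd z).hasFDerivWithinAt) (fun z hz => ?_) (left_mem_segment ℝ _ _) (right_mem_segment ℝ _ _)
  · rw [add_sub_cancel_left, InnerProductSpace.toDual_apply_apply, Real.norm_eq_abs] at h1
    rw [pow_two, ← mul_assoc]
    exact h1
  · rw [← map_sub, LinearIsometryEquiv.norm_map]
    refine (hV.gradient_lipschitz.norm_sub_le z x).trans ?_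
    gcongr
    have := norm_sub_le_of_mem_segment hz
    simpa using this

theorem lipschitz : LipschitzWith B' V := by
  refine lipschitzWith_of_nnnorm_fderiv_le (𝕜 := ℝ) (hV.contDiff.differentiable one_ne_zero) fun x => ?_
  have h := hV.gradient_bound x
  have h2 : fderiv ℝ V x = InnerProductSpace.toDual ℝ (Pos d) (gradient V x) := by
    simp [gradient]
  rw [h2]
  rw [← NNReal.coe_le_coe, coe_nnnorm, LinearIsometryEquiv.norm_map]
  exact h

theorem norm_bosonPotential_le (φ : L2 d) (x : Pos d) : |bosonPotential V φ x| ≤ B * ‖φ‖ ^ 2 := by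
  rw [bosonPotential_eq]
  exact norm_integral_smul_kernel_le φ fun y => hV.bound _

theorem norm_bosonPotential_sub_le (φ ψ : L2 d) (x : Pos d) :
    |bosonPotential V φ x - bosonPotential V ψ x| ≤ B * ((‖φ‖ + ‖ψ‖) * ‖φ - ψ‖) := by
  rw [bosonPotential_eq, bosonPotential_eq]
  exact norm_integral_smul_kernel_sub_le hV.contDiff.continuous hV.bound φ ψ x

theorem norm_bosonForce_le (φ : L2 d) (x : Pos d) : ‖bosonForce V φ x‖ ≤ B' * ‖φ‖ ^ 2 := by
  unfold bosonForce
  rw [norm_neg]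
  exact norm_integral_smul_kernel_le φ fun y => hV.gradient_bound _

theorem norm_bosonForce_sub_le (φ ψ : L2 d) (x : Pos d) :
    ‖bosonForce V φ x - bosonForce V ψ x‖ ≤ B' * ((‖φ‖ + ‖ψ‖) * ‖φ - ψ‖) := by
  unfold bosonForce
  rw [neg_sub_neg, norm_sub_rev]
  exact norm_integral_smul_kernel_sub_le hV.gradient_lipschitz.continuous hV.gradient_bound φ ψ x

theorem norm_bosonForce_sub_point_le (φ : L2 d) (x y : Pos d) :
    ‖bosonForce V φ x - bosonForce V φ y‖ ≤ L * ‖φ‖ ^ 2 * ‖x - y‖ := by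
  have hint := integrable_smul_kernel hV.gradient_lipschitz.continuous hV.gradient_bound φ
  unfold bosonForce
  rw [neg_sub_neg, norm_sub_rev, ← integral_sub (hint x) (hint y)]
  simp_rw [← smul_sub]
  have := norm_integral_smul_kernel_le (B := L * ‖x - y‖) φ
    (k := fun z => gradient V (x - z) - gradient V (y - z)) fun z => by
      refine (hV.gradient_lipschitz.norm_sub_le _ _).trans ?_
      rw [sub_sub_sub_cancel_right]
  linarith

/-- Taylor's bound for `V` integrated against `|φ|²`. This is the form in which a kick uses that the
force is the negative gradient of the potential. -/
theorem bosonPotential_taylor (φ : L2 d) (x h : Pos d) :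
    |bosonPotential V φ (x + h) - bosonPotential V φ x + inner ℝ (bosonForce V φ x) h|
      ≤ L * ‖φ‖ ^ 2 * ‖h‖ ^ 2 := by
  have hint := integrable_smul_kernel hV.contDiff.continuous hV.bound φ
  have hint2 := integrable_smul_kernel hV.gradient_lipschitz.continuous hV.gradient_bound φ x
  have h1 : inner ℝ (bosonForce V φ x) h = -∫ y, (‖φ y‖ ^ 2) • inner ℝ (gradient V (x - y)) h := by
    unfold bosonForce
    rw [inner_neg_left, real_inner_comm, ← integral_inner hint2 h]
    congr 2
    ext y
    rw [inner_smul_right, real_inner_comm, smul_eq_mul]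
  have hint3 : Integrable fun y => (‖φ y‖ ^ 2) • inner ℝ (gradient V (x - y)) h := by
    refine (hint2.inner_const h).congr (Eventually.of_forall fun y => ?_)
    simp only
    rw [inner_smul_left]
    simp
  rw [h1, bosonPotential_eq, bosonPotential_eq, ← sub_eq_add_neg, ← integral_sub (hint _) (hint _)]
  rw [← integral_sub (f := fun y => (‖φ y‖ ^ 2) • V (x + h - y) - (‖φ y‖ ^ 2) • V (x - y))
    ((hint _).sub (hint _)) hint3]
  simp only [← smul_sub]
  have := norm_integral_smul_kernel_le (B := L * ‖h‖ ^ 2) φ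
    (k := fun y => V (x + h - y) - V (x - y) - inner ℝ (gradient V (x - y)) h) fun y => by
      have := hV.taylor (x - y) h
      rwa [show x - y + h = x + h - y by abel] at this
  rw [Real.norm_eq_abs] at this
  linarith

theorem continuous_bosonPotential (φ : L2 d) : Continuous (bosonPotential V φ) := by
  have hint := integrable_smul_kernel hV.contDiff.continuous hV.bound φ
  refine LipschitzWith.continuous (K := B' * (‖φ‖₊ ^ 2)) (LipschitzWith.of_dist_le_mul fun x y => ?_)
  rw [dist_eq_norm, dist_eq_norm, bosonPotential_eq, bosonPotential_eq, ← integral_sub (hint x) (hint y)]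
  simp_rw [← smul_sub]
  have := norm_integral_smul_kernel_le (B := B' * ‖x - y‖) φ (k := fun z => V (x - z) - V (y - z)) fun z => by
      refine (hV.lipschitz.norm_sub_le _ _).trans ?_
      rw [sub_sub_sub_cancel_right]
  push_cast
  linarith

variable {R : ℝ≥0} {φ : ℝ → L2 d}

theorem isRegularForce (hφ : Continuous φ) (hR : ∀ t, ‖φ t‖ ≤ R) :
    IsRegularForce (fun t => bosonForce V (φ t)) (B' * R ^ 2) (L * R ^ 2) where
  continuous x := by
    refine continuous_iff_continuousAt.2 fun s => ?_
    rw [ContinuousAt, tendsto_iff_norm_sub_tendsto_zero]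
    refine squeeze_zero (fun t => norm_nonneg _) (fun t => norm_bosonForce_sub_le hV (φ t) (φ s) x) ?_
    have h : Continuous fun t => (B' : ℝ) * ((‖φ t‖ + ‖φ s‖) * ‖φ t - φ s‖) := by fun_prop
    simpa using h.tendsto s
  bound t x := by
    refine (hV.norm_bosonForce_le _ x).trans ?_
    push_cast
    gcongr
    exact hR t
  lipschitz t := LipschitzWith.of_dist_le_mul fun x y => by
    rw [dist_eq_norm, dist_eq_norm]
    refine (hV.norm_bosonForce_sub_point_le _ x y).trans ?_
    push_cast
    gcongr
    exact hR t

theorem isRegularPotential (hφ : Continuous φ) (hR : ∀ t, ‖φ t‖ ≤ R) :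
    IsRegularPotential (fun t => bosonPotential V (φ t)) (B * R ^ 2) where
  measurable t := (hV.continuous_bosonPotential (φ t)).measurable
  bound t x := by
    refine (hV.norm_bosonPotential_le _ x).trans ?_
    push_cast
    gcongr
    exact hR t
  equicontinuous s ε hε := by
    have h : Continuous fun t => (B : ℝ) * ((‖φ t‖ + ‖φ s‖) * ‖φ t - φ s‖) := by fun_prop
    have h2 := h.tendsto s
    simp only [sub_self, norm_zero, mul_zero] at h2
    filter_upwards [h2.eventually (ge_mem_nhds hε)] with t ht y
    exact (hV.norm_bosonPotential_sub_le (φ t) (φ s) y).trans ht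

end IsC11With

end MeanField


/-! ### The classical flow preserves volume -/

section Liouville

variable {d : ℕ}

instance isAddHaarMeasure_phase : (volume : Measure (Phase d)).IsAddHaarMeasure :=
  inferInstanceAs ((volume : Measure (Pos d)).prod (volume : Measure (Pos d))).IsAddHaarMeasure

theorem measurePreserving_shear {g : Pos d → Pos d} (hg : Measurable g) :
    MeasurePreserving (fun z : Phase d => (z.1, z.2 + g z.1)) volume volume := by
  have h := (MeasurePreserving.id (volume : Measure (Pos d))).skew_product
    (g := fun x p => p + g x) (μc := volume) (μd := volume) (by fun_prop)
    (Eventually.of_forall fun x => (measurePreserving_add_right volume (g x)).map_eq)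
  exact h

/-- The kick is a shear in `p`, and the drift is a shear in `x`, which the swap of the two factors
turns into a shear in `p`. -/
theorem measurePreserving_kickDrift {F : ℝ → Pos d → Pos d} (s τ : ℝ) (hF : Measurable (F s)) :
    MeasurePreserving (kickDrift F s τ) volume volume := by
  have h1 := measurePreserving_shear (hF.const_smul τ)
  have h2 := measurePreserving_shear (d := d) (measurable_id.const_smul τ)
  have hs : MeasurePreserving (Prod.swap : Phase d → Phase d) volume volume := Measure.measurePreserving_swap
  exact (hs.comp (h2.comp hs)).comp h1

theorem measurePreserving_oneStep {F : ℝ → Pos d → Pos d} (hF : ∀ s, Measurable (F s)) (τ : ℝ) (k : ℕ) :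
    MeasurePreserving (fun z => oneStep (kickDrift F) τ z k) volume volume := by
  induction k with
  | zero => exact MeasurePreserving.id _
  | succ k ih => exact (measurePreserving_kickDrift (k * τ) τ (hF _)).comp ih

/-- If `Φ z` lies in an open set, then so does `S n z` for all large `n`. Continuity of the measure
along increasing unions gives the inequality on open sets, and outer regularity extends it. No
Jacobian is needed, which suits a flow that is merely Lipschitz. -/
theorem map_le_of_tendsto {X : Type*} [TopologicalSpace X] [MeasurableSpace X] [BorelSpace X]
    {μ : Measure X} [μ.OuterRegular] {S : ℕ → X → X} (hS : ∀ n, MeasurePreserving (S n) μ μ) {Φ : X → X}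
    (hΦ : Measurable Φ) (h : ∀ z, Tendsto (fun n => S n z) atTop (𝓝 (Φ z))) : μ.map Φ ≤ μ := by
  have hopen : ∀ U, IsOpen U → μ (Φ ⁻¹' U) ≤ μ U := by
    intro U hU
    have hsub : Φ ⁻¹' U ⊆ ⋃ N : ℕ, ⋂ n ≥ N, S n ⁻¹' U := by
      intro z hz
      have := (h z).eventually (hU.mem_nhds hz)
      obtain ⟨N, hN⟩ := eventually_atTop.1 this
      simp only [Set.mem_iUnion, Set.mem_iInter, Set.mem_preimage]
      exact ⟨N, hN⟩
    refine (measure_mono hsub).trans ?_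
    rw [Monotone.measure_iUnion]
    · refine iSup_le fun N => ?_
      refine (measure_mono (Set.biInter_subset_of_mem (Set.mem_ofPred.2 (le_refl N)))).trans ?_
      rw [(hS N).measure_preimage hU.measurableSet.nullMeasurableSet]
    · intro N N' hN
      exact Set.biInter_subset_biInter_left fun n (hn : N' ≤ n) => le_trans hN hn
  refine Measure.le_iff.2 fun A hA => ?_
  rw [Measure.map_apply hΦ hA, A.measure_eq_iInf_isOpen μ]
  refine le_iInf₂ fun U hAU => le_iInf fun hU => ?_
  exact (measure_mono (Set.preimage_mono hAU)).trans (hopen U hU)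

namespace IsRegularForce

variable {F : ℝ → Pos d → Pos d} {B L : ℝ≥0} (hF : IsRegularForce F B L)

include hF in
theorem shift (T : ℝ) : IsRegularForce (fun t => F (T + t)) B L where
  continuous x := (hF.continuous x).comp (continuous_const.add continuous_id)
  bound _ x := hF.bound _ x
  lipschitz _ := hF.lipschitz _

theorem flow_shift (T t : ℝ) (z : Phase d) :
    (hF.shift T).isLipschitzField.flow 0 t z = hF.isLipschitzField.flow T (T + t) z := by
  have h : ∀ t, HasDerivAt (fun t => hF.isLipschitzField.flow T (T + t) z)
      (newtonField (fun t => F (T + t)) t (hF.isLipschitzField.flow T (T + t) z)) t := by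
    intro t
    exact (hF.isLipschitzField.hasDerivAt_flow T (T + t) z).comp_const_add T t
  have h2 := (hF.shift T).isLipschitzField.eq_flow h 0 t
  rw [add_zero, IsLipschitzField.flow_self] at h2
  exact h2.symm

/-- Liouville's theorem. -/
theorem measurePreserving_flow (T : ℝ) :
    MeasurePreserving (hF.isLipschitzField.flow 0 T) volume volume := by
  have hle : ∀ {F : ℝ → Pos d → Pos d} (hF : IsRegularForce F B L) (T : ℝ),
      (volume : Measure (Phase d)).map (hF.isLipschitzField.flow 0 T) ≤ volume := fun hF T =>
    map_le_of_tendsto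
      (fun n => measurePreserving_oneStep (fun s => (hF.lipschitz s).continuous.measurable) (T / n) n)
      (hF.isLipschitzField.lipschitz_flow 0 T).continuous.measurable fun z => hF.tendsto_kickDrift T z
  have hm : ∀ s t, Measurable (hF.isLipschitzField.flow s t) := fun s t =>
    (hF.isLipschitzField.lipschitz_flow s t).continuous.measurable
  refine ⟨hm 0 T, le_antisymm (hle hF T) ?_⟩
  -- The limit argument yields only an inequality. The inverse flow is a flow of the time-shifted
  -- force, so it satisfies the same inequality; pushing that forward with the flow gives the
  -- converse.
  have h2 : (volume : Measure (Phase d)).map (hF.isLipschitzField.flow T 0) ≤ volume := by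
    have h3 := hle (hF.shift T) (-T)
    have h4 : (hF.shift T).isLipschitzField.flow 0 (-T) = hF.isLipschitzField.flow T 0 := by
      ext1 z
      rw [hF.flow_shift, add_neg_cancel]
    rwa [h4] at h3
  calc (volume : Measure (Phase d))
      = ((volume : Measure (Phase d)).map (hF.isLipschitzField.flow T 0)).map
          (hF.isLipschitzField.flow 0 T) := by
        rw [Measure.map_map (hm 0 T) (hm T 0)]
        have : hF.isLipschitzField.flow 0 T ∘ hF.isLipschitzField.flow T 0 = id := by
          ext1 z
          simp only [Function.comp, id]
          rw [IsLipschitzField.flow_flow, IsLipschitzField.flow_self]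
        rw [this, Measure.map_id]
    _ ≤ _ := Measure.map_mono h2 (hm 0 T)

end IsRegularForce

end Liouville

/-! ### Uniqueness for the transport equation -/

section Transport

variable {d : ℕ}

theorem abs_integral_mul_le (f : PhaseL1 d) {g : Phase d → ℝ} {C : ℝ} (hg : ∀ z, |g z| ≤ C) :
    |∫ z, f z * g z| ≤ C * ‖f‖ := by
  rw [L1.norm_eq_integral_norm, ← integral_const_mul, ← Real.norm_eq_abs]
  refine norm_integral_le_of_norm_le ((L1.integrable_coeFn f).norm.const_mul C) (Eventually.of_forall fun z => ?_)
  rw [norm_mul, mul_comm]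
  gcongr
  exact hg z

theorem integrable_mul_of_continuous (f : PhaseL1 d) {g : Phase d → ℝ} (hg : Continuous g) {C : ℝ}
    (hC : ∀ z, |g z| ≤ C) : Integrable fun z => f z * g z :=
  (L1.integrable_coeFn f).smul_bdd C hg.aestronglyMeasurable (Eventually.of_forall hC)

theorem taylor_of_lipschitz_fderiv {E : Type*} [NormedAddCommGroup E] [NormedSpace ℝ E] {g : E → ℝ}
    (hg : Differentiable ℝ g) {C : ℝ≥0} (hC : LipschitzWith C (fderiv ℝ g)) (x h : E) :
    |g (x + h) - g x - fderiv ℝ g x h| ≤ C * ‖h‖ ^ 2 := by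
  have h1 := (convex_segment x (x + h)).norm_image_sub_le_of_norm_hasFDerivWithin_le'
    (C := C * ‖h‖) (φ := fderiv ℝ g x)
    (fun z _ => (hg z).hasFDerivAt.hasFDerivWithinAt) (fun z hz => ?_) (left_mem_segment ℝ _ _) (right_mem_segment ℝ _ _)
  · rw [add_sub_cancel_left, Real.norm_eq_abs] at h1
    rw [pow_two, ← mul_assoc]
    exact h1
  · refine (hC.norm_sub_le z x).trans ?_
    gcongr
    have := norm_sub_le_of_mem_segment hz
    simpa using this

/-- Bounded weak solutions of `∂ₜf + div (b f) = 0`. -/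
structure IsWeakTransport (b : ℝ → Phase d → Phase d) (f : ℝ → PhaseL1 d) (M : ℝ) : Prop where
  bound : ∀ t, ‖f t‖ ≤ M
  weak : ∀ (h : Phase d → ℝ), HasCompactSupport h → ContDiff ℝ (⊤ : ℕ∞) h → ∀ t,
    HasDerivAt (fun s => ∫ z, f s z * h z) (∫ z, f t z * fderiv ℝ h z (b t z)) t

section Bump

variable {η : Phase d → ℝ} (hη : HasCompactSupport η) (hη' : ContDiff ℝ (⊤ : ℕ∞) η)

include hη hη'

theorem contDiff_fderiv_apply (v a : Phase d) :
    HasCompactSupport (fun z => fderiv ℝ η (z - a) v) ∧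
      ContDiff ℝ (⊤ : ℕ∞) (fun z => fderiv ℝ η (z - a) v) := by
  constructor
  · have h1 := hη.fderiv_apply (𝕜 := ℝ) v
    exact h1.comp_homeomorph (Homeomorph.subRight a)
  · have h2 : ContDiff ℝ (⊤ : ℕ∞) (fderiv ℝ η) := hη'.fderiv_right (by simp)
    exact (h2.comp (contDiff_id.sub contDiff_const)).clm_apply contDiff_const

/-- Testing with a moving bump function. -/
theorem IsWeakTransport.hasDerivAt_moving {b : ℝ → Phase d → Phase d} {f : ℝ → PhaseL1 d} {M : ℝ}
    (hf : IsWeakTransport b f M) {c : ℝ → Phase d} {c' : Phase d} {s : ℝ} (hc : HasDerivAt c c' s)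
    (hint : Integrable fun z => f s z * fderiv ℝ η (z - c s) (b s z)) :
    HasDerivAt (fun r => ∫ z, f r z * η (z - c r)) (∫ z, f s z * fderiv ℝ η (z - c s) (b s z - c')) s := by
  have hM0 : 0 ≤ M := (norm_nonneg _).trans (hf.bound 0)
  have hdiff : Differentiable ℝ η := hη'.differentiable (by simp)
  have hfd : ContDiff ℝ 1 (fderiv ℝ η) := hη'.fderiv_right (by norm_cast)
  obtain ⟨C, hC⟩ := hfd.lipschitzWith_of_hasCompactSupport (hη.fderiv (𝕜 := ℝ)) one_ne_zero
  obtain ⟨C₁, hC₁⟩ := hfd.continuous.bounded_above_of_compact_support (hη.fderiv (𝕜 := ℝ))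
  obtain ⟨C₀, hC₀⟩ := hη'.continuous.bounded_above_of_compact_support hη
  have hC₁0 : 0 ≤ C₁ := (norm_nonneg _).trans (hC₁ 0)
  have hint0 : ∀ r a, Integrable fun z => f r z * η (z - a) := fun r a =>
    integrable_mul_of_continuous (f r) (hη'.continuous.comp (continuous_id.sub continuous_const))
      fun z => hC₀ _
  have hint1 : ∀ r v, Integrable fun z => f r z * fderiv ℝ η (z - c s) v := fun r v =>
    integrable_mul_of_continuous (f r) (contDiff_fderiv_apply hη hη' v (c s)).2.continuous (C := C₁ * ‖v‖)
      fun z => ContinuousLinearMap.le_of_opNorm_le _ (hC₁ _) v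
  have h1 : HasDerivAt (fun r => ∫ z, f r z * η (z - c s)) (∫ z, f s z * fderiv ℝ η (z - c s) (b s z)) s := by
    have h2 := hf.weak (fun z => η (z - c s)) (hη.comp_homeomorph (Homeomorph.subRight (c s)))
      (hη'.comp (contDiff_id.sub contDiff_const)) s
    simp_rw [fderiv_comp_sub] at h2
    exact h2
  -- Weak continuity of `f` in time, which the weak equation itself supplies for this test function.
  have h2 : Tendsto (fun r => ∫ z, f r z * fderiv ℝ η (z - c s) c') (𝓝[≠] s)
      (𝓝 (∫ z, f s z * fderiv ℝ η (z - c s) c')) := by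
    have h3 := contDiff_fderiv_apply hη hη' c' (c s)
    exact (hf.weak _ h3.1 h3.2 s).continuousAt.tendsto.mono_left nhdsWithin_le_nhds
  have hslope := hasDerivAt_iff_tendsto_slope.1 hc
  -- The first-order expansion of the moved bump is uniform in `z`. Paired with `f r` it is
  -- controlled by the bound `M`, so no strong continuity of `f` in time is required.
  have h3 : Tendsto (fun r => ∫ z, f r z * ((r - s)⁻¹ * (η (z - c r) - η (z - c s))
      + fderiv ℝ η (z - c s) c')) (𝓝[≠] s) (𝓝 0) := by
    have h4 : Tendsto (fun r => (C * (‖slope c s r‖ * ‖c r - c s‖) + C₁ * ‖slope c s r - c'‖) * M) (𝓝[≠] s)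
        (𝓝 0) := by
      have h5 : Tendsto (fun r => ‖c r - c s‖) (𝓝[≠] s) (𝓝 0) := by
        have := (hc.continuousAt.tendsto.mono_left (nhdsWithin_le_nhds (s := {s}ᶜ))).sub_const (c s)
        rw [sub_self] at this
        simpa using this.norm
      have h6 : Tendsto (fun r => ‖slope c s r - c'‖) (𝓝[≠] s) (𝓝 0) := by
        simpa using (hslope.sub_const c').norm
      have := (((hslope.norm.mul h5).const_mul (C : ℝ)).add (h6.const_mul C₁)).mul_const M
      simpa using this
    refine squeeze_zero_norm' ?_ h4
    filter_upwards [self_mem_nhdsWithin] with r hr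
    have hr0 : r - s ≠ 0 := sub_ne_zero.2 hr
    rw [Real.norm_eq_abs]
    refine (abs_integral_mul_le (f r) (C := C * (‖slope c s r‖ * ‖c r - c s‖) + C₁ * ‖slope c s r - c'‖)
      fun z => ?_).trans ?_
    · have h5 := taylor_of_lipschitz_fderiv hdiff hC (z - c s) (-(c r - c s))
      rw [map_neg, norm_neg, show z - c s + -(c r - c s) = z - c r by abel] at h5
      have h6 : (r - s)⁻¹ * (η (z - c r) - η (z - c s)) + fderiv ℝ η (z - c s) c'
          = (r - s)⁻¹ * (η (z - c r) - η (z - c s) - -fderiv ℝ η (z - c s) (c r - c s))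
            - fderiv ℝ η (z - c s) (slope c s r - c') := by
        rw [map_sub (fderiv ℝ η (z - c s)) (slope c s r) c', slope_def_module, map_smul, smul_eq_mul]
        ring
      rw [h6]
      refine (abs_sub _ _).trans ?_
      gcongr
      · rw [abs_mul, abs_inv, slope_def_module, norm_smul, norm_inv, Real.norm_eq_abs]
        calc |r - s|⁻¹ * _ ≤ |r - s|⁻¹ * (C * ‖c r - c s‖ ^ 2) := by gcongr
          _ = _ := by ring
      · exact ContinuousLinearMap.le_of_opNorm_le _ (hC₁ _) _
    · gcongr
      exact hf.bound r
  rw [hasDerivAt_iff_tendsto_slope] at h1 ⊢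
  have h4 := (h1.add h3).sub h2
  have h5 : (∫ z, f s z * fderiv ℝ η (z - c s) (b s z)) + 0 - ∫ z, f s z * fderiv ℝ η (z - c s) c'
      = ∫ z, f s z * fderiv ℝ η (z - c s) (b s z - c') := by
    rw [add_zero, ← integral_sub hint (hint1 s c')]
    simp_rw [map_sub, mul_sub]
  rw [h5] at h4
  refine h4.congr fun r => ?_
  have h6 : ∫ z, f r z * ((r - s)⁻¹ * (η (z - c r) - η (z - c s)) + fderiv ℝ η (z - c s) c')
      = (r - s)⁻¹ * ((∫ z, f r z * η (z - c r)) - ∫ z, f r z * η (z - c s))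
        + ∫ z, f r z * fderiv ℝ η (z - c s) c' := by
    have e := integral_add (((hint0 r (c r)).sub (hint0 r (c s))).const_mul (r - s)⁻¹) (hint1 r c')
    simp only [Pi.sub_apply] at e
    rw [← integral_sub (hint0 r _) (hint0 r _), ← integral_const_mul, ← e]
    congr 1
    ext z
    ring
  rw [h6, slope_def_field, slope_def_field, div_eq_inv_mul, div_eq_inv_mul]
  ring

end Bump

end Transport


/-! ### Mollification along trajectories: weak solutions are carried by the flow. -/

section TransportUniqueness

variable {d : ℕ}

theorem integral_phase_sub_left (g : Phase d → ℝ) (z : Phase d) : ∫ w, g (z - w) = ∫ w, g w := by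
  have h := (Measure.measurePreserving_neg (volume : Measure (Pos d))).prod
    (Measure.measurePreserving_neg (volume : Measure (Pos d)))
  have : (volume : Measure (Phase d)).IsNegInvariant := ⟨h.map_eq⟩
  exact integral_sub_left_eq_self g volume z

theorem integral_fderiv_eq_zero {E : Type*} [NormedAddCommGroup E] [NormedSpace ℝ E] [FiniteDimensional ℝ E]
    [MeasurableSpace E] [BorelSpace E] {μ : Measure E} [μ.IsAddHaarMeasure] {g : E → ℝ} (hg : ContDiff ℝ 1 g)
    (hc : HasCompactSupport g) (v : E) : ∫ x, fderiv ℝ g x v ∂μ = 0 := by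
  have hg' : Continuous fun x => fderiv ℝ g x v := (hg.continuous_fderiv one_ne_zero).clm_apply continuous_const
  have h := integral_mul_fderiv_eq_neg_fderiv_mul_of_integrable (𝕜 := ℝ) (μ := μ) (f := fun _ : E => (1 : ℝ)) (g := g)
    (v := v) ?_ ?_ ?_ (fun x _ => differentiableAt_const _) (fun x _ => (hg.differentiable one_ne_zero) x)
  · simpa using h
  · simp
  · simpa using hg'.integrable_of_hasCompactSupport (hc.fderiv_apply (𝕜 := ℝ) v)
  · simpa using hg.continuous.integrable_of_hasCompactSupport hc

/-- Averages of Lipschitz functions against kernels of small support. -/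
theorem abs_integral_mul_sub_le {H G : Phase d → ℝ} {Λ : ℝ≥0} (hH : LipschitzWith Λ H) (hG : Continuous G)
    {z : Phase d} {ε C : ℝ} (hε : 0 ≤ ε) (hC : ∀ w, |G w| ≤ C) (hsupp : ∀ w, ε < ‖z - w‖ → G w = 0) :
    |(∫ w, H w * G w) - H z * ∫ w, G w| ≤ Λ * ε * C * volume.real (Metric.closedBall (0 : Phase d) ε) := by
  have hcs : HasCompactSupport G := HasCompactSupport.intro (isCompact_closedBall z ε) fun w hw => by
    refine hsupp w ?_
    rw [Metric.mem_closedBall, not_le, dist_eq_norm, norm_sub_rev] at hw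
    exact hw
  have hC0 : 0 ≤ C := (abs_nonneg _).trans (hC 0)
  have h1 : Integrable fun w => H w * G w :=
    (hH.continuous.mul hG).integrable_of_hasCompactSupport hcs.mul_left
  have h2 : Integrable G := hG.integrable_of_hasCompactSupport hcs
  rw [← integral_const_mul, ← integral_sub h1 (h2.const_mul _)]
  have h3 : ∀ w, ‖H w * G w - H z * G w‖ ≤ (Metric.closedBall z ε).indicator (fun _ => Λ * ε * C) w := by
    intro w
    by_cases hw : w ∈ Metric.closedBall z ε
    · rw [Set.indicator_of_mem hw, ← sub_mul, norm_mul]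
      rw [Metric.mem_closedBall, dist_eq_norm] at hw
      have := hH.norm_sub_le w z
      have := hC w
      rw [Real.norm_eq_abs (G w)]
      gcongr
      exact (hH.norm_sub_le w z).trans (by gcongr)
    · rw [Set.indicator_of_notMem hw]
      rw [Metric.mem_closedBall, not_le, dist_eq_norm, norm_sub_rev] at hw
      simp [hsupp w hw]
  have hfin : volume (Metric.closedBall z ε) ≠ ∞ := measure_closedBall_lt_top.ne
  have h5 : Integrable ((Metric.closedBall z ε).indicator fun _ => (Λ * ε * C : ℝ)) volume :=
    (integrable_indicator_iff measurableSet_closedBall).2 (integrableOn_const hfin)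
  have h6 := norm_integral_le_of_norm_le h5 (Eventually.of_forall h3)
  rw [integral_indicator_const _ measurableSet_closedBall, smul_eq_mul] at h6
  have h7 : volume.real (Metric.closedBall z ε) = volume.real (Metric.closedBall (0 : Phase d) ε) := by
    unfold Measure.real
    rw [Measure.addHaar_closedBall_center]
  rw [h7, mul_comm, Real.norm_eq_abs] at h6
  exact h6

/-- Fubini and the volume-preserving substitution `w = Φ y`. An average of `k` over trajectories
becomes a pairing of `f` with a mollification of `k ∘ Φ⁻¹`. -/
theorem fubini_transport (f : PhaseL1 d) {k : Phase d → ℝ} (hk : Continuous k) (hkc : HasCompactSupport k)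
    {Φ Φ' : Phase d → Phase d} (hΦ : MeasurePreserving Φ volume volume) (hΦc : Continuous Φ)
    (hΦ'c : Continuous Φ') (hl : ∀ z, Φ' (Φ z) = z) (hr : ∀ z, Φ (Φ' z) = z)
    {Ψ : Phase d → Phase d → ℝ} (hΨ : Continuous (Function.uncurry Ψ)) {C : ℝ} (hC : ∀ z w, |Ψ z w| ≤ C) :
    ∫ y, k y * ∫ z, f z * Ψ z (Φ y) = ∫ z, f z * ∫ w, k (Φ' w) * Ψ z w := by
  let e : Phase d ≃ₜ Phase d := ⟨⟨Φ, Φ', hl, hr⟩, hΦc, hΦ'c⟩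
  have h1 : ∀ z, ∫ w, k (Φ' w) * Ψ z w = ∫ y, k y * Ψ z (Φ y) := by
    intro z
    rw [← hΦ.integral_comp e.measurableEmbedding]
    simp_rw [hl]
  simp_rw [h1, ← integral_const_mul]
  rw [integral_integral_swap]
  · congr 1
    ext z
    congr 1
    ext y
    ring
  · have h2 : Integrable (fun p : Phase d × Phase d => k p.1 * f p.2) (volume.prod volume) :=
      (hk.integrable_of_hasCompactSupport hkc).mul_prod (L1.integrable_coeFn f)
    have h3 : Continuous fun p : Phase d × Phase d => Ψ p.2 (Φ p.1) :=
      hΨ.comp (continuous_snd.prodMk (hΦc.comp continuous_fst))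
    have h4 := h2.smul_bdd C h3.aestronglyMeasurable (Eventually.of_forall fun p => hC p.2 (Φ p.1))
    refine h4.congr (Eventually.of_forall fun p => ?_)
    simp only [Function.uncurry, Pi.smul_apply', smul_eq_mul]
    ring

theorem stronglyMeasurable_transport (f : PhaseL1 d) {Φ : Phase d → Phase d} (hΦc : Continuous Φ)
    {Ψ : Phase d → Phase d → ℝ} (hΨ : Continuous (Function.uncurry Ψ)) :
    StronglyMeasurable fun y => ∫ z, f z * Ψ z (Φ y) := by
  have h : StronglyMeasurable (Function.uncurry fun (y z : Phase d) => f z * Ψ z (Φ y)) := by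
    refine StronglyMeasurable.mul ?_ ?_
    · exact (Lp.stronglyMeasurable f).comp_measurable measurable_snd
    · have h3 : Continuous fun p : Phase d × Phase d => Ψ p.2 (Φ p.1) :=
        hΨ.comp (continuous_snd.prodMk (hΦc.comp continuous_fst))
      exact h3.stronglyMeasurable
  exact h.integral_prod_right

variable {F : ℝ → Pos d → Pos d} {B L : ℝ≥0}

/-- The Newton field is divergence free in a strong sense: its `x`-component depends on `p` alone
and its `p`-component on `x` alone. Each component is therefore constant on the slices where the
bump is differentiated, the slice integrals vanish, and `F` is never differentiated. -/
theorem integral_fderiv_newtonField_eq_zero {η : Phase d → ℝ} (hη' : ContDiff ℝ (⊤ : ℕ∞) η) {ε : ℝ}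
    (hsupp : ∀ z, ε < ‖z‖ → η z = 0) (hF : IsRegularForce F B L) (s : ℝ) (z : Phase d) :
    ∫ w, fderiv ℝ η (z - w) (newtonField F s z - newtonField F s w) = 0 := by
  have hFc : Continuous (F s) := (hF.lipschitz s).continuous
  have hη1 : ContDiff ℝ 1 η := hη'.of_le (by norm_cast)
  have hdc : Continuous (fderiv ℝ η) := hη1.continuous_fderiv one_ne_zero
  have hcs : HasCompactSupport η := HasCompactSupport.intro (isCompact_closedBall 0 ε) fun w hw => by
    refine hsupp w ?_
    rwa [Metric.mem_closedBall, not_le, dist_zero_right] at hw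
  have hD : HasCompactSupport fun w => fderiv ℝ η (z - w) :=
    (hcs.fderiv (𝕜 := ℝ)).comp_homeomorph (Homeomorph.subLeft z)
  have hint : ∀ v : Phase d → Phase d, Continuous v → Integrable fun w => fderiv ℝ η (z - w) (v w) := by
    intro v hv
    refine Continuous.integrable_of_hasCompactSupport ?_ ?_
    · exact (hdc.comp (continuous_const.sub continuous_id)).clm_apply hv
    · refine hD.mono' ?_
      refine subset_trans ?_ subset_closure
      intro w hw
      simp only [Function.mem_support] at hw ⊢
      intro h0
      rw [h0] at hw
      simp at hw
  have hsplit : ∀ w : Phase d, fderiv ℝ η (z - w) (newtonField F s z - newtonField F s w)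
      = fderiv ℝ η (z - w) (z.2 - w.2, 0) + fderiv ℝ η (z - w) (0, F s z.1 - F s w.1) := by
    intro w
    rw [← map_add]
    congr 1
    simp [newtonField]
  simp_rw [hsplit]
  have hi1 := hint (fun w => (z.2 - w.2, 0)) (by fun_prop)
  have hi2 := hint (fun w => (0, F s z.1 - F s w.1)) (by fun_prop)
  rw [integral_add hi1 hi2]
  have hc1 : ∀ p x v, fderiv ℝ η (z - (x, p)) (v, 0) = -fderiv ℝ (fun x => η (z - (x, p))) x v := by
    intro p x v
    have h1 : HasFDerivAt (fun x : Pos d => z - (x, p)) (-(ContinuousLinearMap.inl ℝ (Pos d) (Pos d))) x := by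
      exact ((hasFDerivAt_id (𝕜 := ℝ) x).prodMk (hasFDerivAt_const p x)).const_sub z
    have h2 := ((hη1.differentiable one_ne_zero) (z - (x, p))).hasFDerivAt.comp x h1
    have h3 : fderiv ℝ (fun x => η (z - (x, p))) x = _ := h2.fderiv
    rw [h3]
    simp
  have hc2 : ∀ x p v, fderiv ℝ η (z - (x, p)) (0, v) = -fderiv ℝ (fun p => η (z - (x, p))) p v := by
    intro x p v
    have h1 : HasFDerivAt (fun p : Pos d => z - (x, p)) (-(ContinuousLinearMap.inr ℝ (Pos d) (Pos d))) p := by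
      exact ((hasFDerivAt_const x p).prodMk (hasFDerivAt_id (𝕜 := ℝ) p)).const_sub z
    have h2 := ((hη1.differentiable one_ne_zero) (z - (x, p))).hasFDerivAt.comp p h1
    have h3 : fderiv ℝ (fun p => η (z - (x, p))) p = _ := h2.fderiv
    rw [h3]
    simp
  have hz1 : ∀ p v, ∫ x : Pos d, fderiv ℝ η (z - (x, p)) (v, 0) = 0 := by
    intro p v
    simp_rw [hc1]
    rw [integral_neg, integral_fderiv_eq_zero, neg_zero]
    · exact hη1.comp (contDiff_const.sub (contDiff_id.prodMk contDiff_const))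
    · refine HasCompactSupport.intro (isCompact_closedBall z.1 ε) fun x hx => hsupp _ ?_
      rw [Metric.mem_closedBall, not_le, dist_eq_norm, norm_sub_rev] at hx
      exact hx.trans_le (norm_fst_le (z - (x, p)))
  have hz2 : ∀ x v, ∫ p : Pos d, fderiv ℝ η (z - (x, p)) (0, v) = 0 := by
    intro x v
    simp_rw [hc2]
    rw [integral_neg, integral_fderiv_eq_zero, neg_zero]
    · exact hη1.comp (contDiff_const.sub (contDiff_const.prodMk contDiff_id))
    · refine HasCompactSupport.intro (isCompact_closedBall z.2 ε) fun p hp => hsupp _ ?_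
      rw [Metric.mem_closedBall, not_le, dist_eq_norm, norm_sub_rev] at hp
      exact hp.trans_le (norm_snd_le (z - (x, p)))
  have e1 : ∫ w : Phase d, fderiv ℝ η (z - w) (z.2 - w.2, 0) = 0 := by
    rw [Measure.volume_eq_prod] at hi1 ⊢
    rw [integral_prod_symm _ hi1]
    simp only [hz1, integral_zero]
  have e2 : ∫ w : Phase d, fderiv ℝ η (z - w) (0, F s z.1 - F s w.1) = 0 := by
    rw [Measure.volume_eq_prod] at hi2 ⊢
    rw [integral_prod _ hi2]
    simp only [hz2, integral_zero]
  rw [e1, e2, add_zero]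

/-- Weak solutions transported by the flow, up to an error that is small with the support of the
kernel `η`. -/
theorem IsWeakTransport.kernel_estimate (hF : IsRegularForce F B L) {f : ℝ → PhaseL1 d} {M : ℝ}
    (hf : IsWeakTransport (newtonField F) f M) {k : Phase d → ℝ} (hkc : HasCompactSupport k) {Λ₀ : ℝ≥0}
    (hk : LipschitzWith Λ₀ k) {η : Phase d → ℝ} (hη' : ContDiff ℝ (⊤ : ℕ∞) η) {ε C₀ C₁ : ℝ} (hε : 0 < ε)
    (hsupp : ∀ z, ε < ‖z‖ → η z = 0) (hC₀ : ∀ z, |η z| ≤ C₀) (hC₁ : ∀ z, ‖fderiv ℝ η z‖ ≤ C₁ / ε) (T : ℝ) :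
    |((∫ z, f T z * k (hF.isLipschitzField.flow T 0 z)) - ∫ z, f 0 z * k z) * ∫ w, η w|
      ≤ (2 * C₀ + C₁ * max 1 L * |T|) * (Λ₀ * Real.exp (max 1 L * |T|)) * ε
        * volume.real (Metric.closedBall (0 : Phase d) ε) * M := by
  have hv := hF.isLipschitzField
  set v := volume.real (Metric.closedBall (0 : Phase d) ε) with hvdef
  set K : ℝ := ((max 1 L : ℝ≥0) : ℝ) with hK
  have hK0 : 0 ≤ K := NNReal.coe_nonneg _
  have hv0 : 0 ≤ v := measureReal_nonneg
  set Λ : ℝ≥0 := Λ₀ * Real.toNNReal (Real.exp (K * |T|)) with hΛ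
  have hΛr : (Λ : ℝ) = Λ₀ * Real.exp (K * |T|) := by
    rw [hΛ]; push_cast; rw [Real.coe_toNNReal _ (Real.exp_pos _).le]
  have hM0 : 0 ≤ M := (norm_nonneg _).trans (hf.bound 0)
  have hC₀0 : 0 ≤ C₀ := (abs_nonneg _).trans (hC₀ 0)
  have hC₁0 : 0 ≤ C₁ := by
    have h := (norm_nonneg _).trans (hC₁ 0)
    by_contra hneg
    exact absurd h (not_le.2 (div_neg_of_neg_of_pos (not_le.1 hneg) hε))
  have hη : HasCompactSupport η := HasCompactSupport.intro (isCompact_closedBall 0 ε) fun w hw => by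
    refine hsupp w ?_
    rwa [Metric.mem_closedBall, not_le, dist_zero_right] at hw
  have hη1 : ContDiff ℝ 1 η := hη'.of_le (by norm_cast)
  have hdc : Continuous (fderiv ℝ η) := hη1.continuous_fderiv one_ne_zero
  have hsupp' : ∀ z, ε < ‖z‖ → fderiv ℝ η z = 0 := by
    intro z hz
    have h1 : η =ᶠ[𝓝 z] fun _ => 0 := by
      filter_upwards [(isOpen_lt continuous_const continuous_norm).mem_nhds hz] with w hw
      exact hsupp w hw
    rw [h1.fderiv_eq]
    simp
  have hbc : ∀ s, Continuous (newtonField F s) := fun s => (hv.lipschitz s).continuous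
  have hΨ0 : Continuous (Function.uncurry fun z w : Phase d => η (z - w)) :=
    hη'.continuous.comp (continuous_fst.sub continuous_snd)
  let Ψ : ℝ → Phase d → Phase d → ℝ := fun s z w => fderiv ℝ η (z - w) (newtonField F s z - newtonField F s w)
  have hΨc : ∀ s, Continuous (Function.uncurry (Ψ s)) := fun s =>
    (hdc.comp (continuous_fst.sub continuous_snd)).clm_apply
      (((hbc s).comp continuous_fst).sub ((hbc s).comp continuous_snd))
  have hΨsupp : ∀ s z w, ε < ‖z - w‖ → Ψ s z w = 0 := by
    intro s z w h
    simp only [Ψ]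
    rw [hsupp' _ h]
    simp
  have hΨb : ∀ s z w, |Ψ s z w| ≤ C₁ * K := by
    intro s z w
    rcases lt_or_ge ε ‖z - w‖ with h | h
    · rw [hΨsupp s z w h, abs_zero]
      positivity
    · refine (ContinuousLinearMap.le_of_opNorm_le _ (hC₁ _) _).trans ?_
      have := (hv.lipschitz s).norm_sub_le z w
      calc C₁ / ε * ‖newtonField F s z - newtonField F s w‖ ≤ C₁ / ε * (K * ε) := by
            gcongr
            exact this.trans (by gcongr)
        _ = C₁ * K := by field_simp
  have hΦc : ∀ s t, Continuous (hv.flow s t) := fun s t => (hv.lipschitz_flow s t).continuous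
  have hl : ∀ s z, hv.flow s 0 (hv.flow 0 s z) = z := fun s z => by rw [hv.flow_flow, hv.flow_self]
  have hr : ∀ s z, hv.flow 0 s (hv.flow s 0 z) = z := fun s z => by rw [hv.flow_flow, hv.flow_self]
  have hLip : ∀ s ∈ Set.uIcc 0 T, LipschitzWith Λ fun w => k (hv.flow s 0 w) := by
    intro s hs
    have h1 := hk.comp (hv.lipschitz_flow s 0)
    refine h1.weaken ?_
    have : |s| ≤ |T| := by
      have := Set.abs_sub_left_of_mem_uIcc hs
      simpa using this
    rw [hΛ, zero_sub, abs_neg]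
    refine mul_le_mul le_rfl (Real.toNNReal_le_toNNReal (Real.exp_le_exp.2 ?_)) zero_le zero_le
    exact mul_le_mul_of_nonneg_left this hK0
  -- `I s` approximates `∫ η` times the integral of `f s` against `k ∘ Φ_s⁻¹`. It has a derivative
  -- by the moving-bump formula, whereas `k ∘ Φ_s⁻¹` itself is not a smooth test function.
  let I : ℝ → ℝ := fun s => ∫ y, k y * ∫ z, f s z * η (z - hv.flow 0 s y)
  have hI : ∀ s, I s = ∫ z, f s z * ∫ w, k (hv.flow s 0 w) * η (z - w) := fun s =>
    fubini_transport (f s) hk.continuous hkc (hF.measurePreserving_flow s) (hΦc 0 s) (hΦc s 0) (hl s) (hr s)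
      hΨ0 fun z w => hC₀ _
  -- the derivative of `I`
  have hkint : Integrable k := hk.continuous.integrable_of_hasCompactSupport hkc
  have hmov : ∀ s y, HasDerivAt (fun s => ∫ z, f s z * η (z - hv.flow 0 s y))
      (∫ z, f s z * Ψ s z (hv.flow 0 s y)) s := by
    intro s y
    refine hf.hasDerivAt_moving hη hη' (hv.hasDerivAt_flow 0 s y) ?_
    have hcont : Continuous fun z => fderiv ℝ η (z - hv.flow 0 s y) (newtonField F s z) :=
      (hdc.comp (continuous_id.sub continuous_const)).clm_apply (hbc s)
    have hcs : HasCompactSupport fun z => fderiv ℝ η (z - hv.flow 0 s y) (newtonField F s z) := by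
      refine HasCompactSupport.intro (isCompact_closedBall (hv.flow 0 s y) ε) fun w hw => ?_
      rw [Metric.mem_closedBall, not_le, dist_eq_norm] at hw
      rw [hsupp' _ hw]
      simp
    obtain ⟨C, hC⟩ := hcont.bounded_above_of_compact_support hcs
    exact integrable_mul_of_continuous _ hcont hC
  have hID : ∀ s, HasDerivAt I (∫ y, k y * ∫ z, f s z * Ψ s z (hv.flow 0 s y)) s := by
    intro s
    refine (hasDerivAt_integral_of_dominated_loc_of_deriv_le (s := Set.univ)
      (F' := fun s y => k y * ∫ z, f s z * Ψ s z (hv.flow 0 s y))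
      (bound := fun y => |k y| * (C₁ * K * M)) univ_mem (Eventually.of_forall fun r => ?_) ?_ ?_
      (Eventually.of_forall fun y r _ => ?_) ?_ (Eventually.of_forall fun y r _ => ?_)).2
    · exact (hk.continuous.stronglyMeasurable.mul
        (stronglyMeasurable_transport (f r) (hΦc 0 r) hΨ0)).aestronglyMeasurable
    · refine (hkint.smul_bdd (C₀ * M) (stronglyMeasurable_transport (f s) (hΦc 0 s) hΨ0).aestronglyMeasurable
        (Eventually.of_forall fun y => ?_))
      refine (abs_integral_mul_le (f s) fun z => hC₀ _).trans ?_
      gcongr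
      exact hf.bound s
    · exact (hk.continuous.stronglyMeasurable.mul
        (stronglyMeasurable_transport (f s) (hΦc 0 s) (hΨc s))).aestronglyMeasurable
    · rw [norm_mul, Real.norm_eq_abs, Real.norm_eq_abs]
      gcongr
      refine (abs_integral_mul_le (f r) fun z => hΨb r z _).trans ?_
      gcongr
      exact hf.bound r
    · exact hkint.abs.mul_const _
    · exact (hmov r y).const_mul (k y)
  -- The factor `1/ε` of `∇η` is cancelled by the Lipschitz bound of the field on the support, and
  -- the kernel has mean zero. The oscillation of `k ∘ Φ_s⁻¹` on a ball of radius `ε` then gains the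
  -- factor `Λε`.
  have hIb : ∀ s ∈ Set.uIcc 0 T, ‖∫ y, k y * ∫ z, f s z * Ψ s z (hv.flow 0 s y)‖
      ≤ Λ * ε * (C₁ * K) * v * M := by
    intro s hs
    rw [fubini_transport (f s) hk.continuous hkc (hF.measurePreserving_flow s) (hΦc 0 s) (hΦc s 0) (hl s) (hr s)
      (hΨc s) (hΨb s)]
    refine (abs_integral_mul_le (f s) (C := Λ * ε * (C₁ * K) * v) fun z => ?_).trans ?_
    · have h1 := abs_integral_mul_sub_le (hLip s hs) (G := Ψ s z) ((hΨc s).comp (Continuous.prodMk_right z)) hε.le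
        (hΨb s z) (hΨsupp s z)
      have h2 : ∫ w, Ψ s z w = 0 := integral_fderiv_newtonField_eq_zero hη' hsupp hF s z
      rw [h2, mul_zero, sub_zero] at h1
      exact h1
    · gcongr
      exact hf.bound s
  have hdiffI : |I T - I 0| ≤ Λ * ε * (C₁ * K) * v * M * |T| := by
    have := Convex.norm_image_sub_le_of_norm_hasDerivWithin_le
      (fun s _ => (hID s).hasDerivWithinAt) hIb (convex_uIcc 0 T) Set.left_mem_uIcc Set.right_mem_uIcc
    simpa [Real.norm_eq_abs] using this
  -- The mollification error, again the oscillation of `k ∘ Φ_s⁻¹` over the support of the kernel.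
  have hclose : ∀ s ∈ Set.uIcc 0 T, |I s - (∫ z, f s z * k (hv.flow s 0 z)) * ∫ w, η w|
      ≤ Λ * ε * C₀ * v * M := by
    intro s hs
    obtain ⟨Ck, hCk⟩ := hk.continuous.bounded_above_of_compact_support hkc
    have hsub : ∀ z, ∫ w, η (z - w) = ∫ w, η w := fun z => integral_phase_sub_left η z
    have hGc : ∀ z, Continuous fun w => η (z - w) := fun z =>
      hη'.continuous.comp (continuous_const.sub continuous_id)
    have hbd : ∀ z, |(∫ w, k (hv.flow s 0 w) * η (z - w)) - k (hv.flow s 0 z) * ∫ w, η w|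
        ≤ Λ * ε * C₀ * v := by
      intro z
      have h1 := abs_integral_mul_sub_le (hLip s hs) (hGc z) hε.le (fun w => hC₀ _)
        (fun w hw => hsupp _ hw)
      rwa [hsub] at h1
    have hi2 : Integrable fun z => f s z * (k (hv.flow s 0 z) * ∫ w, η w) :=
      integrable_mul_of_continuous (f s) (C := Ck * |∫ w, η w|)
        ((hk.continuous.comp (hΦc s 0)).mul continuous_const) fun z => by
          rw [abs_mul]
          gcongr
          exact hCk _
    have hm : StronglyMeasurable fun z => ∫ w, k (hv.flow s 0 w) * η (z - w) := by
      have h : StronglyMeasurable (Function.uncurry fun (z w : Phase d) => k (hv.flow s 0 w) * η (z - w)) := by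
        have hc : Continuous fun p : Phase d × Phase d => k (hv.flow s 0 p.2) * η (p.1 - p.2) :=
          (hk.continuous.comp ((hΦc s 0).comp continuous_snd)).mul
            (hη'.continuous.comp (continuous_fst.sub continuous_snd))
        exact hc.stronglyMeasurable
      exact h.integral_prod_right
    have hi1 : Integrable fun z => f s z * ∫ w, k (hv.flow s 0 w) * η (z - w) := by
      refine (L1.integrable_coeFn (f s)).smul_bdd (Λ * ε * C₀ * v + Ck * |∫ w, η w|) hm.aestronglyMeasurable
        (Eventually.of_forall fun z => ?_)
      have h1 := hbd z
      have h2 : |k (hv.flow s 0 z) * ∫ w, η w| ≤ Ck * |∫ w, η w| := by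
        rw [abs_mul]
        gcongr
        exact hCk _
      rw [Real.norm_eq_abs]
      calc |∫ w, k (hv.flow s 0 w) * η (z - w)|
          = |((∫ w, k (hv.flow s 0 w) * η (z - w)) - k (hv.flow s 0 z) * ∫ w, η w)
              + k (hv.flow s 0 z) * ∫ w, η w| := by rw [sub_add_cancel]
        _ ≤ _ := (abs_add_le _ _).trans (add_le_add h1 h2)
    rw [hI s, ← integral_mul_const]
    simp_rw [mul_assoc (f s _)]
    rw [← integral_sub hi1 hi2]
    simp_rw [← mul_sub]
    refine (abs_integral_mul_le (f s) hbd).trans ?_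
    gcongr
    exact hf.bound s
  have hT := hclose T Set.right_mem_uIcc
  have h0 := hclose 0 Set.left_mem_uIcc
  simp_rw [hv.flow_self] at h0
  rw [← hΛr, sub_mul]
  rw [abs_le] at *
  constructor <;> nlinarith

/-- Bounded weak solutions of the transport equation are transported by the flow. -/
theorem IsWeakTransport.ae_eq_flow (hF : IsRegularForce F B L) {f : ℝ → PhaseL1 d} {M : ℝ}
    (hf : IsWeakTransport (newtonField F) f M) (T : ℝ) :
    ∀ᵐ z, f T (hF.isLipschitzField.flow 0 T z) = f 0 z := by
  have hv := hF.isLipschitzField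
  have hMP := hF.measurePreserving_flow T
  have hM0 : 0 ≤ M := (norm_nonneg _).trans (hf.bound 0)
  have key : ∀ k : Phase d → ℝ, ContDiff ℝ (⊤ : ℕ∞) k → HasCompactSupport k →
      ∫ z, f T z * k (hv.flow T 0 z) = ∫ z, f 0 z * k z := by
    intro k hk hkc
    obtain ⟨Λ, hΛ⟩ := (hk.of_le (by norm_cast) : ContDiff ℝ 1 k).lipschitzWith_of_hasCompactSupport hkc one_ne_zero
    let b : ContDiffBump (0 : Phase d) := ⟨1 / 2, 1, by norm_num, by norm_num⟩
    have hb : ContDiff ℝ (⊤ : ℕ∞) b := b.contDiff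
    have hb1 : ContDiff ℝ 1 b := hb.of_le (by norm_cast)
    have hbint : 0 < ∫ w, b w := b.integral_pos
    have hbsupp : ∀ z, 1 < ‖z‖ → b z = 0 := fun z hz => b.zero_of_le_dist (by
      rw [dist_zero_right]; exact hz.le)
    obtain ⟨C₁, hC₁⟩ := (hb1.continuous_fderiv one_ne_zero).bounded_above_of_compact_support
      (b.hasCompactSupport.fderiv (𝕜 := ℝ))
    set D := Module.finrank ℝ (Phase d) with hD
    set v₁ := (volume (Metric.ball (0 : Phase d) 1)).toReal with hv₁
    set X := (∫ z, f T z * k (hv.flow T 0 z)) - ∫ z, f 0 z * k z with hX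
    set A := (2 * 1 + C₁ * ((max 1 L : ℝ≥0) : ℝ) * |T|) * (Λ * Real.exp (((max 1 L : ℝ≥0) : ℝ) * |T|)) with hA
    -- For the rescaled bump both `∫ η` and the volume of the ball scale like `ε^D`. These powers
    -- cancel, and one factor `ε` remains.
    have hest : ∀ ε : ℝ, 0 < ε → |X| * (∫ w, b w) ≤ A * v₁ * M * ε := by
      intro ε hε
      have h1 := hf.kernel_estimate hF hkc hΛ (η := fun z => b (ε⁻¹ • z)) (C₀ := 1) (C₁ := C₁)
        (hb.comp (contDiff_const_smul _)) hε (fun z hz => hbsupp _ ?_) (fun z => ?_) (fun z => ?_) T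
      · rw [Measure.integral_comp_inv_smul_of_nonneg _ _ hε.le, ← hD, smul_eq_mul] at h1
        have h2 : volume.real (Metric.closedBall (0 : Phase d) ε) = ε ^ D * v₁ := by
          unfold Measure.real
          rw [Measure.addHaar_closedBall _ _ hε.le, ENNReal.toReal_mul, ENNReal.toReal_ofReal (by positivity)]
        rw [h2, ← hX, ← hA, abs_mul, abs_mul, abs_of_pos hbint, abs_of_pos (pow_pos hε D)] at h1
        have h3 : 0 < ε ^ D := pow_pos hε D
        refine le_of_mul_le_mul_left ?_ h3
        linarith
      · rw [norm_smul, norm_inv, Real.norm_of_nonneg hε.le]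
        rwa [lt_inv_mul_iff₀ hε, mul_one]
      · rw [abs_of_nonneg b.nonneg]
        exact b.le_one
      · rw [fderiv_comp_smul, norm_smul, norm_inv, Real.norm_of_nonneg hε.le, div_eq_inv_mul]
        gcongr
        exact hC₁ _
    have h4 : |X| * (∫ w, b w) ≤ 0 := by
      have h5 : Tendsto (fun ε : ℝ => A * v₁ * M * ε) (𝓝[>] 0) (𝓝 0) := by
        have : Continuous fun ε : ℝ => A * v₁ * M * ε := by fun_prop
        simpa using (this.tendsto 0).mono_left nhdsWithin_le_nhds
      refine ge_of_tendsto h5 ?_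
      filter_upwards [self_mem_nhdsWithin] with ε hε
      exact hest ε hε
    have h6 : |X| ≤ 0 := by
      by_contra hneg
      have := mul_pos (not_le.1 hneg) hbint
      linarith
    exact sub_eq_zero.1 (abs_nonpos_iff.1 h6)
  have hint : Integrable fun z => f T (hv.flow 0 T z) :=
    hMP.integrable_comp_of_integrable (L1.integrable_coeFn (f T))
  refine ae_eq_of_integral_contDiff_smul_eq hint.locallyIntegrable (L1.integrable_coeFn (f 0)).locallyIntegrable
    fun k hk hkc => ?_
  simp_rw [smul_eq_mul, mul_comm (k _)]
  rw [← key k hk hkc, ← hMP.integral_comp (hv.flowHomeomorph 0 T).measurableEmbedding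
    fun z => f T z * k (hv.flow T 0 z)]
  congr 1
  ext z
  rw [hv.flow_flow, hv.flow_self]

end TransportUniqueness


/-! ### The potential generated by a phase-space density -/

section PhasePotential

variable {d : ℕ}

/-- The potential `V * ρ_f` of a phase-space density. -/
noncomputable def phasePotential (V : Pos d → ℝ) (f : PhaseL1 d) (x : Pos d) : ℝ := ∫ z, f z * V (x - z.1)

namespace IsC11With

variable {V : Pos d → ℝ} {B B' L : ℝ≥0} (hV : IsC11With V B B' L)

include hV

theorem integrable_phase (f : PhaseL1 d) (x : Pos d) : Integrable fun z => f z * V (x - z.1) :=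
  integrable_mul_of_continuous f
    (hV.contDiff.continuous.comp (continuous_const.sub continuous_fst)) fun _ => hV.bound _

theorem potential_spatialDensity (f : PhaseL1 d) :
    potential V (spatialDensity f) = fun x => (phasePotential V f x : ℂ) := by
  ext x
  unfold potential spatialDensity phasePotential
  have e : ∫ z : Phase d, f z * V (x - z.1) = ∫ y, ∫ p, f (y, p) * V (x - y) :=
    integral_prod (μ := volume) (ν := volume) (fun z : Phase d => f z * V (x - z.1)) (hV.integrable_phase f x)
  rw [e, ← integral_complex_ofReal]
  congr 1
  ext y
  rw [integral_mul_const]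
  push_cast
  ring

theorem abs_phasePotential_le (f : PhaseL1 d) (x : Pos d) : |phasePotential V f x| ≤ B * ‖f‖ :=
  abs_integral_mul_le f fun _ => hV.bound _

theorem phasePotential_sub (f g : PhaseL1 d) (x : Pos d) :
    phasePotential V f x - phasePotential V g x = phasePotential V (f - g) x := by
  unfold phasePotential
  rw [← integral_sub (hV.integrable_phase f x) (hV.integrable_phase g x)]
  apply integral_congr_ae
  filter_upwards [Lp.coeFn_sub f g] with z hz
  rw [hz, Pi.sub_apply, sub_mul]

theorem continuous_phasePotential (f : PhaseL1 d) : Continuous (phasePotential V f) := by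
  refine LipschitzWith.continuous (K := B' * ‖f‖₊) (LipschitzWith.of_dist_le_mul fun x y => ?_)
  rw [Real.dist_eq, dist_eq_norm]
  unfold phasePotential
  rw [← integral_sub (hV.integrable_phase f x) (hV.integrable_phase f y)]
  simp_rw [← mul_sub]
  refine (abs_integral_mul_le f (C := B' * ‖x - y‖) fun z => ?_).trans (le_of_eq ?_)
  · have := hV.lipschitz.norm_sub_le (x - z.1) (y - z.1)
    rwa [sub_sub_sub_cancel_right] at this
  · push_cast
    ring

theorem memLp_phasePotential (f : PhaseL1 d) :
    MemLp (fun y => (phasePotential V f y : ℂ)) ∞ (volume : Measure (Pos d)) := by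
  have := (hV.continuous_phasePotential f).measurable
  refine memLp_top_of_norm_le (B := B * ‖f‖) (Measurable.aestronglyMeasurable (by fun_prop)) fun y => ?_
  rw [Complex.norm_real]
  exact hV.abs_phasePotential_le f y

/-- Lipschitz dependence on the density makes the Duhamel integrand strongly measurable when `f` is
only a measurable curve. -/
theorem continuous_mulOp_phasePotential :
    Continuous fun f : PhaseL1 d => mulOp fun y => (phasePotential V f y : ℂ) := by
  refine LipschitzWith.continuous (K := B) (LipschitzWith.of_dist_le_mul fun f g => ?_)
  rw [dist_eq_norm, dist_eq_norm, mulOp_sub (hV.memLp_phasePotential f) (hV.memLp_phasePotential g)]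
  refine norm_mulOp_le ((hV.memLp_phasePotential f).sub (hV.memLp_phasePotential g)) fun y => ?_
  rw [Pi.sub_apply, ← Complex.ofReal_sub, Complex.norm_real, hV.phasePotential_sub]
  exact hV.abs_phasePotential_le _ y

/-- Potentials generated by transported densities are continuous in time. -/
theorem isRegularPotential_phase {F : ℝ → Pos d → Pos d} {BF LF : ℝ≥0} (hF : IsRegularForce F BF LF)
    {f : ℝ → PhaseL1 d} {M : ℝ≥0} (hM : ∀ t, ‖f t‖ ≤ M)
    (hf : ∀ t, ∀ᵐ z, f t (hF.isLipschitzField.flow 0 t z) = f 0 z) :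
    IsRegularPotential (fun t => phasePotential V (f t)) (B * M) where
  measurable t := (hV.continuous_phasePotential _).measurable
  bound t x := by
    refine (hV.abs_phasePotential_le _ x).trans ?_
    push_cast
    gcongr
    exact hM t
  equicontinuous s ε hε := by
    have hv := hF.isLipschitzField
    -- In Lagrangian coordinates the time dependence sits in the flow alone, with the fixed density
    -- `f 0`. The curve `f` itself is not assumed to be strongly continuous.
    have hrep : ∀ t x, phasePotential V (f t) x = ∫ z, f 0 z * V (x - (hv.flow 0 t z).1) := by
      intro t x
      unfold phasePotential
      rw [← (hF.measurePreserving_flow t).integral_comp (hv.flowHomeomorph 0 t).measurableEmbedding]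
      apply integral_congr_ae
      filter_upwards [hf t] with z hz
      rw [hz]
    have hint : ∀ t x, Integrable fun z => f 0 z * V (x - (hv.flow 0 t z).1) := fun t x =>
      integrable_mul_of_continuous (f 0) (hV.contDiff.continuous.comp (continuous_const.sub
        (continuous_fst.comp (hv.lipschitz_flow 0 t).continuous))) fun _ => hV.bound _
    -- The cut-off at `2B` provides an integrable majorant without any moment of `f 0`. The integral
    -- of `g t` does not depend on `x`, hence the uniformity in space.
    let g : ℝ → Phase d → ℝ := fun t z =>
      |f 0 z| * min (B' * ‖(hv.flow 0 t z).1 - (hv.flow 0 s z).1‖) (2 * B)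
    have hg : ∀ t x, |phasePotential V (f t) x - phasePotential V (f s) x| ≤ ∫ z, g t z := by
      intro t x
      rw [hrep, hrep, ← integral_sub (hint t x) (hint s x), ← Real.norm_eq_abs]
      refine norm_integral_le_of_norm_le ?_ (Eventually.of_forall fun z => ?_)
      · refine (L1.integrable_coeFn (f 0)).abs.smul_bdd (2 * B) ?_ (Eventually.of_forall fun z => ?_)
        · have h1 := (hv.lipschitz_flow 0 t).continuous
          have h2 := (hv.lipschitz_flow 0 s).continuous
          have : Continuous fun z => min (B' * ‖(hv.flow 0 t z).1 - (hv.flow 0 s z).1‖) (2 * (B : ℝ)) := by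
            fun_prop
          exact this.aestronglyMeasurable
        · rw [Real.norm_eq_abs, abs_of_nonneg (le_min (by positivity) (by positivity))]
          exact min_le_right _ _
      · rw [← mul_sub, norm_mul, Real.norm_eq_abs]
        refine mul_le_mul_of_nonneg_left (le_min ?_ ?_) (abs_nonneg _)
        · have := hV.lipschitz.norm_sub_le (x - (hv.flow 0 t z).1) (x - (hv.flow 0 s z).1)
          rwa [sub_sub_sub_cancel_left, norm_sub_rev (hv.flow 0 s z).1] at this
        · refine (norm_sub_le _ _).trans ?_
          have h1 := hV.bound (x - (hv.flow 0 t z).1)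
          have h2 := hV.bound (x - (hv.flow 0 s z).1)
          linarith
    have hlim : Tendsto (fun t => ∫ z, g t z) (𝓝 s) (𝓝 0) := by
      have h0 : ∫ z, g s z = 0 := by simp [g]
      rw [← h0]
      refine tendsto_integral_filter_of_dominated_convergence (fun z => |f 0 z| * (2 * B))
        (Eventually.of_forall fun t => ?_) (Eventually.of_forall fun t => Eventually.of_forall fun z => ?_)
        ((L1.integrable_coeFn (f 0)).abs.mul_const _) (Eventually.of_forall fun z => ?_)
      · have h1 := (hv.lipschitz_flow 0 t).continuous
        have h2 := (hv.lipschitz_flow 0 s).continuous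
        have : Continuous fun z => min (B' * ‖(hv.flow 0 t z).1 - (hv.flow 0 s z).1‖) (2 * (B : ℝ)) := by
          fun_prop
        exact (L1.integrable_coeFn (f 0)).abs.aestronglyMeasurable.mul this.aestronglyMeasurable
      · have hn : 0 ≤ min (B' * ‖(hv.flow 0 t z).1 - (hv.flow 0 s z).1‖) (2 * (B : ℝ)) :=
          le_min (by positivity) (by positivity)
        rw [Real.norm_eq_abs, abs_mul, abs_abs, abs_of_nonneg hn]
        gcongr
        exact min_le_right _ _
      · have h1 := hv.continuous_flow_time 0 z
        have : Continuous fun t => g t z := by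
          simp only [g]
          fun_prop
        exact this.tendsto s
    filter_upwards [hlim.eventually (ge_mem_nhds hε)] with t ht x
    exact (hg t x).trans ht

end IsC11With

/-! ### The Vlasov–Hartree flow -/

section Vlasov

variable {V : Pos d → ℝ} {B B' L : ℝ≥0} {f₀ : PhaseL1 d} {φ₀ : L2 d} {f : ℝ → PhaseL1 d} {φ : ℝ → L2 d}

theorem continuous_freeProp_neg_apply :
    Continuous fun q : ℝ × (Op d × L2 d) => freeProp (-q.1) (q.2.1 q.2.2) := by
  have h : Continuous fun q : ℝ × (Op d × L2 d) => q.2.1 q.2.2 :=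
    (continuous_fst.comp continuous_snd).clm_apply (continuous_snd.comp continuous_snd)
  exact continuous_freeProp_comp continuous_fst.neg h

/-- Taking the free group out of Duhamel's formula leaves a primitive of a bounded measurable
function, which is continuous in time. -/
theorem IsVlasovHartreeSolution.continuous_boson (h : IsVlasovHartreeSolution V f₀ φ₀ f φ)
    (hV : IsC11With V B B' L) : Continuous φ := by
  obtain ⟨C, hC⟩ := h.bounded
  have hC0 : 0 ≤ C := (norm_nonneg _).trans (hC 0).1
  let g : ℝ → L2 d := fun s => freeProp (-s) (mulOp (potential V (spatialDensity (f s))) (φ s))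
  have hgm : StronglyMeasurable g := by
    have h2 : StronglyMeasurable fun s => mulOp (potential V (spatialDensity (f s))) := by
      simp_rw [hV.potential_spatialDensity]
      have h1 := hV.continuous_mulOp_phasePotential.comp_stronglyMeasurable h.measurable_fermion
      simpa only [Function.comp_def] using h1
    have h3 : StronglyMeasurable fun s : ℝ => ((s, (_, φ s)) : ℝ × (Op d × L2 d)) :=
      stronglyMeasurable_id.prodMk (h2.prodMk h.measurable_boson)
    have h4 := (continuous_freeProp_neg_apply (d := d)).comp_stronglyMeasurable h3
    simpa only [Function.comp_def] using h4
  have hgb : ∀ s, ‖g s‖ ≤ B * C * C := by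
    intro s
    simp only [g]
    rw [norm_freeProp, hV.potential_spatialDensity]
    refine (norm_mulOp_apply_le (hV.memLp_phasePotential (f s)) (B := B * C) (fun y => ?_) (φ s)).trans ?_
    · rw [Complex.norm_real]
      refine (hV.abs_phasePotential_le (f s) y).trans ?_
      gcongr
      exact (hC s).1
    · gcongr
      exact (hC s).2
  have hgi : ∀ a b, IntervalIntegrable g volume a b := by
    intro a b
    refine (intervalIntegrable_const (c := B * C * C)).mono_fun hgm.aestronglyMeasurable
      (Eventually.of_forall fun s => ?_)
    exact (hgb s).trans (le_abs_self _)
  have h1 : ∀ t, φ t = freeProp t (φ₀ - Complex.I • ∫ s in (0 : ℝ)..t, g s) := by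
    intro t
    rw [freeProp_sub_vec, freeProp_smul_vec, freeProp_intervalIntegral _ (hgi 0 t), h.boson_eq t]
    congr 3
    ext1 s
    simp only [g]
    rw [← freeProp_add]
    congr 1
  have h2 : φ = fun t => freeProp t (φ₀ - Complex.I • ∫ s in (0 : ℝ)..t, g s) := funext h1
  rw [h2]
  refine continuous_freeProp_comp continuous_id ?_
  exact continuous_const.sub ((intervalIntegral.continuous_primitive hgi 0).const_smul Complex.I)

theorem IsVlasovHartreeSolution.isWeakTransport (h : IsVlasovHartreeSolution V f₀ φ₀ f φ) :
    ∃ M : ℝ≥0, IsWeakTransport (newtonField fun t => bosonForce V (φ t)) f M := by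
  obtain ⟨C, hC⟩ := h.bounded
  refine ⟨C.toNNReal, fun t => (hC t).1.trans (Real.le_coe_toNNReal C), fun k hkc hk t => ?_⟩
  exact h.fermion_eq (hkc.toSchwartzMap hk) t

/-- The boson field of a Vlasov–Hartree solution in terms of a regular potential. -/
theorem IsVlasovHartreeSolution.isRegularPotential (h : IsVlasovHartreeSolution V f₀ φ₀ f φ)
    (hV : IsC11With V B B' L) :
    ∃ M : ℝ≥0, IsRegularPotential (fun t => phasePotential V (f t)) M := by
  obtain ⟨C, hC⟩ := h.bounded
  obtain ⟨M, hM⟩ := h.isWeakTransport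
  have hR : ∀ t, ‖φ t‖ ≤ C.toNNReal := fun t => (hC t).2.trans (Real.le_coe_toNNReal C)
  have hF := hV.isRegularForce (h.continuous_boson hV) hR
  exact ⟨_, hV.isRegularPotential_phase hF hM.bound fun t => hM.ae_eq_flow hF t⟩

/-- The potential is continuous in time, uniformly in space, once `f` is known to be carried by the
flow. The mild solution is then given by a unitary propagator. -/
theorem IsVlasovHartreeSolution.norm_boson (h : IsVlasovHartreeSolution V f₀ φ₀ f φ)
    (hV : IsC11With V B B' L) (t : ℝ) : ‖φ t‖ = ‖φ₀‖ := by
  obtain ⟨M, hM⟩ := h.isRegularPotential hV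
  have h1 := hM.isBoundedHamiltonian.eq_propagator_of_mild 1 1 (φ₀ := φ₀) (h.continuous_boson hV)
    (fun t => by
      have := h.boson_eq t
      simp_rw [hV.potential_spatialDensity] at this
      simpa using this) t
  rw [h1, LinearIsometryEquiv.norm_map]

end Vlasov

end PhasePotential


/-! ### The potential generated by a density matrix -/

section QuantumPotential

variable {d : ℕ}

/-- The potential `V * ρ_ω`, with `ρ_ω = ħ^d ω(x; x)`, of a nonnegative trace-class operator. -/
noncomputable def quantumPotential (V : Pos d → ℝ) (ħ : ℝ) (ω : Op d) (x : Pos d) : ℝ :=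
  ħ ^ d * ∫ y, V (x - y) * (eDensity ω y).toReal

theorem ae_eDensity_lt_top {ω : Op d} (hω : 0 ≤ ω) (ht : IsTraceClass ω) : ∀ᵐ y, eDensity ω y < ∞ :=
  ae_lt_top' (aemeasurable_eDensity ω) (by rw [lintegral_eDensity hω]; exact ht.ne)

theorem integrable_eDensity {ω : Op d} (hω : 0 ≤ ω) (ht : IsTraceClass ω) :
    Integrable fun y => (eDensity ω y).toReal :=
  integrable_toReal_of_lintegral_ne_top (aemeasurable_eDensity ω) (by
    rw [lintegral_eDensity hω]; exact ht.ne)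

theorem integrable_mul_eDensity {ω : Op d} (hω : 0 ≤ ω) (ht : IsTraceClass ω) {a : Pos d → ℝ}
    (ha : Measurable a) {C : ℝ} (hC : ∀ y, |a y| ≤ C) : Integrable fun y => a y * (eDensity ω y).toReal := by
  refine ((integrable_eDensity hω ht).smul_bdd C ha.aestronglyMeasurable (Eventually.of_forall hC)).congr
    (Eventually.of_forall fun y => ?_)
  simp only [Pi.smul_apply', smul_eq_mul]
  ring

theorem integral_mul_eDensity {ω : Op d} (hω : 0 ≤ ω) (ht : IsTraceClass ω) {a : Pos d → ℝ}
    (ha : Measurable a) (ha0 : ∀ y, 0 ≤ a y) :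
    ∫ y, a y * (eDensity ω y).toReal = (mulTrace a ω).toReal := by
  rw [← lintegral_mul_eDensity ha, integral_eq_lintegral_of_nonneg_ae
    (Eventually.of_forall fun y => mul_nonneg (ha0 y) ENNReal.toReal_nonneg)
    (ha.aestronglyMeasurable.mul (integrable_eDensity hω ht).aestronglyMeasurable)]
  congr 1
  apply lintegral_congr_ae
  filter_upwards [ae_eDensity_lt_top hω ht] with y hy
  rw [ENNReal.ofReal_mul (ha0 y), ENNReal.ofReal_toReal hy.ne]

theorem summable_norm_sq_opSqrt {ω : Op d} (hω : 0 ≤ ω) (ht : IsTraceClass ω) :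
    Summable fun i => ‖opSqrt ω (onb (L2 d) i)‖ ^ 2 := by
  have h := ENNReal.summable_toReal (f := fun i => ‖opSqrt ω (onb (L2 d) i)‖ₑ ^ 2) (by
    rw [← traceNorm_eq hω]; exact ht.ne)
  refine h.congr fun i => ?_
  simp

theorem integrable_mul_norm_sq (v : L2 d) {a : Pos d → ℝ} (ha : Measurable a) {C : ℝ} (hC : ∀ y, |a y| ≤ C) :
    Integrable fun y => a y * ‖v y‖ ^ 2 := by
  refine ((integrable_norm_sq v).smul_bdd C ha.aestronglyMeasurable (Eventually.of_forall hC)).congr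
    (Eventually.of_forall fun y => ?_)
  simp only [Pi.smul_apply', smul_eq_mul]
  ring

theorem integral_eDensity_conjOp_of_nonneg (U : L2 d ≃ₗᵢ[ℂ] L2 d) {ω : Op d} (hω : 0 ≤ ω)
    (ht : IsTraceClass ω) {a : Pos d → ℝ} (ha : Measurable a) (ha0 : ∀ y, 0 ≤ a y) {C : ℝ}
    (hC : ∀ y, a y ≤ C) :
    ∫ y, a y * (eDensity (conjOp U ω) y).toReal
      = ∑' i, ∫ y, a y * ‖U (opSqrt ω (onb (L2 d) i)) y‖ ^ 2 := by
  have h1 := opTrace_conjOp U hω ht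
  rw [integral_mul_eDensity (conjOp_nonneg U hω) h1.1 ha ha0, mulTrace_conjOp ha ha0 hC U hω]
  have hC' : ∀ y, |a y| ≤ C := fun y => by rw [abs_of_nonneg (ha0 y)]; exact hC y
  have h2 : ∀ i, ∫⁻ y, ENNReal.ofReal (a y) * ‖U (opSqrt ω (onb (L2 d) i)) y‖ₑ ^ 2
      = ENNReal.ofReal (∫ y, a y * ‖U (opSqrt ω (onb (L2 d) i)) y‖ ^ 2) := by
    intro i
    rw [ofReal_integral_eq_lintegral_ofReal (integrable_mul_norm_sq _ ha hC')
      (Eventually.of_forall fun y => mul_nonneg (ha0 y) (by positivity))]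
    congr 1
    ext y
    rw [ENNReal.ofReal_mul (ha0 y), ennreal_sq_ofReal_norm]
  simp_rw [h2]
  rw [ENNReal.tsum_toReal_eq fun i => ENNReal.ofReal_ne_top]
  congr 1
  ext i
  exact ENNReal.toReal_ofReal (integral_nonneg fun y => mul_nonneg (ha0 y) (by positivity))

/-- The trace of a multiplication operator against a conjugated density matrix. -/
theorem integral_eDensity_conjOp (U : L2 d ≃ₗᵢ[ℂ] L2 d) {ω : Op d} (hω : 0 ≤ ω)
    (ht : IsTraceClass ω) {a : Pos d → ℝ} (ha : Measurable a) {C : ℝ} (hC : ∀ y, |a y| ≤ C) :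
    ∫ y, a y * (eDensity (conjOp U ω) y).toReal
      = ∑' i, ∫ y, a y * ‖U (opSqrt ω (onb (L2 d) i)) y‖ ^ 2 := by
  have hC0 : 0 ≤ C := (abs_nonneg _).trans (hC 0)
  have h1 := opTrace_conjOp U hω ht
  have hω' := conjOp_nonneg U hω
  -- The nonnegative case is applied to `a + C` and to `C`, and the difference is taken.
  have e1 := integral_eDensity_conjOp_of_nonneg U hω ht (a := fun y => a y + C) (ha.add_const C)
    (fun y => by linarith [(abs_le.1 (hC y)).1]) (C := C + C) (fun y => by linarith [(abs_le.1 (hC y)).2])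
  have e2 := integral_eDensity_conjOp_of_nonneg U hω ht (a := fun _ => C) measurable_const
    (fun y => hC0) (C := C) (fun y => le_rfl)
  have hs := summable_norm_sq_opSqrt hω ht
  have hint := fun i => integrable_mul_norm_sq (U (opSqrt ω (onb (L2 d) i))) ha hC
  have hintC := fun i => (integrable_norm_sq (U (opSqrt ω (onb (L2 d) i)))).const_mul C
  have hs1 : Summable fun i => ∫ y, C * ‖U (opSqrt ω (onb (L2 d) i)) y‖ ^ 2 := by
    refine (hs.mul_left C).congr fun i => ?_
    rw [integral_const_mul, integral_norm_sq, LinearIsometryEquiv.norm_map]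
  have hs2 : Summable fun i => ∫ y, a y * ‖U (opSqrt ω (onb (L2 d) i)) y‖ ^ 2 := by
    refine Summable.of_norm_bounded hs1 fun i => ?_
    refine norm_integral_le_of_norm_le (hintC i) (Eventually.of_forall fun y => ?_)
    rw [norm_mul, Real.norm_eq_abs, Real.norm_of_nonneg (by positivity)]
    gcongr
    exact hC y
  simp_rw [add_mul] at e1
  rw [integral_add (integrable_mul_eDensity hω' h1.1 ha hC)
    ((integrable_eDensity hω' h1.1).const_mul C)] at e1
  simp_rw [integral_add (hint _) (hintC _)] at e1
  rw [hs2.tsum_add hs1, e2] at e1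
  linarith

/-- The fermion density is a sum of boson-like densities of the orbitals `U ω^{1/2} e_i`, so the
bounds for `V * |φ|²` can be used orbital by orbital. -/
theorem quantumPotential_conjOp {V : Pos d → ℝ} {B B' L : ℝ≥0} (hV : IsC11With V B B' L) (ħ : ℝ)
    (U : L2 d ≃ₗᵢ[ℂ] L2 d) {ω : Op d} (hω : 0 ≤ ω) (ht : IsTraceClass ω) (x : Pos d) :
    quantumPotential V ħ (conjOp U ω) x
      = ħ ^ d * ∑' i, bosonPotential V (U (opSqrt ω (onb (L2 d) i))) x := by
  have hc : Measurable fun y => V (x - y) :=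
    (hV.contDiff.continuous.comp (continuous_const.sub continuous_id)).measurable
  unfold quantumPotential bosonPotential
  rw [integral_eDensity_conjOp U hω ht hc fun y => hV.bound _]

theorem potential_fermionDensity {V : Pos d → ℝ} {B B' L : ℝ≥0} (hV : IsC11With V B B' L) (ħ : ℝ)
    {ω : Op d} (hω : 0 ≤ ω) (ht : IsTraceClass ω) :
    potential V (fermionDensity ħ ω) = fun x => (quantumPotential V ħ ω x : ℂ) := by
  ext x
  have hc : Measurable fun y => V (x - y) :=
    (hV.contDiff.continuous.comp (continuous_const.sub continuous_id)).measurable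
  have h := integral_mul_positionDensity hω ht hc fun y => hV.bound (x - y)
  unfold potential fermionDensity quantumPotential
  push_cast
  rw [← h, ← integral_const_mul]
  congr 1
  ext y
  ring

theorem IsQuantumState.traceNorm_eq_inv {ħ : ℝ} {ω : Op d} (h : IsQuantumState ħ ω) :
    traceNorm ω = ENNReal.ofReal ((ħ ^ d)⁻¹) := by
  have h1 := h.trace_eq
  rw [opTrace_eq h.nonneg] at h1
  have h2 : (traceNorm ω).toReal = (ħ ^ d)⁻¹ := by exact_mod_cast h1
  rw [← h2, ENNReal.ofReal_toReal h.traceClass.ne]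

theorem IsQuantumState.tsum_norm_sq {ħ : ℝ} (hħ : 0 < ħ) {ω : Op d} (h : IsQuantumState ħ ω) :
    ∑' i, ‖opSqrt ω (onb (L2 d) i)‖ ^ 2 = (ħ ^ d)⁻¹ := by
  have h1 := h.traceNorm_eq_inv
  rw [traceNorm_eq h.nonneg] at h1
  simp_rw [ennreal_sq_ofReal_norm] at h1
  rw [← ENNReal.ofReal_tsum_of_nonneg (fun i => by positivity)
    (summable_norm_sq_opSqrt h.nonneg h.traceClass)] at h1
  have h2 := congrArg ENNReal.toReal h1
  rwa [ENNReal.toReal_ofReal (tsum_nonneg fun i => by positivity),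
    ENNReal.toReal_ofReal (by positivity)] at h2

/-- Potentials of unitarily transported density matrices are continuous in time, if they are given
by strongly continuous unitaries on some neighbourhood of each time. -/
theorem isRegularPotential_quantum {V : Pos d → ℝ} {B B' L : ℝ≥0} (hV : IsC11With V B B' L) {ħ : ℝ}
    (hħ : 0 < ħ) {ω₀ : Op d} (hω₀ : IsQuantumState ħ ω₀) {ω : ℝ → Op d}
    (hω : ∀ T : ℝ, ∃ U : ℝ → L2 d ≃ₗᵢ[ℂ] L2 d, (∀ u, Continuous fun t => U t u) ∧
      ∀ t ∈ Set.Ioo (-T) T, ω t = conjOp (U t) ω₀) :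
    IsRegularPotential (fun t => quantumPotential V ħ (ω t)) B := by
  have hs := summable_norm_sq_opSqrt hω₀.nonneg hω₀.traceClass
  have hsum := hω₀.tsum_norm_sq hħ
  have hħd : 0 < ħ ^ d := pow_pos hħ d
  have hmem : ∀ t : ℝ, t ∈ Set.Ioo (-(|t| + 1)) (|t| + 1) := fun t => by
    constructor
    · linarith [neg_abs_le t]
    · linarith [le_abs_self t]
  have hbd : ∀ (U : L2 d ≃ₗᵢ[ℂ] L2 d) i x, |bosonPotential V (U (opSqrt ω₀ (onb (L2 d) i))) x|
      ≤ B * ‖opSqrt ω₀ (onb (L2 d) i)‖ ^ 2 := by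
    intro U i x
    have := hV.norm_bosonPotential_le (U (opSqrt ω₀ (onb (L2 d) i))) x
    rwa [LinearIsometryEquiv.norm_map] at this
  have hsb : ∀ (U : L2 d ≃ₗᵢ[ℂ] L2 d) x, Summable fun i => bosonPotential V (U (opSqrt ω₀ (onb (L2 d) i))) x :=
    fun U x => Summable.of_norm_bounded (hs.mul_left (B : ℝ)) fun i => hbd U i x
  have hrep : ∀ (U : L2 d ≃ₗᵢ[ℂ] L2 d) x, quantumPotential V ħ (conjOp U ω₀) x
      = ħ ^ d * ∑' i, bosonPotential V (U (opSqrt ω₀ (onb (L2 d) i))) x := fun U x =>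
    quantumPotential_conjOp hV ħ U hω₀.nonneg hω₀.traceClass x
  refine ⟨fun t => ?_, fun t x => ?_, fun s ε hε => ?_⟩
  · obtain ⟨U, -, hU⟩ := hω (|t| + 1)
    have : quantumPotential V ħ (ω t)
        = fun x => ħ ^ d * ∑' i, bosonPotential V (U t (opSqrt ω₀ (onb (L2 d) i))) x := by
      ext x
      rw [hU t (hmem t), hrep]
    rw [this]
    refine (Continuous.measurable ?_)
    refine continuous_const.mul (continuous_tsum (fun i => hV.continuous_bosonPotential _)
      (hs.mul_left (B : ℝ)) fun i x => hbd (U t) i x)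
  · obtain ⟨U, -, hU⟩ := hω (|t| + 1)
    rw [hU t (hmem t), hrep, abs_mul, abs_of_pos hħd]
    have h1 : |∑' i, bosonPotential V (U t (opSqrt ω₀ (onb (L2 d) i))) x| ≤ B * (ħ ^ d)⁻¹ := by
      rw [← hsum, ← tsum_mul_left]
      rw [← Real.norm_eq_abs]
      exact tsum_of_norm_bounded (hs.mul_left (B : ℝ)).hasSum fun i => hbd (U t) i x
    calc ħ ^ d * _ ≤ ħ ^ d * (B * (ħ ^ d)⁻¹) := by gcongr
      _ = B := by field_simp
  · obtain ⟨U, hUc, hU⟩ := hω (|s| + 1)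
    -- The orbital bounds are uniform in `x` and dominated by the summable `4B‖ω₀^{1/2}e_i‖²`, so
    -- strong continuity of the unitaries suffices.
    let g : ℝ → basisIndex (L2 d) → ℝ := fun t i =>
      B * ((‖opSqrt ω₀ (onb (L2 d) i)‖ + ‖opSqrt ω₀ (onb (L2 d) i)‖)
        * ‖U t (opSqrt ω₀ (onb (L2 d) i)) - U s (opSqrt ω₀ (onb (L2 d) i))‖)
    have hgb : ∀ t i, g t i ≤ 4 * B * ‖opSqrt ω₀ (onb (L2 d) i)‖ ^ 2 := by
      intro t i
      have h1 : ‖U t (opSqrt ω₀ (onb (L2 d) i)) - U s (opSqrt ω₀ (onb (L2 d) i))‖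
          ≤ 2 * ‖opSqrt ω₀ (onb (L2 d) i)‖ := by
        refine (norm_sub_le _ _).trans ?_
        rw [LinearIsometryEquiv.norm_map, LinearIsometryEquiv.norm_map]
        linarith
      calc g t i ≤ B * ((‖opSqrt ω₀ (onb (L2 d) i)‖ + ‖opSqrt ω₀ (onb (L2 d) i)‖)
            * (2 * ‖opSqrt ω₀ (onb (L2 d) i)‖)) := by
            simp only [g]
            gcongr
        _ = _ := by ring
    have hg0 : ∀ t i, 0 ≤ g t i := fun t i => by
      simp only [g]
      positivity
    have hgs : ∀ t, Summable (g t) := fun t =>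
      Summable.of_nonneg_of_le (hg0 t) (hgb t) (hs.mul_left _)
    have hlim : Tendsto (fun t => ħ ^ d * ∑' i, g t i) (𝓝 s) (𝓝 0) := by
      have h1 : Tendsto (fun t => ∑' i, g t i) (𝓝 s) (𝓝 (∑' i, g s i)) := by
        refine tendsto_tsum_of_dominated_convergence (hs.mul_left (4 * (B : ℝ))) (fun i => ?_)
          (Eventually.of_forall fun t i => ?_)
        · have h2 := hUc (opSqrt ω₀ (onb (L2 d) i))
          have : Continuous fun t => g t i := by
            simp only [g]
            fun_prop
          exact this.tendsto s
        · rw [Real.norm_of_nonneg (hg0 t i)]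
          exact hgb t i
      have h3 : ∑' i, g s i = 0 := by simp [g]
      rw [h3] at h1
      simpa using h1.const_mul (ħ ^ d)
    filter_upwards [hlim.eventually (ge_mem_nhds hε), Ioo_mem_nhds (hmem s).1 (hmem s).2] with t ht htm x
    refine le_trans ?_ ht
    beta_reduce
    rw [hU t htm, hU s (hmem s), hrep, hrep, ← mul_sub, abs_mul, abs_of_pos hħd,
      ← (hsb (U t) x).tsum_sub (hsb (U s) x)]
    gcongr
    rw [← Real.norm_eq_abs]
    refine tsum_of_norm_bounded (hgs t).hasSum fun i => ?_
    have := hV.norm_bosonPotential_sub_le (U t (opSqrt ω₀ (onb (L2 d) i))) (U s (opSqrt ω₀ (onb (L2 d) i))) x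
    rw [LinearIsometryEquiv.norm_map, LinearIsometryEquiv.norm_map] at this
    exact this

section Hartree

variable {V : Pos d → ℝ} {B B' L : ℝ≥0} {ħ : ℝ} {ω₀ : Op d} {φ₀ : L2 d} {ω : ℝ → Op d} {φ : ℝ → L2 d}

theorem IsHartreeHartreeSolution.continuous_op (h : IsHartreeHartreeSolution V ħ ω₀ φ₀ ω φ) :
    Continuous ω := by
  refine continuous_iff_continuousAt.2 fun s => ?_
  rw [ContinuousAt, tendsto_iff_edist_tendsto_0]
  refine tendsto_of_tendsto_of_tendsto_of_le_of_le tendsto_const_nhds (h.continuous_fermion s)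
    (fun _ => zero_le) fun t => ?_
  simp only
  rw [edist_eq_enorm_sub]
  exact enorm_le_traceNorm _

/-- No global bound on the boson field is known at this stage, since conservation of its norm
presupposes a regular fermion potential. Freezing the field outside `[-T, T]` gives a bounded
potential and breaks the circle: the local representation yields positivity of `ω` and a regular
potential, hence the conserved norm. -/
theorem IsHartreeHartreeSolution.exists_unitary (h : IsHartreeHartreeSolution V ħ ω₀ φ₀ ω φ)
    (hV : IsC11With V B B' L) (T : ℝ) : ∃ U : ℝ → L2 d ≃ₗᵢ[ℂ] L2 d, (∀ u, Continuous fun t => U t u) ∧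
      ∀ t ∈ Set.Ioo (-T) T, ω t = conjOp (U t) ω₀ := by
  rcases le_or_gt T 0 with hT | hT
  · refine ⟨fun _ => LinearIsometryEquiv.refl ℂ _, fun u => continuous_const, fun t ht => ?_⟩
    have := ht.1.trans ht.2
    linarith
  have hc := h.continuous_boson
  obtain ⟨R, hR⟩ := (isCompact_Icc (a := -T) (b := T)).exists_bound_of_continuousOn hc.continuousOn
  let ψ : ℝ → L2 d := fun t => φ (max (-T) (min t T))
  have hψc : Continuous ψ := hc.comp (by fun_prop)
  have hψ : ∀ t, ‖ψ t‖ ≤ R.toNNReal := fun t =>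
    (hR _ ⟨le_max_left _ _, max_le (by linarith) (min_le_right _ _)⟩).trans (Real.le_coe_toNNReal R)
  have hψφ : ∀ t ∈ Set.Ioo (-T) T, ψ t = φ t := by
    intro t ht
    simp only [ψ]
    rw [min_eq_left ht.2.le, max_eq_right ht.1.le]
  have hM := (hV.isRegularPotential hψc hψ).isBoundedHamiltonian
  -- Continuity is local in time, so the same freezing, now around `s`, is enough for the
  -- untruncated potential.
  have hM' : Continuous fun t => mulOp fun y => (bosonPotential V (φ t) y : ℂ) := by
    refine continuous_iff_continuousAt.2 fun s => ?_
    obtain ⟨R', hR'⟩ := (isCompact_Icc (a := s - 1) (b := s + 1)).exists_bound_of_continuousOn hc.continuousOn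
    let χ : ℝ → L2 d := fun t => φ (max (s - 1) (min t (s + 1)))
    have hχc : Continuous χ := hc.comp (by fun_prop)
    have hχ : ∀ t, ‖χ t‖ ≤ R'.toNNReal := fun t =>
      (hR' _ ⟨le_max_left _ _, max_le (by linarith) (min_le_right _ _)⟩).trans (Real.le_coe_toNNReal R')
    refine ((hV.isRegularPotential hχc hχ).isBoundedHamiltonian.continuous.continuousAt (x := s)).congr ?_
    filter_upwards [Ioo_mem_nhds (show s - 1 < s by linarith) (show s < s + 1 by linarith)] with t ht
    simp only [χ]
    rw [min_eq_left ht.2.le, max_eq_right ht.1.le]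
  refine ⟨fun t => hM.propagator ħ ħ⁻¹ t, fun u => hM.continuous_propagator ħ ħ⁻¹ u, fun t ht => ?_⟩
  refine hM.eq_conjOp_of_mild ħ ħ⁻¹ hM' (fun s hs => by simp only [hψφ s hs]) h.continuous_op (fun t u => ?_) ht
  have h1 := h.fermion_eq t u
  simp_rw [potential_bosonDensity] at h1
  rw [Complex.ofReal_inv, ← div_eq_mul_inv]
  exact h1

theorem IsHartreeHartreeSolution.isRegularPotential (h : IsHartreeHartreeSolution V ħ ω₀ φ₀ ω φ)
    (hV : IsC11With V B B' L) (hħ : 0 < ħ) (hω₀ : IsQuantumState ħ ω₀) :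
    IsRegularPotential (fun t => quantumPotential V ħ (ω t)) B :=
  isRegularPotential_quantum hV hħ hω₀ fun T => h.exists_unitary hV T

theorem IsHartreeHartreeSolution.nonneg (h : IsHartreeHartreeSolution V ħ ω₀ φ₀ ω φ)
    (hV : IsC11With V B B' L) (hω₀ : IsQuantumState ħ ω₀) (t : ℝ) : 0 ≤ ω t := by
  obtain ⟨U, -, hU⟩ := h.exists_unitary hV (|t| + 1)
  rw [hU t ⟨by linarith [neg_abs_le t], by linarith [le_abs_self t]⟩]
  exact conjOp_nonneg _ hω₀.nonneg

theorem IsHartreeHartreeSolution.boson_mild (h : IsHartreeHartreeSolution V ħ ω₀ φ₀ ω φ)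
    (hV : IsC11With V B B' L) (hω₀ : IsQuantumState ħ ω₀) (t : ℝ) :
    φ t = freeProp t φ₀ - Complex.I • ∫ s in (0 : ℝ)..t,
      freeProp (t - s) (mulOp (fun y => (quantumPotential V ħ (ω s) y : ℂ)) (φ s)) := by
  have h1 := h.boson_eq t
  have h2 : ∀ s, potential V (fermionDensity ħ (ω s)) = fun y => (quantumPotential V ħ (ω s) y : ℂ) :=
    fun s => potential_fermionDensity hV ħ (h.nonneg hV hω₀ s) (h.traceClass s)
  simp_rw [h2] at h1
  exact h1

theorem IsHartreeHartreeSolution.norm_boson (h : IsHartreeHartreeSolution V ħ ω₀ φ₀ ω φ)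
    (hV : IsC11With V B B' L) (hħ : 0 < ħ) (hω₀ : IsQuantumState ħ ω₀) (t : ℝ) : ‖φ t‖ = ‖φ₀‖ := by
  have h1 := (h.isRegularPotential hV hħ hω₀).isBoundedHamiltonian.eq_propagator_of_mild 1 1 (φ₀ := φ₀)
    h.continuous_boson (fun t => by simpa using h.boson_mild hV hω₀ t) t
  rw [h1, LinearIsometryEquiv.norm_map]

/-- The fermions of a Hartree–Hartree solution evolve by conjugation with a propagator. -/
theorem IsHartreeHartreeSolution.eq_conjOp (h : IsHartreeHartreeSolution V ħ ω₀ φ₀ ω φ)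
    (hV : IsC11With V B B' L) {R : ℝ≥0} (hR : ∀ t, ‖φ t‖ ≤ R) (t : ℝ) :
    ω t = conjOp ((hV.isRegularPotential h.continuous_boson hR).isBoundedHamiltonian.propagator ħ ħ⁻¹ t) ω₀ := by
  have hM := (hV.isRegularPotential h.continuous_boson hR).isBoundedHamiltonian
  refine hM.eq_conjOp_of_mild (T := |t| + 1) ħ ħ⁻¹ hM.continuous (fun s _ => rfl) h.continuous_op (fun t u => ?_)
    ⟨by linarith [neg_abs_le t], by linarith [le_abs_self t]⟩
  have h1 := h.fermion_eq t u
  simp_rw [potential_bosonDensity] at h1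
  rw [Complex.ofReal_inv, ← div_eq_mul_inv]
  exact h1

end Hartree

end QuantumPotential


/-! ### Comparison of the classical and quantum potentials along a coupling -/

section Coupling

variable {d : ℕ}

theorem lintegral_enorm_sq (v : L2 d) : ∫⁻ y, ‖v y‖ₑ ^ 2 = ‖v‖ₑ ^ 2 := by
  have h2 := wNorm_sq (fun _ => 1) v
  rw [wNorm_const] at h2
  simpa using h2.symm

/-- From `|x - y| ≤ θ/2 + |x - y|²/(2θ)`: the quadratic term is the position part of the cost
divided by `θ`. A free `θ` replaces a Cauchy–Schwarz argument. -/
theorem lintegral_mul_enorm_sq_le {A : Pos d → ℝ} {x : Pos d} {b θ : ℝ} (hb : 0 ≤ b) (hθ : 0 < θ)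
    (hA : ∀ y, A y ≤ A x + b * ‖x - y‖) (ħ : ℝ) (p : Pos d) (v : L2 d) :
    ∫⁻ y, ENNReal.ofReal (A y) * ‖v y‖ₑ ^ 2
      ≤ ENNReal.ofReal (A x + b * (θ / 2)) * ‖v‖ₑ ^ 2 + ENNReal.ofReal (b / θ) * costForm ħ x p v := by
  have hpt : ∀ y, ENNReal.ofReal (A y) * ‖v y‖ₑ ^ 2 ≤ ENNReal.ofReal (A x + b * (θ / 2)) * ‖v y‖ₑ ^ 2
      + ENNReal.ofReal (b / θ) * (2⁻¹ * (‖x - y‖ₑ ^ 2 * ‖v y‖ₑ ^ 2)) := by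
    intro y
    have h1 : A y ≤ (A x + b * (θ / 2)) + b / θ * (2⁻¹ * ‖x - y‖ ^ 2) := by
      have h2 : ‖x - y‖ ≤ θ / 2 + 1 / θ * (2⁻¹ * ‖x - y‖ ^ 2) := by
        have h3 : θ / 2 + 1 / θ * (2⁻¹ * ‖x - y‖ ^ 2) - ‖x - y‖ = (θ - ‖x - y‖) ^ 2 / (2 * θ) := by
          field_simp
          ring
        have h4 : 0 ≤ (θ - ‖x - y‖) ^ 2 / (2 * θ) := by positivity
        linarith
      calc A y ≤ A x + b * ‖x - y‖ := hA y
        _ ≤ A x + b * (θ / 2 + 1 / θ * (2⁻¹ * ‖x - y‖ ^ 2)) := by gcongr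
        _ = _ := by ring
    have h5 : ENNReal.ofReal (b / θ * (2⁻¹ * ‖x - y‖ ^ 2))
        = ENNReal.ofReal (b / θ) * (2⁻¹ * ‖x - y‖ₑ ^ 2) := by
      rw [ENNReal.ofReal_mul (by positivity), ENNReal.ofReal_mul (by positivity), ennreal_sq_ofReal_norm,
        ENNReal.ofReal_inv_of_pos (by norm_num)]
      simp
    calc ENNReal.ofReal (A y) * ‖v y‖ₑ ^ 2
        ≤ (ENNReal.ofReal (A x + b * (θ / 2)) + ENNReal.ofReal (b / θ * (2⁻¹ * ‖x - y‖ ^ 2)))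
          * ‖v y‖ₑ ^ 2 := by
          gcongr
          exact (ENNReal.ofReal_le_ofReal h1).trans ENNReal.ofReal_add_le
      _ = _ := by rw [h5]; ring
  refine (lintegral_mono hpt).trans ?_
  have hm : AEMeasurable (fun y => ‖v y‖ₑ ^ 2) := (Lp.aestronglyMeasurable v).enorm.pow_const 2
  rw [lintegral_add_left' (hm.const_mul _), lintegral_const_mul' _ _ ENNReal.ofReal_ne_top,
    lintegral_enorm_sq, lintegral_const_mul' _ _ ENNReal.ofReal_ne_top,
    lintegral_const_mul' _ _ (by simp)]
  gcongr
  exact le_self_add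

theorem mulTrace_le_of_lipschitz {A : Pos d → ℝ} {x : Pos d} {b θ : ℝ} (hb : 0 ≤ b) (hθ : 0 < θ)
    (hA : ∀ y, A y ≤ A x + b * ‖x - y‖) (ħ : ℝ) (p : Pos d) {Q : Op d} (hQ : 0 ≤ Q) :
    mulTrace A Q ≤ ENNReal.ofReal (A x + b * (θ / 2)) * traceNorm Q
      + ENNReal.ofReal (b / θ) * traceForm (costForm ħ x p) Q := by
  rw [traceNorm_eq hQ]
  unfold mulTrace traceForm
  rw [← ENNReal.tsum_mul_left, ← ENNReal.tsum_mul_left, ← ENNReal.tsum_add]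
  exact ENNReal.tsum_le_tsum fun i => lintegral_mul_enorm_sq_le hb hθ hA ħ p _

/-- The transport cost of a coupling. -/
noncomputable def couplingCost (ħ : ℝ) (Q : Phase d → Op d) : ℝ≥0∞ :=
  ∫⁻ z, traceForm (costForm ħ z.1 z.2) (Q z)

variable {ħ : ℝ} {f : PhaseL1 d} {ω : Op d} {Q : Phase d → Op d}

theorem IsCoupling.ae_traceNorm (hQ : IsCoupling ħ f ω Q) :
    ∀ᵐ z, 0 ≤ Q z ∧ traceNorm (Q z) = ENNReal.ofReal ((ħ ^ d)⁻¹ * f z) := by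
  filter_upwards [hQ.nonneg, hQ.trace_eq] with z h0 h1
  refine ⟨h0, ?_⟩
  have h2 := h1.2
  rw [opTrace_eq h0] at h2
  have h3 : (traceNorm (Q z)).toReal = (ħ ^ d)⁻¹ * f z := by exact_mod_cast h2
  rw [← h3, ENNReal.ofReal_toReal h1.1.ne]

/-- The bound for each `Q(z)` is integrated over phase space. The integral of `Tr(A Q(z))` is
`Tr(Aω)`, and `Tr Q(z)` is `ħ^{-d} f(z)`. Keeping `θ` free avoids dividing by a cost that may
vanish. -/
theorem IsCoupling.mulTrace_le (hQ : IsCoupling ħ f ω Q) (hħ : 0 < ħ) (hf : IsClassicalState f)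
    (hω : 0 ≤ ω) (hfin : couplingCost ħ Q ≠ ∞) {A : Pos d → ℝ} (hAm : Measurable A)
    {b θ C : ℝ} (hb : 0 ≤ b) (hθ : 0 < θ) (hA : ∀ x y, A y ≤ A x + b * ‖x - y‖) (hA0 : ∀ x, 0 ≤ A x)
    (hC : ∀ x, A x ≤ C) :
    ħ ^ d * (mulTrace A ω).toReal ≤ (∫ z, f z * A z.1)
      + b * (θ / 2 + ħ ^ d * (couplingCost ħ Q).toReal / θ) := by
  have hħd : 0 < ħ ^ d := pow_pos hħ d
  have hint : Integrable f := L1.integrable_coeFn f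
  have hfA : Integrable fun z : Phase d => f z * A z.1 :=
    (hint.smul_bdd C (hAm.comp measurable_fst).aestronglyMeasurable (Eventually.of_forall fun z => by
      simpa only [Function.comp_apply, Real.norm_of_nonneg (hA0 _)] using hC _)).congr (Eventually.of_forall fun z => by
        simp [mul_comm])
  have hg : Integrable fun z : Phase d => (ħ ^ d)⁻¹ * (f z * A z.1 + b * (θ / 2) * f z) :=
    (hfA.add (hint.const_mul _)).const_mul _
  have h1 : mulTrace A ω ≤ ENNReal.ofReal (∫ z : Phase d, (ħ ^ d)⁻¹ * (f z * A z.1 + b * (θ / 2) * f z))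
      + ENNReal.ofReal (b / θ) * couplingCost ħ Q := by
    rw [← lintegral_mulTrace hAm hA0 hC hQ.nonneg hω (fun u => hQ.integral_eq u u)]
    have hg0 : ∀ᵐ z : Phase d, 0 ≤ (ħ ^ d)⁻¹ * (f z * A z.1 + b * (θ / 2) * f z) := by
      filter_upwards [hf.nonneg] with z hz
      have := hA0 z.1
      positivity
    rw [ofReal_integral_eq_lintegral_ofReal hg hg0, couplingCost,
      ← lintegral_const_mul' _ _ ENNReal.ofReal_ne_top,
      ← lintegral_add_left' hg.aestronglyMeasurable.aemeasurable.ennreal_ofReal]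
    apply lintegral_mono_ae
    filter_upwards [hQ.ae_traceNorm, hf.nonneg] with z hz hfz
    refine (mulTrace_le_of_lipschitz hb hθ (hA z.1) ħ z.2 hz.1).trans (le_of_eq ?_)
    have := hA0 z.1
    rw [hz.2, ← ENNReal.ofReal_mul (by positivity)]
    congr 2
    ring
  have h2 := ENNReal.toReal_mono (by finiteness) h1
  rw [ENNReal.toReal_add ENNReal.ofReal_ne_top (by finiteness), ENNReal.toReal_mul,
    ENNReal.toReal_ofReal (integral_nonneg_of_ae (by
      filter_upwards [hf.nonneg] with z hz
      have := hA0 z.1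
      positivity)), ENNReal.toReal_ofReal (by positivity), integral_const_mul, integral_add hfA (hint.const_mul _), integral_const_mul,
    hf.integral_eq_one] at h2
  refine (mul_le_mul_of_nonneg_left h2 hħd.le).trans (le_of_eq ?_)
  calc _ = ħ ^ d * (ħ ^ d)⁻¹ * ((∫ z, f z * A z.1) + b * (θ / 2))
          + b * (ħ ^ d * (couplingCost ħ Q).toReal / θ) := by ring
    _ = _ := by rw [mul_inv_cancel₀ hħd.ne']; ring

theorem IsQuantumState.integral_eDensity (hħ : 0 < ħ) (h : IsQuantumState ħ ω) :
    ħ ^ d * ∫ y, (eDensity ω y).toReal = 1 := by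
  have h1 := integral_mul_eDensity h.nonneg h.traceClass (a := fun _ => 1) measurable_const (by simp)
  have h2 := lintegral_mul_eDensity (a := fun _ => 1) measurable_const ω
  simp only [ENNReal.ofReal_one, one_mul, lintegral_eDensity h.nonneg, h.traceNorm_eq_inv] at h1 h2
  have hħd : 0 < ħ ^ d := pow_pos hħ d
  rw [h1, ← h2, ENNReal.toReal_ofReal (by positivity)]
  field_simp

/-- The potentials generated by coupled fermion states are close if the coupling is cheap. -/
theorem IsCoupling.abs_potential_sub_le {V : Pos d → ℝ} {B B' L : ℝ≥0} (hV : IsC11With V B B' L)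
    (hQ : IsCoupling ħ f ω Q) (hħ : 0 < ħ) (hf : IsClassicalState f) (hω : IsQuantumState ħ ω)
    (hfin : couplingCost ħ Q ≠ ∞) {θ : ℝ} (hθ : 0 < θ) (x : Pos d) :
    |phasePotential V f x - quantumPotential V ħ ω x|
      ≤ B' * (θ / 2 + ħ ^ d * (couplingCost ħ Q).toReal / θ) := by
  have hint : Integrable f := L1.integrable_coeFn f
  have hc : Measurable fun y => V (x - y) :=
    (hV.contDiff.continuous.comp (continuous_const.sub continuous_id)).measurable
  have hlip : ∀ y y', |V (x - y) - V (x - y')| ≤ B' * ‖y - y'‖ := fun y y' => by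
    have := hV.lipschitz.dist_le_mul (x - y) (x - y')
    rw [dist_eq_norm, dist_eq_norm] at this
    rwa [sub_sub_sub_cancel_left, norm_sub_rev y' y, Real.norm_eq_abs] at this
  have hb : ∀ y, |V (x - y)| ≤ B := fun y => hV.bound _
  have hE := hω.integral_eDensity hħ
  have hi := integrable_mul_eDensity hω.nonneg hω.traceClass hc hb
  have hiE := (integrable_eDensity hω.nonneg hω.traceClass).const_mul (B : ℝ)
  have hf' : Integrable fun z : Phase d => f z * V (x - z.1) :=
    (hint.smul_bdd B (hc.comp measurable_fst).aestronglyMeasurable (Eventually.of_forall fun z =>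
      hb _)).congr (Eventually.of_forall fun z => by simp [mul_comm])
  have hfB : Integrable fun z : Phase d => f z * (B : ℝ) := hint.mul_const _
  have hfBi : ∫ z : Phase d, f z * (B : ℝ) = B := by rw [integral_mul_const, hf.integral_eq_one, one_mul]
  -- Applied to the nonnegative functions `V(x - ·) + B` and `B - V(x - ·)`. Both normalized states
  -- have mass one, so the constant `B` cancels.
  have up := hQ.mulTrace_le hħ hf hω.nonneg hfin (A := fun y => V (x - y) + B) (hc.add_const _) B'.coe_nonneg hθ
    (fun y y' => by linarith [(abs_le.1 (hlip y y')).1])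
    (fun y => by linarith [(abs_le.1 (hb y)).1]) (C := B + B) fun y => by linarith [(abs_le.1 (hb y)).2]
  have dn := hQ.mulTrace_le hħ hf hω.nonneg hfin (A := fun y => B - V (x - y)) (hc.const_sub _) B'.coe_nonneg hθ
    (fun y y' => by linarith [(abs_le.1 (hlip y y')).2])
    (fun y => by linarith [(abs_le.1 (hb y)).2]) (C := B + B) fun y => by linarith [(abs_le.1 (hb y)).1]
  rw [← integral_mul_eDensity hω.nonneg hω.traceClass (hc.add_const _)
    fun y => by linarith [(abs_le.1 (hb y)).1]] at up
  rw [← integral_mul_eDensity hω.nonneg hω.traceClass (hc.const_sub _)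
    fun y => by linarith [(abs_le.1 (hb y)).2]] at dn
  simp_rw [add_mul, mul_add] at up
  simp_rw [sub_mul, mul_sub] at dn
  rw [integral_add hi hiE, integral_add hf' hfB, hfBi, integral_const_mul] at up
  rw [integral_sub hiE hi, integral_sub hfB hf', hfBi, integral_const_mul] at dn
  unfold phasePotential quantumPotential
  rw [abs_le]
  have hE' : ħ ^ d * ((B : ℝ) * ∫ y, (eDensity ω y).toReal) = B := by
    rw [mul_left_comm, hE, mul_one]
  constructor
  · linarith
  · linarith

end Coupling


/-! ### Transport of states and couplings -/

section Transport

variable {d : ℕ} {ħ : ℝ} {f g : PhaseL1 d} {ω : Op d} {Q : Phase d → Op d} {e : Phase d ≃ᵐ Phase d}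

theorem ae_eq_comp_symm (he : MeasurePreserving e volume volume) (hfg : ∀ᵐ z, g (e z) = f z) :
    ∀ᵐ z, g z = f (e.symm z) := by
  filter_upwards [(he.symm e).quasiMeasurePreserving.ae hfg] with z hz
  rwa [e.apply_symm_apply] at hz

theorem IsCoupling.transport (hQ : IsCoupling ħ f ω Q) (he : MeasurePreserving e volume volume)
    (hfg : ∀ᵐ z, g (e z) = f z) (U : L2 d ≃ₗᵢ[ℂ] L2 d) :
    IsCoupling ħ g (conjOp U ω) fun z => conjOp U (Q (e.symm z)) where
  measurable u v := by
    simp_rw [inner_conjOp]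
    exact (hQ.measurable _ _).comp_measurePreserving (he.symm e)
  nonneg := by
    filter_upwards [(he.symm e).quasiMeasurePreserving.ae hQ.nonneg] with z hz
    exact conjOp_nonneg U hz
  integral_eq u v := by
    simp_rw [inner_conjOp]
    have h := hQ.integral_eq (U.symm u) (U.symm v)
    refine ⟨(he.symm e).integrable_comp_of_integrable h.1, ?_⟩
    rw [← h.2]
    exact (he.symm e).integral_comp' fun z => inner ℂ (U.symm u) (Q z (U.symm v))
  trace_eq := by
    filter_upwards [(he.symm e).quasiMeasurePreserving.ae hQ.nonneg,
      (he.symm e).quasiMeasurePreserving.ae hQ.trace_eq, ae_eq_comp_symm he hfg] with z hz h1 h2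
    have h3 := opTrace_conjOp U hz h1.1
    rw [h2, h3.2]
    exact ⟨h3.1, h1.2⟩

theorem IsCoupling.lintegral_traceNorm (hQ : IsCoupling ħ f ω Q) (hħ : 0 < ħ) (hf : IsClassicalState f) :
    ∫⁻ z, traceNorm (Q z) = ENNReal.ofReal ((ħ ^ d)⁻¹) := by
  rw [lintegral_congr_ae (hQ.ae_traceNorm.mono fun z hz => hz.2),
    ← ofReal_integral_eq_lintegral_ofReal ((L1.integrable_coeFn f).const_mul _),
    integral_const_mul, hf.integral_eq_one, mul_one]
  filter_upwards [hf.nonneg] with z hz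
  have : 0 < ħ ^ d := pow_pos hħ d
  positivity

/-- Basis independence reduces the traces to the vector bound `hc`, after the volume-preserving
substitution; the inhomogeneous term sums up to the total trace `ħ^{-d}`. -/
theorem IsCoupling.couplingCost_transport_le (hQ : IsCoupling ħ f ω Q) (hħ : 0 < ħ)
    (hf : IsClassicalState f) (he : MeasurePreserving e volume volume) (U : L2 d ≃ₗᵢ[ℂ] L2 d) {E D : ℝ}
    (hc : ∀ z u, costForm ħ (e z).1 (e z).2 (U u)
      ≤ ENNReal.ofReal E * (costForm ħ z.1 z.2 u + ENNReal.ofReal D * ‖u‖ₑ ^ 2)) :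
    couplingCost ħ (fun z => conjOp U (Q (e.symm z)))
      ≤ ENNReal.ofReal E * (couplingCost ħ Q + ENNReal.ofReal D * ENNReal.ofReal ((ħ ^ d)⁻¹)) := by
  have h1 : couplingCost ħ (fun z => conjOp U (Q (e.symm z)))
      = ∫⁻ z, traceForm (costForm ħ (e z).1 (e z).2) (conjOp U (Q z)) := by
    unfold couplingCost
    rw [← he.lintegral_comp_emb e.measurableEmbedding]
    simp_rw [e.symm_apply_apply]
  rw [h1, ← hQ.lintegral_traceNorm hħ hf, couplingCost, ← lintegral_const_mul' _ _ ENNReal.ofReal_ne_top,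
    ← lintegral_add_right', ← lintegral_const_mul' _ _ ENNReal.ofReal_ne_top]
  · apply lintegral_mono_ae
    filter_upwards [hQ.nonneg] with z hz
    rw [traceForm_conjOp ħ _ _ U hz (isParseval_onb (L2 d)), traceNorm_eq hz, traceForm,
      ← ENNReal.tsum_mul_left, ← ENNReal.tsum_add, ← ENNReal.tsum_mul_left]
    exact ENNReal.tsum_le_tsum fun i => hc z _
  · refine AEMeasurable.const_mul ?_ _
    refine AEMeasurable.congr ?_ (hQ.ae_traceNorm.mono fun z hz => hz.2.symm)
    exact ((L1.integrable_coeFn f).const_mul _).aestronglyMeasurable.aemeasurable.ennreal_ofReal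

theorem IsClassicalState.transport (hf : IsClassicalState f) (he : MeasurePreserving e volume volume)
    (hfg : ∀ᵐ z, g (e z) = f z) {a K : ℝ} (hlin : ∀ z, ‖e z‖ ≤ a + K * ‖z‖) : IsClassicalState g where
  nonneg := by
    filter_upwards [(he.symm e).quasiMeasurePreserving.ae hf.nonneg, ae_eq_comp_symm he hfg] with z hz h2
    rwa [h2]
  integral_eq_one := by
    rw [← hf.integral_eq_one, ← he.integral_comp']
    exact integral_congr_ae hfg
  second_moment := by
    rw [← he.integrable_comp_emb e.measurableEmbedding]
    have hint : Integrable f := L1.integrable_coeFn f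
    have hm : Integrable fun z : Phase d => 4 * a ^ 2 * f z + 4 * K ^ 2 * ((‖z.1‖ ^ 2 + ‖z.2‖ ^ 2) * f z) :=
      (hint.const_mul _).add (hf.second_moment.const_mul _)
    refine hm.mono' ?_ ?_
    · refine AEStronglyMeasurable.mul ?_ ?_
      · have : Measurable fun z : Phase d => ‖(e z).1‖ ^ 2 + ‖(e z).2‖ ^ 2 :=
          ((measurable_fst.comp e.measurable).norm.pow_const 2).add
            ((measurable_snd.comp e.measurable).norm.pow_const 2)
        exact this.aestronglyMeasurable
      · exact (Lp.aestronglyMeasurable g).comp_measurePreserving he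
    · filter_upwards [hfg, hf.nonneg] with z hz h0
      simp only [Function.comp_apply]
      rw [hz, Real.norm_of_nonneg (by positivity), ← mul_assoc, ← add_mul]
      refine mul_le_mul_of_nonneg_right ?_ h0
      have h1 := norm_fst_le (e z)
      have h2 := norm_snd_le (e z)
      have h3 := hlin z
      have h4 : ‖z‖ ^ 2 ≤ ‖z.1‖ ^ 2 + ‖z.2‖ ^ 2 := by
        rw [Prod.norm_def]
        rcases max_cases ‖z.1‖ ‖z.2‖ with h | h <;> rw [h.1] <;> nlinarith [sq_nonneg ‖z.1‖, sq_nonneg ‖z.2‖]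
      have h5 : ‖(e z).1‖ ^ 2 ≤ (a + K * ‖z‖) ^ 2 := by gcongr; exact h1.trans h3
      have h6 : ‖(e z).2‖ ^ 2 ≤ (a + K * ‖z‖) ^ 2 := by gcongr; exact h2.trans h3
      have h7 : (a + K * ‖z‖) ^ 2 ≤ 2 * a ^ 2 + 2 * K ^ 2 * ‖z‖ ^ 2 := by
        nlinarith [sq_nonneg (a - K * ‖z‖)]
      have h8 : K ^ 2 * ‖z‖ ^ 2 ≤ K ^ 2 * (‖z.1‖ ^ 2 + ‖z.2‖ ^ 2) := by gcongr
      linarith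

theorem enorm_sub_sq_le {E : Type*} [NormedAddCommGroup E] (x y : E) :
    ‖x - y‖ₑ ^ 2 ≤ 2 * ‖x‖ₑ ^ 2 + 2 * ‖0 - y‖ₑ ^ 2 := by
  rw [ennreal_sq_ofReal_norm, ennreal_sq_ofReal_norm, ennreal_sq_ofReal_norm, zero_sub, norm_neg]
  have h2 : (2 : ℝ≥0∞) = ENNReal.ofReal 2 := by simp
  rw [h2, ← ENNReal.ofReal_mul (by norm_num), ← ENNReal.ofReal_mul (by norm_num),
    ← ENNReal.ofReal_add (by positivity) (by positivity)]
  refine ENNReal.ofReal_le_ofReal ?_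
  have h1 := norm_sub_le x y
  have h3 : ‖x - y‖ ^ 2 ≤ (‖x‖ + ‖y‖) ^ 2 := by gcongr
  nlinarith [sq_nonneg (‖x‖ - ‖y‖)]

theorem lintegral_enorm_sub_sq_le {X : Pos d → Pos d} (x : Pos d) (v : L2 d) :
    2⁻¹ * ∫⁻ y, ‖x - X y‖ₑ ^ 2 * ‖v y‖ₑ ^ 2
      ≤ ‖x‖ₑ ^ 2 * ‖v‖ₑ ^ 2 + 2 * (2⁻¹ * ∫⁻ y, ‖0 - X y‖ₑ ^ 2 * ‖v y‖ₑ ^ 2) := by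
  have hm : AEMeasurable (fun y => ‖v y‖ₑ ^ 2) := (Lp.aestronglyMeasurable v).enorm.pow_const 2
  have h1 : ∫⁻ y, ‖x - X y‖ₑ ^ 2 * ‖v y‖ₑ ^ 2
      ≤ 2 * ‖x‖ₑ ^ 2 * ‖v‖ₑ ^ 2 + 2 * ∫⁻ y, ‖0 - X y‖ₑ ^ 2 * ‖v y‖ₑ ^ 2 := by
    rw [← lintegral_enorm_sq v, ← lintegral_const_mul' _ _ (by finiteness),
      ← lintegral_const_mul' _ _ (by finiteness), ← lintegral_add_left' (hm.const_mul _)]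
    refine lintegral_mono fun y => ?_
    calc ‖x - X y‖ₑ ^ 2 * ‖v y‖ₑ ^ 2 ≤ (2 * ‖x‖ₑ ^ 2 + 2 * ‖0 - X y‖ₑ ^ 2) * ‖v y‖ₑ ^ 2 := by
          gcongr
          exact enorm_sub_sq_le _ _
      _ = _ := by ring
  have h2 : (2 : ℝ≥0∞)⁻¹ * 2 = 1 := ENNReal.inv_mul_cancel (by norm_num) (by norm_num)
  refine (mul_le_mul_right h1 _).trans (le_of_eq ?_)
  calc _ = (2⁻¹ * 2) * (‖x‖ₑ ^ 2 * ‖v‖ₑ ^ 2) + 2 * (2⁻¹ * ∫⁻ y, ‖0 - X y‖ₑ ^ 2 * ‖v y‖ₑ ^ 2) := by ring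
    _ = _ := by rw [h2, one_mul]

theorem costForm_le_costForm_zero (ħ : ℝ) (x p : Pos d) (u : L2 d) :
    costForm ħ x p u ≤ (‖x‖ₑ ^ 2 + ‖p‖ₑ ^ 2) * ‖u‖ₑ ^ 2 + 2 * costForm ħ 0 0 u := by
  have h1 := lintegral_enorm_sub_sq_le (X := fun y => y) x u
  have h2 := lintegral_enorm_sub_sq_le (X := fun y => (2 * Real.pi * ħ) • y) p (𝓕 u : L2 d)
  have h3 : ‖(𝓕 u : L2 d)‖ₑ = ‖u‖ₑ := by
    rw [enorm_eq_ofReal_norm, Lp.norm_fourier_eq, ← enorm_eq_ofReal_norm]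
  rw [h3] at h2
  unfold costForm
  refine (add_le_add h1 h2).trans (le_of_eq ?_)
  ring

/-- Recentring the cost at the origin adds only `(|x|² + |p|²) Tr ω`. The comparison may thus use
any centre, which is needed since the flow moves centres. -/
theorem IsQuantumState.conjOp (hω : IsQuantumState ħ ω) (U : L2 d ≃ₗᵢ[ℂ] L2 d) {E : ℝ} {x p : Pos d}
    (hc : ∀ u, costForm ħ 0 0 (U u) ≤ ENNReal.ofReal E * costForm ħ x p u) :
    IsQuantumState ħ (conjOp U ω) where
  nonneg := conjOp_nonneg U hω.nonneg
  traceClass := (opTrace_conjOp U hω.nonneg hω.traceClass).1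
  trace_eq := (opTrace_conjOp U hω.nonneg hω.traceClass).2.trans hω.trace_eq
  second_moment := by
    rw [traceForm_conjOp ħ 0 0 U hω.nonneg (isParseval_onb (L2 d))]
    have h1 : ∑' i, costForm ħ 0 0 (U (opSqrt ω (onb (L2 d) i)))
        ≤ ENNReal.ofReal E * ((‖x‖ₑ ^ 2 + ‖p‖ₑ ^ 2) * traceNorm ω + 2 * traceForm (costForm ħ 0 0) ω) := by
      rw [traceNorm_eq hω.nonneg, traceForm, ← ENNReal.tsum_mul_left, ← ENNReal.tsum_mul_left,
        ← ENNReal.tsum_add, ← ENNReal.tsum_mul_left]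
      refine ENNReal.tsum_le_tsum fun i => (hc _).trans ?_
      gcongr
      exact costForm_le_costForm_zero ħ x p _
    refine h1.trans_lt ?_
    have h2 : traceNorm ω ≠ ∞ := hω.traceClass.ne
    have h3 := hω.second_moment.ne
    finiteness

end Transport

/-! ### Propagation of states and couplings along the two evolutions. -/

section Evolution

variable {d : ℕ} {V : Pos d → ℝ} {B B' L : ℝ≥0} {ħ : ℝ} {ω₀ : Op d} {φ₀ φħ₀ : L2 d} {ω : ℝ → Op d}
  {φ φħ : ℝ → L2 d} {f₀ : PhaseL1 d} {f : ℝ → PhaseL1 d}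

theorem IsHartreeHartreeSolution.isQuantumState (h : IsHartreeHartreeSolution V ħ ω₀ φħ₀ ω φħ)
    (hV : IsC11With V B B' L) (hħ : 0 < ħ) (hω₀ : IsQuantumState ħ ω₀) (t : ℝ) :
    IsQuantumState ħ (ω t) := by
  have hR : ∀ s, ‖φħ s‖ ≤ ‖φħ₀‖₊ := fun s => (h.norm_boson hV hħ hω₀ s).le
  have hF := hV.isRegularForce h.continuous_boson hR
  have hw := hV.isRegularPotential h.continuous_boson hR
  set L' : ℝ := L * ‖φħ₀‖ ^ 2
  -- The second moment at time `t` is the cost relative to the origin. A fictitious classical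
  -- particle driven by the same boson field, so that `Δ = 0`, is started at the point from which it
  -- reaches the origin at time `t`.
  let z := hF.isLipschitzField.flow t 0 (0, 0)
  have hz : hF.isLipschitzField.flow 0 t z = (0, 0) := by
    simp only [z]
    rw [hF.isLipschitzField.flow_flow, hF.isLipschitzField.flow_self]
  rw [h.eq_conjOp hV hR t]
  refine hω₀.conjOp _ (E := Real.exp (2 * (6 + 12 * L' ^ 2) * |t|)) (x := z.1) (p := z.2) fun u => ?_
  have h1 := costForm_propagator_le hħ hF hw (fun s => (hF.lipschitz s).continuous.measurable)
    (L := L * ‖φħ₀‖ ^ 2) (L' := L') (Δ := 0) (lam := 6 + 12 * L' ^ 2) (T := t) (by linarith)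
    (by nlinarith [sq_nonneg L']) (fun s y k => by
      rw [← h.norm_boson hV hħ hω₀ s]
      exact hV.bosonPotential_taylor _ _ _) (fun s _ x y => by
      rw [zero_mul, add_zero]
      simp only [L']
      rw [← h.norm_boson hV hħ hω₀ s]
      exact hV.norm_bosonForce_sub_point_le _ _ _) z u
  rw [hz] at h1
  simpa using h1

/-- The flow of the mean-field force as a measurable equivalence of phase space. -/
noncomputable def IsRegularForce.flowEquiv {F : ℝ → Pos d → Pos d} {BF LF : ℝ≥0}
    (hF : IsRegularForce F BF LF) (t : ℝ) : Phase d ≃ᵐ Phase d :=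
  (hF.isLipschitzField.flowHomeomorph 0 t).toMeasurableEquiv

theorem IsRegularForce.flowEquiv_apply {F : ℝ → Pos d → Pos d} {BF LF : ℝ≥0}
    (hF : IsRegularForce F BF LF) (t : ℝ) (z : Phase d) :
    hF.flowEquiv t z = hF.isLipschitzField.flow 0 t z := rfl

theorem IsRegularForce.measurePreserving_flowEquiv {F : ℝ → Pos d → Pos d} {BF LF : ℝ≥0}
    (hF : IsRegularForce F BF LF) (t : ℝ) : MeasurePreserving (hF.flowEquiv t) volume volume :=
  hF.measurePreserving_flow t

theorem IsVlasovHartreeSolution.ae_flowEquiv (h : IsVlasovHartreeSolution V f₀ φ₀ f φ)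
    {BF LF : ℝ≥0} (hF : IsRegularForce (fun t => bosonForce V (φ t)) BF LF) (t : ℝ) :
    ∀ᵐ z, f t (hF.flowEquiv t z) = f₀ z := by
  obtain ⟨M, hM⟩ := h.isWeakTransport
  have := hM.ae_eq_flow hF t
  rwa [h.initial_fermion] at this

theorem IsVlasovHartreeSolution.isClassicalState (h : IsVlasovHartreeSolution V f₀ φ₀ f φ)
    (hV : IsC11With V B B' L) (hf₀ : IsClassicalState f₀) (t : ℝ) : IsClassicalState (f t) := by
  have hR : ∀ s, ‖φ s‖ ≤ ‖φ₀‖₊ := fun s => (h.norm_boson hV s).le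
  have hF := hV.isRegularForce (h.continuous_boson hV) hR
  refine hf₀.transport (hF.measurePreserving_flowEquiv t) (h.ae_flowEquiv hF t)
    (a := ‖hF.flowEquiv t 0‖) (K := Real.exp ((max 1 (L * ‖φ₀‖₊ ^ 2) : ℝ≥0) * |t - 0|)) fun z => ?_
  have h1 := hF.isLipschitzField.dist_flow_le 0 t z 0
  rw [dist_eq_norm, dist_zero_right] at h1
  have h2 := norm_le_norm_add_norm_sub' (hF.isLipschitzField.flow 0 t z) (hF.isLipschitzField.flow 0 t 0)
  simp only [IsRegularForce.flowEquiv_apply]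
  linarith

/-- Along the two evolutions, couplings can be transported at an exponential price, up to the
distance of the bosonic fields. -/
theorem exists_coupling_evolution (h : IsVlasovHartreeSolution V f₀ φ₀ f φ)
    (h' : IsHartreeHartreeSolution V ħ ω₀ φħ₀ ω φħ) (hV : IsC11With V B B' L) (hħ : 0 < ħ)
    (hf₀ : IsClassicalState f₀) (hω₀ : IsQuantumState ħ ω₀) {R : ℝ≥0} (hR : ‖φ₀‖ ≤ R) (hR' : ‖φħ₀‖ ≤ R)
    {lam : ℝ} (hlam : 6 + 12 * (L * R ^ 2) ^ 2 ≤ lam) {m T : ℝ}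
    (hφ : ∀ s ∈ Set.uIcc 0 T, ‖φ s - φħ s‖ ≤ m * Real.exp (lam * |s|))
    {Q : Phase d → Op d} (hQ : IsCoupling ħ f₀ ω₀ Q) (hfin : couplingCost ħ Q ≠ ∞) :
    ∃ Q', IsCoupling ħ (f T) (ω T) Q' ∧ couplingCost ħ Q' ≠ ∞ ∧ ħ ^ d * (couplingCost ħ Q').toReal
      ≤ Real.exp (2 * lam * |T|) * (ħ ^ d * (couplingCost ħ Q).toReal + (2 * B' * R * m) ^ 2) := by
  have hb : ∀ s, ‖φ s‖ ≤ R := fun s => (h.norm_boson hV s).le.trans hR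
  have hb' : ∀ s, ‖φħ s‖ ≤ R := fun s => (h'.norm_boson hV hħ hω₀ s).le.trans hR'
  have hF := hV.isRegularForce (h.continuous_boson hV) hb
  have hG := hV.isRegularForce h'.continuous_boson hb'
  have hw := hV.isRegularPotential h'.continuous_boson hb'
  have hħd : 0 < ħ ^ d := pow_pos hħ d
  set U := hw.isBoundedHamiltonian.propagator ħ ħ⁻¹ T with hU
  -- The forces differ by the displacement at fixed field, with constant `LR²`, and by the change of
  -- field at a fixed point, with constant `B' · 2R`. Hence `Δ = 2B'Rm`.
  have hc : ∀ z u, costForm ħ (hF.flowEquiv T z).1 (hF.flowEquiv T z).2 (U u)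
      ≤ ENNReal.ofReal (Real.exp (2 * lam * |T|))
        * (costForm ħ z.1 z.2 u + ENNReal.ofReal ((2 * B' * R * m) ^ 2) * ‖u‖ₑ ^ 2) := by
    intro z u
    refine costForm_propagator_le hħ hF hw (fun s => (hG.lipschitz s).continuous.measurable)
      (L := L * R ^ 2) (L' := L * R ^ 2) (by linarith) (by nlinarith [sq_nonneg ((L : ℝ) * R ^ 2)])
      (fun s y k => ?_) (fun s hs x y => ?_) z u
    · refine (hV.bosonPotential_taylor _ _ _).trans ?_
      gcongr
      exact hb' s
    · have e1 := hV.norm_bosonForce_sub_point_le (φ s) x y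
      have e2 := hV.norm_bosonForce_sub_le (φ s) (φħ s) y
      have e3 : (L : ℝ) * ‖φ s‖ ^ 2 * ‖x - y‖ ≤ L * R ^ 2 * ‖x - y‖ := by
        gcongr
        exact hb s
      have e4 : (B' : ℝ) * ((‖φ s‖ + ‖φħ s‖) * ‖φ s - φħ s‖)
          ≤ B' * ((R + R) * (m * Real.exp (lam * |s|))) := by
        gcongr
        · exact hb s
        · exact hb' s
        · exact hφ s hs
      calc ‖bosonForce V (φ s) x - bosonForce V (φħ s) y‖
          ≤ ‖bosonForce V (φ s) x - bosonForce V (φ s) y‖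
            + ‖bosonForce V (φ s) y - bosonForce V (φħ s) y‖ := norm_sub_le_norm_sub_add_norm_sub _ _ _
        _ ≤ L * R ^ 2 * ‖x - y‖ + B' * ((R + R) * (m * Real.exp (lam * |s|))) :=
          add_le_add (e1.trans e3) (e2.trans e4)
        _ = _ := by ring
  have hQ' := hQ.transport (hF.measurePreserving_flowEquiv T) (h.ae_flowEquiv hF T) U
  rw [hU, ← h'.eq_conjOp hV hb' T] at hQ'
  have h1 := hQ.couplingCost_transport_le hħ hf₀ (hF.measurePreserving_flowEquiv T) U hc
  refine ⟨_, hQ', (h1.trans_lt (by finiteness)).ne, ?_⟩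
  have h2 := ENNReal.toReal_mono (by finiteness) h1
  rw [ENNReal.toReal_mul, ENNReal.toReal_add hfin (by finiteness), ENNReal.toReal_mul,
    ENNReal.toReal_ofReal (by positivity), ENNReal.toReal_ofReal (by positivity),
    ENNReal.toReal_ofReal (by positivity)] at h2
  refine (mul_le_mul_of_nonneg_left h2 hħd.le).trans (le_of_eq ?_)
  calc _ = Real.exp (2 * lam * |T|) * (ħ ^ d * (couplingCost ħ Q).toReal
        + (2 * B' * R * m) ^ 2 * (ħ ^ d * (ħ ^ d)⁻¹)) := by ring
    _ = _ := by rw [mul_inv_cancel₀ hħd.ne', mul_one]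

end Evolution


/-! ### Stability of the bosonic fields and of the quantum Wasserstein distance -/

section Stability

variable {d : ℕ} {V : Pos d → ℝ} {B B' L : ℝ≥0} {ħ : ℝ} {ω₀ : Op d} {φ₀ φħ₀ : L2 d} {ω : ℝ → Op d}
  {φ φħ : ℝ → L2 d} {f₀ : PhaseL1 d} {f : ℝ → PhaseL1 d}

theorem norm_mulOp_sub_mulOp_le {a b : Pos d → ℝ} (ha : MemLp (fun y => (a y : ℂ)) ∞ (volume : Measure (Pos d)))
    (hb : MemLp (fun y => (b y : ℂ)) ∞ (volume : Measure (Pos d))) {κ β : ℝ} (hab : ∀ y, |a y - b y| ≤ κ)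
    (hβ : ∀ y, |b y| ≤ β) (u v : L2 d) :
    ‖mulOp (fun y => (a y : ℂ)) u - mulOp (fun y => (b y : ℂ)) v‖ ≤ κ * ‖u‖ + β * ‖u - v‖ := by
  have h1 : mulOp (fun y => (a y : ℂ)) u - mulOp (fun y => (b y : ℂ)) v
      = mulOp (fun y => (a y : ℂ) - (b y : ℂ)) u + mulOp (fun y => (b y : ℂ)) (u - v) := by
    rw [← mulOp_sub ha hb, map_sub, sub_apply]
    abel
  rw [h1]
  refine (norm_add_le _ _).trans (add_le_add ?_ ?_)
  · refine norm_mulOp_apply_le (ha.sub hb) (fun y => ?_) u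
    rw [Pi.sub_apply, ← Complex.ofReal_sub, Complex.norm_real]
    exact hab y
  · refine norm_mulOp_apply_le hb (fun y => ?_) _
    rw [Complex.norm_real]
    exact hβ y

/-- Grönwall-type estimate for two solutions of Schrödinger equations with nearby potentials. -/
theorem norm_sub_le_of_mild {w w' : ℝ → Pos d → ℝ} {M M' : ℝ≥0} (hw : IsRegularPotential w M)
    (hw' : IsRegularPotential w' M') {ψ ψ' : ℝ → L2 d} (hψ : Continuous ψ) (hψ' : Continuous ψ') {ψ₀ ψ₀' : L2 d}
    {T : ℝ} (h : ψ T = freeProp T ψ₀ - Complex.I • ∫ s in (0 : ℝ)..T,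
      freeProp (T - s) (mulOp (fun y => (w s y : ℂ)) (ψ s)))
    (h' : ψ' T = freeProp T ψ₀' - Complex.I • ∫ s in (0 : ℝ)..T,
      freeProp (T - s) (mulOp (fun y => (w' s y : ℂ)) (ψ' s)))
    {R κ m lam : ℝ} (hlam : 0 < lam) (hκ : 0 ≤ κ) (hR : ∀ s, ‖ψ s‖ ≤ R)
    (hww : ∀ s ∈ Set.uIcc 0 T, ∀ y, |w s y - w' s y| ≤ κ * Real.exp (lam * |s|))
    (hm : ∀ s ∈ Set.uIcc 0 T, ‖ψ s - ψ' s‖ ≤ m * Real.exp (lam * |s|)) :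
    ‖ψ T - ψ' T‖ ≤ ‖ψ₀ - ψ₀'‖ + (κ * R + M' * m) / lam * (Real.exp (lam * |T|) - 1) := by
  have hg : Continuous fun s => freeProp (T - s) (mulOp (fun y => (w s y : ℂ)) (ψ s)) :=
    continuous_freeProp_comp (by fun_prop) (hw.isBoundedHamiltonian.continuous.clm_apply hψ)
  have hg' : Continuous fun s => freeProp (T - s) (mulOp (fun y => (w' s y : ℂ)) (ψ' s)) :=
    continuous_freeProp_comp (by fun_prop) (hw'.isBoundedHamiltonian.continuous.clm_apply hψ')
  have h1 : ψ T - ψ' T = freeProp T (ψ₀ - ψ₀') - Complex.I • ∫ s in (0 : ℝ)..T,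
      (freeProp (T - s) (mulOp (fun y => (w s y : ℂ)) (ψ s))
        - freeProp (T - s) (mulOp (fun y => (w' s y : ℂ)) (ψ' s))) := by
    rw [intervalIntegral.integral_sub (hg.intervalIntegrable _ _) (hg'.intervalIntegrable _ _), h, h',
      freeProp_sub_vec, smul_sub]
    abel
  rw [h1]
  refine (norm_sub_le _ _).trans ?_
  rw [norm_freeProp, norm_smul, Complex.norm_I, one_mul]
  gcongr
  have h2 := norm_intervalIntegral_le_exp (E := L2 d) (g := fun s =>
      freeProp (T - s) (mulOp (fun y => (w s y : ℂ)) (ψ s))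
        - freeProp (T - s) (mulOp (fun y => (w' s y : ℂ)) (ψ' s))) (A := κ * R + M' * m) (t₀ := 0) hlam T
    fun s hs => by
      rw [← freeProp_sub_vec, norm_freeProp, sub_zero]
      refine (norm_mulOp_sub_mulOp_le (hw.memLp s) (hw'.memLp s) (hww s hs) (hw'.bound s) _ _).trans ?_
      calc κ * Real.exp (lam * |s|) * ‖ψ s‖ + M' * ‖ψ s - ψ' s‖
          ≤ κ * Real.exp (lam * |s|) * R + M' * (m * Real.exp (lam * |s|)) := by
            gcongr
            · exact hR s
            · exact hm s hs
        _ = _ := by ring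
  simpa using h2

/-- The rate of exponential growth in the stability estimate. -/
noncomputable def growthRate (B B' L R : ℝ≥0) : ℝ :=
  6 + 12 * (L * R ^ 2) ^ 2 + 2 * (3 / 2 * B' * R * (2 * B' * R) + B + 3 / 2 * B' * R)

theorem growthRate_ge (B B' L R : ℝ≥0) : 6 + 12 * (L * R ^ 2) ^ 2 ≤ growthRate B B' L R := by
  unfold growthRate
  have : (0 : ℝ) ≤ 2 * (3 / 2 * B' * R * (2 * B' * R) + B + 3 / 2 * B' * R) := by positivity
  linarith

theorem growthRate_pos (B B' L R : ℝ≥0) : 0 < growthRate B B' L R :=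
  lt_of_lt_of_le (by positivity) (growthRate_ge B B' L R)

/-- The distance of the bosonic fields is controlled by the initial distances. -/
theorem norm_boson_sub_le (h : IsVlasovHartreeSolution V f₀ φ₀ f φ)
    (h' : IsHartreeHartreeSolution V ħ ω₀ φħ₀ ω φħ) (hV : IsC11With V B B' L) (hħ : 0 < ħ)
    (hf₀ : IsClassicalState f₀) (hω₀ : IsQuantumState ħ ω₀) {R : ℝ≥0} (hR : ‖φ₀‖ ≤ R) (hR' : ‖φħ₀‖ ≤ R)
    {Q : Phase d → Op d} (hQ : IsCoupling ħ f₀ ω₀ Q) (hfin : couplingCost ħ Q ≠ ∞) (T : ℝ) :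
    ‖φ T - φħ T‖ ≤ (2 * ‖φ₀ - φħ₀‖ + √(ħ ^ d * (couplingCost ħ Q).toReal))
      * Real.exp (growthRate B B' L R * |T|) := by
  have hc := h.continuous_boson hV
  have hc' := h'.continuous_boson
  set lam := growthRate B B' L R with hlam
  have hlam0 : 0 < lam := growthRate_pos B B' L R
  set a := ħ ^ d * (couplingCost ħ Q).toReal with ha
  have ha0 : 0 ≤ a := by positivity
  -- The maximum `m` of the weighted distance of the fields gives the exponential a priori bound
  -- that `exists_coupling_evolution` needs. It is then estimated by Duhamel's formula at the
  -- maximizing time `S`.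
  obtain ⟨S, hS, hmax⟩ := (isCompact_uIcc (a := 0) (b := T)).exists_isMaxOn Set.nonempty_uIcc
    (f := fun s => ‖φ s - φħ s‖ * Real.exp (-(lam * |s|))) (by fun_prop)
  set m := ‖φ S - φħ S‖ * Real.exp (-(lam * |S|)) with hm
  have hm0 : 0 ≤ m := by positivity
  have hexp : ∀ s, Real.exp (-(lam * |s|)) * Real.exp (lam * |s|) = 1 := fun s => by
    rw [← Real.exp_add, neg_add_cancel, Real.exp_zero]
  have hb : ∀ s ∈ Set.uIcc 0 T, ‖φ s - φħ s‖ ≤ m * Real.exp (lam * |s|) := by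
    intro s hs
    have h1 : ‖φ s - φħ s‖ * Real.exp (-(lam * |s|)) ≤ m := hmax hs
    calc ‖φ s - φħ s‖ = ‖φ s - φħ s‖ * Real.exp (-(lam * |s|)) * Real.exp (lam * |s|) := by
          rw [mul_assoc, hexp, mul_one]
      _ ≤ _ := by gcongr
  have hsub : ∀ s ∈ Set.uIcc 0 S, Set.uIcc 0 s ⊆ Set.uIcc 0 T := fun s hs =>
    (Set.uIcc_subset_uIcc_left hs).trans (Set.uIcc_subset_uIcc_left hS)
  suffices hmain : m ≤ 2 * ‖φ₀ - φħ₀‖ + √a by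
    refine (hb T Set.right_mem_uIcc).trans ?_
    gcongr
  obtain ⟨M, hM⟩ := h.isRegularPotential hV
  have hM' := h'.isRegularPotential hV hħ hω₀
  refine le_of_forall_pos_le_add fun ε hε => ?_
  -- `n e^{λ|s|}` dominates the square root of the transported cost and serves as `θ`. The term `ε`
  -- keeps it positive when cost and distance vanish, and the sum `1/2 + 1` gives the constant
  -- `3/2`.
  set n := √a + 2 * B' * R * m + ε with hn
  have hn0 : 0 < n := by positivity
  have hpot : ∀ s ∈ Set.uIcc 0 S, ∀ y, |phasePotential V (f s) y - quantumPotential V ħ (ω s) y|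
      ≤ 3 / 2 * B' * n * Real.exp (lam * |s|) := by
    intro s hs y
    obtain ⟨Q', hQ', hfin', hcost⟩ := exists_coupling_evolution h h' hV hħ hf₀ hω₀ hR hR'
      (growthRate_ge B B' L R) (fun r hr => hb r (hsub s hs hr)) hQ hfin
    have hθ : 0 < n * Real.exp (lam * |s|) := by positivity
    refine (hQ'.abs_potential_sub_le hV hħ (h.isClassicalState hV hf₀ s)
      (h'.isQuantumState hV hħ hω₀ s) hfin' hθ y).trans ?_
    have h1 : a + (2 * B' * R * m) ^ 2 ≤ n ^ 2 := by
      have h2 : (√a) ^ 2 = a := Real.sq_sqrt ha0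
      have h3 : 0 ≤ √a := Real.sqrt_nonneg a
      have h4 : (0 : ℝ) ≤ 2 * B' * R * m := by positivity
      rw [hn]
      nlinarith [mul_nonneg h3 h4, mul_nonneg (add_nonneg h3 h4) hε.le]
    have h5 : ħ ^ d * (couplingCost ħ Q').toReal / (n * Real.exp (lam * |s|)) ≤ n * Real.exp (lam * |s|) := by
      rw [div_le_iff₀ hθ]
      refine hcost.trans ?_
      calc _ ≤ Real.exp (2 * lam * |s|) * n ^ 2 := by gcongr
        _ = Real.exp (lam * |s| + lam * |s|) * n ^ 2 := by congr 2; ring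
        _ = _ := by rw [Real.exp_add]; ring
    calc (B' : ℝ) * (n * Real.exp (lam * |s|) / 2 + ħ ^ d * (couplingCost ħ Q').toReal / (n * Real.exp (lam * |s|)))
        ≤ B' * (n * Real.exp (lam * |s|) / 2 + n * Real.exp (lam * |s|)) := by gcongr
      _ = _ := by ring
  have hest := norm_sub_le_of_mild hM hM' hc hc' (ψ₀ := φ₀) (ψ₀' := φħ₀) (T := S) (by
      have := h.boson_eq S
      simp_rw [hV.potential_spatialDensity] at this
      exact this) (h'.boson_mild hV hω₀ S) hlam0 (by positivity)
    (fun s => (h.norm_boson hV s).le.trans hR) hpot (fun s hs => hb s (Set.uIcc_subset_uIcc_left hS hs))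
  have hstep : m ≤ ‖φ₀ - φħ₀‖ + (3 / 2 * B' * n * R + B * m) / lam := by
    have hE : 1 ≤ Real.exp (lam * |S|) := Real.one_le_exp (by positivity)
    have hK : 0 ≤ (3 / 2 * B' * n * R + B * m) / lam := by positivity
    have h1 : ‖φ S - φħ S‖ ≤ (‖φ₀ - φħ₀‖ + (3 / 2 * B' * n * R + B * m) / lam) * Real.exp (lam * |S|) := by
      nlinarith [norm_nonneg (φ₀ - φħ₀)]
    calc m ≤ (‖φ₀ - φħ₀‖ + (3 / 2 * B' * n * R + B * m) / lam) * Real.exp (lam * |S|)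
          * Real.exp (-(lam * |S|)) := mul_le_mul_of_nonneg_right h1 (Real.exp_pos _).le
      _ = _ := by rw [mul_assoc, mul_comm (Real.exp _), hexp, mul_one]
  -- The rate `λ` is chosen for this step: it is at least twice the coefficient of `√a + ε` and
  -- twice that of `m`. So `m` enters the right-hand side with weight `1/2` and can be absorbed.
  have hhalf : (3 / 2 * B' * n * R + B * m) / lam ≤ (√a + ε + m) / 2 := by
    rw [div_le_div_iff₀ hlam0 two_pos]
    have e1 : (2 : ℝ) * (3 / 2 * B' * R * (2 * B' * R) + B) ≤ lam := by
      rw [hlam, growthRate]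
      have : (0 : ℝ) ≤ 6 + 12 * (L * R ^ 2) ^ 2 + 2 * (3 / 2 * B' * R) := by positivity
      linarith
    have e2 : (2 : ℝ) * (3 / 2 * B' * R) ≤ lam := by
      rw [hlam, growthRate]
      have : (0 : ℝ) ≤ 6 + 12 * (L * R ^ 2) ^ 2 + 2 * (3 / 2 * B' * R * (2 * B' * R) + B) := by positivity
      linarith
    have e3 : 0 ≤ √a + ε := by positivity
    calc (3 / 2 * B' * n * R + B * m) * 2
        = (√a + ε) * (2 * (3 / 2 * B' * R)) + m * (2 * (3 / 2 * B' * R * (2 * B' * R) + B)) := by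
          rw [hn]; ring
      _ ≤ (√a + ε) * lam + m * lam := by gcongr
      _ = _ := by ring
  linarith

theorem quantumWasserstein_term (hħ : 0 < ħ) {c : ℝ≥0∞} (hc : c ≠ ∞) :
    ENNReal.ofReal (ħ ^ ((d : ℝ) / 2)) * c ^ (1 / 2 : ℝ) = ENNReal.ofReal (√(ħ ^ d * c.toReal)) := by
  have h1 : c ^ (1 / 2 : ℝ) = ENNReal.ofReal (√c.toReal) := by
    rw [Real.sqrt_eq_rpow, ← ENNReal.ofReal_rpow_of_nonneg ENNReal.toReal_nonneg (by norm_num),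
      ENNReal.ofReal_toReal hc]
  have h2 : ħ ^ ((d : ℝ) / 2) = √(ħ ^ d) := by
    rw [Real.sqrt_eq_rpow, ← Real.rpow_natCast, ← Real.rpow_mul hħ.le]
    congr 1
    ring
  rw [h1, h2, ← ENNReal.ofReal_mul (by positivity), ← Real.sqrt_mul (by positivity)]

theorem IsCoupling.quantumWasserstein_le {f : PhaseL1 d} {ω : Op d} {Q : Phase d → Op d}
    (hQ : IsCoupling ħ f ω Q) (hħ : 0 < ħ) (hfin : couplingCost ħ Q ≠ ∞) :
    quantumWasserstein ħ f ω ≤ ENNReal.ofReal (√(ħ ^ d * (couplingCost ħ Q).toReal)) := by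
  rw [← quantumWasserstein_term hħ hfin]
  unfold quantumWasserstein
  gcongr
  exact iInf₂_le Q hQ

/-- Passage to the infimum over couplings. Those of infinite cost satisfy the bound trivially
because `c > 0`, and without couplings the right-hand side is infinite. -/
theorem le_mul_quantumWasserstein_add {f : PhaseL1 d} {ω : Op d} (hħ : 0 < ħ) {x δ : ℝ≥0∞} {c : ℝ} (hc : 0 < c)
    (h : ∀ Q, IsCoupling ħ f ω Q → couplingCost ħ Q ≠ ∞ →
      x ≤ ENNReal.ofReal c * (ENNReal.ofReal (√(ħ ^ d * (couplingCost ħ Q).toReal)) + δ)) :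
    x ≤ ENNReal.ofReal c * (quantumWasserstein ħ f ω + δ) := by
  have hc' : ENNReal.ofReal c ≠ 0 := by simpa using hc
  have hħ' : ENNReal.ofReal (ħ ^ ((d : ℝ) / 2)) ≠ 0 := by
    simpa using Real.rpow_pos_of_pos hħ _
  unfold quantumWasserstein
  rw [iInf_subtype', ENNReal.mul_iInf_of_ne hħ' ENNReal.ofReal_ne_top, ENNReal.iInf_add,
    ENNReal.mul_iInf_of_ne hc' ENNReal.ofReal_ne_top]
  refine le_iInf fun Q => ?_
  by_cases hfin : couplingCost ħ Q.1 = ∞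
  · change x ≤ ENNReal.ofReal c * (_ * (couplingCost ħ Q.1) ^ (1 / 2 : ℝ) + δ)
    rw [hfin, ENNReal.top_rpow_of_pos (by norm_num), ENNReal.mul_top hħ', top_add, ENNReal.mul_top hc']
    exact le_top
  · have := h Q.1 Q.2 hfin
    rwa [← quantumWasserstein_term hħ hfin] at this

/-- Stability with an exponential growth rate. -/
theorem quantumWasserstein_add_le (h : IsVlasovHartreeSolution V f₀ φ₀ f φ)
    (h' : IsHartreeHartreeSolution V ħ ω₀ φħ₀ ω φħ) (hV : IsC11With V B B' L) (hħ : 0 < ħ)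
    (hf₀ : IsClassicalState f₀) (hω₀ : IsQuantumState ħ ω₀) {R : ℝ≥0} (hR : ‖φ₀‖ ≤ R) (hR' : ‖φħ₀‖ ≤ R)
    (T : ℝ) {c : ℝ} (hc : (4 * B' * R + 3) * Real.exp (growthRate B B' L R * |T|) ≤ c) :
    quantumWasserstein ħ (f T) (ω T) + ENNReal.ofReal ‖φ T - φħ T‖
      ≤ ENNReal.ofReal c * (quantumWasserstein ħ f₀ ω₀ + ENNReal.ofReal ‖φ₀ - φħ₀‖) := by
  have hc0 : 0 < c := lt_of_lt_of_le (by positivity) hc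
  refine le_mul_quantumWasserstein_add hħ hc0 fun Q hQ hfin => ?_
  set lam := growthRate B B' L R with hlam
  set a := ħ ^ d * (couplingCost ħ Q).toReal with ha
  set δ := ‖φ₀ - φħ₀‖ with hδ
  set m := 2 * δ + √a with hm
  have hδ0 : 0 ≤ δ := norm_nonneg _
  have hlam0 : 0 < lam := growthRate_pos B B' L R
  have ha0 : 0 ≤ a := by positivity
  have hm0 : 0 ≤ m := by positivity
  have hb : ∀ s, ‖φ s - φħ s‖ ≤ m * Real.exp (lam * |s|) := fun s =>
    norm_boson_sub_le h h' hV hħ hf₀ hω₀ hR hR' hQ hfin s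
  obtain ⟨Q', hQ', hfin', hcost⟩ := exists_coupling_evolution h h' hV hħ hf₀ hω₀ hR hR'
    (growthRate_ge B B' L R) (T := T) (fun s _ => hb s) hQ hfin
  have h1 : √(ħ ^ d * (couplingCost ħ Q').toReal) ≤ (√a + 2 * B' * R * m) * Real.exp (lam * |T|) := by
    rw [Real.sqrt_le_left (by positivity)]
    refine hcost.trans ?_
    have h2 : (√a) ^ 2 = a := Real.sq_sqrt ha0
    have h3 : a + (2 * B' * R * m) ^ 2 ≤ (√a + 2 * B' * R * m) ^ 2 := by
      have : (0 : ℝ) ≤ √a * (2 * B' * R * m) := by positivity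
      nlinarith
    calc _ ≤ Real.exp (2 * lam * |T|) * (√a + 2 * B' * R * m) ^ 2 := by gcongr
      _ = Real.exp (lam * |T| + lam * |T|) * (√a + 2 * B' * R * m) ^ 2 := by congr 2; ring
      _ = _ := by rw [Real.exp_add]; ring
  calc quantumWasserstein ħ (f T) (ω T) + ENNReal.ofReal ‖φ T - φħ T‖
      ≤ ENNReal.ofReal ((√a + 2 * B' * R * m) * Real.exp (lam * |T|))
        + ENNReal.ofReal (m * Real.exp (lam * |T|)) := by
        refine add_le_add ((hQ'.quantumWasserstein_le hħ hfin').trans ?_) ?_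
        · exact ENNReal.ofReal_le_ofReal h1
        · exact ENNReal.ofReal_le_ofReal (hb T)
    _ = ENNReal.ofReal ((√a + 2 * B' * R * m) * Real.exp (lam * |T|) + m * Real.exp (lam * |T|)) :=
        (ENNReal.ofReal_add (by positivity) (by positivity)).symm
    _ ≤ ENNReal.ofReal (c * (√a + δ)) := by
        refine ENNReal.ofReal_le_ofReal ?_
        calc (√a + 2 * B' * R * m) * Real.exp (lam * |T|) + m * Real.exp (lam * |T|)
            ≤ ((4 * B' * R + 3) * Real.exp (lam * |T|)) * (√a + δ) := by
              -- After inserting `m = 2δ + √a`, the coefficients are `2B'R + 2` for `√a` and `4B'R +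
              -- 2` for `δ`.
              have e1 : √a + 2 * B' * R * m + m ≤ (4 * B' * R + 3) * (√a + δ) := by
                rw [hm]
                have : (0 : ℝ) ≤ B' * R * √a := by positivity
                nlinarith [Real.sqrt_nonneg a]
              calc _ = (√a + 2 * B' * R * m + m) * Real.exp (lam * |T|) := by ring
                _ ≤ (4 * B' * R + 3) * (√a + δ) * Real.exp (lam * |T|) := by gcongr
                _ = _ := by ring
          _ ≤ c * (√a + δ) := by gcongr
    _ = _ := by
        rw [ENNReal.ofReal_mul hc0.le, ENNReal.ofReal_add (by positivity) hδ0]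

end Stability

/-! ### The theorem: passage from the rate `e^{λ|t|}` to `C e^{Ct²}`. -/

theorem theorem6p4 {d : ℕ} (V : Pos d → ℝ) (hV : IsC11 V) (R : ℝ) :
    ∃ C : ℝ, 0 < C ∧
      ∀ (ħ : ℝ), 0 < ħ →
      ∀ (f₀ : PhaseL1 d) (φ₀ : L2 d) (ω₀ : Op d) (φħ₀ : L2 d),
        IsClassicalState f₀ → IsQuantumState ħ ω₀ → ‖φ₀‖ ≤ R → ‖φħ₀‖ ≤ R →
      ∀ (f : ℝ → PhaseL1 d) (φ : ℝ → L2 d) (ω : ℝ → Op d) (φħ : ℝ → L2 d),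
        IsVlasovHartreeSolution V f₀ φ₀ f φ →
        IsHartreeHartreeSolution V ħ ω₀ φħ₀ ω φħ →
      ∀ t : ℝ,
        IsClassicalState (f t) ∧ IsQuantumState ħ (ω t) ∧
        quantumWasserstein ħ (f t) (ω t) + ENNReal.ofReal ‖φ t - φħ t‖
          ≤ ENNReal.ofReal (C * Real.exp (C * t ^ 2)) *
            (quantumWasserstein ħ f₀ ω₀ + ENNReal.ofReal ‖φ₀ - φħ₀‖) := by
  obtain ⟨B, B', L, hV'⟩ := hV.exists_with
  set lam := growthRate B B' L R.toNNReal with hlam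
  have hlam0 : 0 < lam := growthRate_pos B B' L R.toNNReal
  set K : ℝ := (4 * B' * R.toNNReal + 3) * Real.exp lam with hK
  have hK0 : 0 < K := by positivity
  refine ⟨K + lam, by positivity, ?_⟩
  intro ħ hħ f₀ φ₀ ω₀ φħ₀ hf₀ hω₀ hR hR' f φ ω φħ h h' t
  refine ⟨h.isClassicalState hV' hf₀ t, h'.isQuantumState hV' hħ hω₀ t,
    quantumWasserstein_add_le h h' hV' hħ hf₀ hω₀ (hR.trans (Real.le_coe_toNNReal R))
      (hR'.trans (Real.le_coe_toNNReal R)) t ?_⟩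
  -- Replacing `|t|` by `1 + t²` costs the factor `e^λ`, which is part of `K`. Then `K + λ` serves
  -- both as prefactor and as rate.
  have ht : |t| ≤ 1 + t ^ 2 := by
    rw [← sq_abs]
    nlinarith [sq_nonneg (|t| - 1), abs_nonneg t]
  calc (4 * B' * R.toNNReal + 3) * Real.exp (lam * |t|)
      ≤ (4 * B' * R.toNNReal + 3) * Real.exp (lam * (1 + t ^ 2)) := by gcongr
    _ = K * Real.exp (lam * t ^ 2) := by rw [mul_add, mul_one, Real.exp_add, hK]; ring
    _ ≤ (K + lam) * Real.exp ((K + lam) * t ^ 2) := by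
        gcongr
        · linarith
        · linarith
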